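/- **Setting.** Let $\mathtt M$ be a pointed model category with functorial factorizations, with zero object $0$, and let $\gamma:\mathtt M\to\mathtt{Ho}(\mathtt M)$ be the localization at the weak equivalences. We also write $0$ for the images in $\mathtt{Ho}(\mathtt M)$ of zero morphisms. *Homotopy fiber sequences.* A commutative square with vertices $X,\mathcal X,X_3,\mathfrak X$ (morphisms $f:X\to\mathcal X$, $X\to X_3$, $g:\mathcal X\to\mathfrak X$, $X_3\to\mathfrak X$) is a *model square* if there is an objectwise weak equivalence from the cospan $X_3\to\mathfrak X\leftarrow\mathcal X$ to a cospan $C\to D\leftarrow B$ of fibrant objects, at least one of whose morphisms is a fibration, such that the induced morphism $X\to B\times_DC$ is a weak equivalence. It is a *homotopy fiber sequence* $X\xrightarrow{f}\mathcal X\xrightarrow{g}\mathfrak X$ if moreover $X_3$ is acyclic ($0\to X_3$ is a weak equivalence). Let $h(\mathtt M)$ be the category of homotopy fiber sequences and commutative cubes, $\mathtt{Ho}(h(\mathtt M))$ its localization at the objectwise weak equivalences, and $\mathtt{Ho}(\mathtt M^{\to})$ the localization of the category of morphisms of $\mathtt M$ at the objectwise weak equivalences. A morphism of $\mathtt{Ho}(h(\mathtt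 M))$ is said to *extend* its image in $\mathtt{Ho}(\mathtt M^\to)$ under the localization of the restriction functor $(X\to\mathcal X\to\mathfrak X)\mapsto(\mathcal X\to\mathfrak X)$; its image in $\mathtt{Ho}(\mathtt M)$ under the localization of $(X\to\mathcal X\to\mathfrak X)\mapsto X$ is its *fiber component*. *Path and loop spaces.* Fix a factorization $X\xrightarrow{s}\mathrm{Path}\,X\xrightarrow{(d_0,d_1)}X\times X$ of the diagonal into a weak equivalence followed by a fibration, functorial in $X$. Put $\Omega^QX=\ker(d_0,d_1)$ and $\mathrm{Path}_0X=\ker d_0$, with the projection $\mathrm{Path}_0X\to X$ induced by $d_1$; the kernel of this projection is identified with $\Omega^QX$. Let $\mathbb R\Omega^Q:\mathtt{Ho}(\mathtt M)\to\mathtt{Ho}(\mathtt M)$ be the right derived functor (Kan extension) of $\Omega^Q$. *The connecting morphism $\Delta$.* For $g:\mathcal X\to\mathfrak X$ between fibrant objects let $K_g=\mathrm{Path}_0\mathfrak X\times_{\mathfrak X}\mathcal X$, and let $\delta_g:\Omega^Q\mathfrak X\to K_g$ be induced by the inclusion into $\mathrm{Path}_0\mathfrak X$ and $0:\Omega^Q\mathfrak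 X\to\mathcal X$. Then $K_g\to\mathcal X\xrightarrow{g}\mathfrak X$ (with fourth vertex $\mathrm{Path}_0\mathfrak X$) is a homotopy fiber sequence. For an objectwise fibrant homotopy fiber sequence $X\xrightarrow{f}\mathcal X\xrightarrow{g}\mathfrak X$ put $$\Delta:\ \Omega^Q\mathfrak X\xrightarrow{\gamma(\delta_g)}K_g\xrightarrow{\ \varepsilon\ }X ,$$ where $\varepsilon$ is the fiber component of the morphism $\Xi$ from $K_g\to\mathcal X\to\mathfrak X$ to $X\to\mathcal X\to\mathfrak X$ in $\mathtt{Ho}(h(\mathtt M))$ that extends $\mathrm{id}_g$. *Quillen's action.* Let $p:U\to V$ be a fibration between fibrant objects with kernel $\kappa:K\to U$. Choose a path object $U\xrightarrow{\sim}I\xrightarrow{(p_0,p_1)}U\times U$ and a morphism $q:I\to\mathrm{Path}\,V$ compatible with $p$, with the constant paths and with start and end points, such that $I\to\mathrm{Path}\,V\times_{V\times V}(U\times U)$ is a fibration. Let $N=I\times_{U\times U}(K\times K)$, with start and end points $e_0,e_1:N\to K$. The morphism $(q,e_1):N\to\Omega^QV\times K$ is a trivial fibration, and $$\rho=\gamma(e_0)\circ\gamma(q,e_1)^{-1}:\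 \Omega^QV\times K\to K$$ in $\mathtt{Ho}(\mathtt M)$ does not depend on the choice (a loop is lifted to a path with prescribed end point, and the start point is taken). *Fibration sequences.* A *fibration sequence* in $\mathtt{Ho}(\mathtt M)$ is a sequence $X\to Y\to Z$ in $\mathtt{Ho}(\mathtt M)$ together with a morphism $R:\mathbb R\Omega^Q(Z)\times_{\mathtt{Ho}(\mathtt M)}X\to X$ such that, for some fibration $p:U\to V$ between fibrant objects with kernel $\kappa:K\to U$, there are isomorphisms $i:X\cong K$, $j:Y\cong U$, $k:Z\cong V$ of $\mathtt{Ho}(\mathtt M)$ from the sequence $X\to Y\to Z$ to the sequence $K\xrightarrow{\gamma\kappa}U\xrightarrow{\gamma p}V$ (so that both squares commute) for which $i\circ R\circ(\tilde k^{-1}\times i^{-1})=\rho$, where $\tilde k:\mathbb R\Omega^Q(Z)\cong\Omega^QV$ is induced by $k$. Its connecting morphism is $\Delta^Q=R\circ(\mathrm{id},0):\mathbb R\Omega^Q(Z)\to X$. **Theorem.** Let $X\xrightarrow{f}\mathcal X\xrightarrow{g}\mathfrak X$ be a homotopy fiber sequence of $\mathtt M$ whose four vertices are fibrant. Then: 1.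 There is exactly one morphism $\Xi$ of $\mathtt{Ho}(h(\mathtt M))$ from $K_g\to\mathcal X\to\mathfrak X$ to $X\to\mathcal X\to\mathfrak X$ that extends $\mathrm{id}_g$, so that $\Delta$ is defined. The canonical morphism $\Omega^Q\mathfrak X\to\mathbb R\Omega^Q(\mathfrak X)$ is an isomorphism, and concatenation of loops makes $\Omega^Q\mathfrak X\cong\mathbb R\Omega^Q(\mathfrak X)$ a group object of $\mathtt{Ho}(\mathtt M)$ with unit $0$. 2. There is a left action $R:\mathbb R\Omega^Q(\mathfrak X)\times_{\mathtt{Ho}(\mathtt M)}X\to X$ of this group object with which $X\xrightarrow{\gamma f}\mathcal X\xrightarrow{\gamma g}\mathfrak X$ is a fibration sequence in $\mathtt{Ho}(\mathtt M)$. It is the canonical one: for every factorization $\mathcal X\xrightarrow{w}U\xrightarrow{p}\mathfrak X$ of $g$ into a weak equivalence $w$ and a fibration $p$ with $U$ fibrant, with $K=\ker p$, there is exactly one isomorphism of $\mathtt{Ho}(h(\mathtt M))$ from $X\to\mathcal X\to\mathfrak X$ to $K\to U\to\mathfrak X$ that extends the class of $(w,\mathrm{id}_{\mathfrak X}):g\to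 p$, and if $i$ is its fiber component, then the conditions on a fibration sequence hold for this $R$ with the isomorphisms $i$, $j=\gamma(w)$ and $k=\mathrm{id}_{\mathfrak X}$. 3. Under the identification $\Omega^Q\mathfrak X\cong\mathbb R\Omega^Q(\mathfrak X)$, the connecting morphism $\Delta$ coincides with the connecting morphism $\Delta^Q$ of this fibration sequence: $\Delta=\Delta^Q$. -/

import Mathlib

open CategoryTheory Limits HomotopicalAlgebra ZeroObject

universe v u

namespace HoFib

/-! ### The homotopy category -/

/-- The Quillen homotopy category `Ho(M)`: the strict localization of `M` at its weak
equivalences. It has the same objects as `M`. -/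
abbrev HoCat (M : Type u) [Category.{v} M] [ModelCategory M] : Type u :=
  (weakEquivalences M).Localization

/-- The localization functor `γ : M ⥤ Ho(M)`. -/
abbrev toHo (M : Type u) [Category.{v} M] [ModelCategory M] : M ⥤ HoCat M :=
  (weakEquivalences M).Q

/-- The isomorphism of `Ho(M)` given by a weak equivalence of `M`. -/
noncomputable def hoIso {M : Type u} [Category.{v} M] [ModelCategory M] {A B : M} (w : A ⟶ B)
    [hw : WeakEquivalence w] : (toHo M).obj A ≅ (toHo M).obj B :=
  Localization.isoOfHom (toHo M) (weakEquivalences M) w ((weakEquivalence_iff w).1 hw)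

section Pointed

variable {M : Type u} [Category.{v} M] [ModelCategory M] [HasZeroObject M] [HasZeroMorphisms M]

/-- The zero morphism of `Ho(M)` between two objects (which are objects of `M`): the image
under `γ` of the zero morphism of `M`. -/
def hoZero (A B : HoCat M) : A ⟶ B :=
  (toHo M).map (0 : (Localization.Construction.objEquiv (weakEquivalences M)).symm A ⟶
    (Localization.Construction.objEquiv (weakEquivalences M)).symm B)

end Pointed

/-! ### Model squares and homotopy fiber sequences -/

section ModelSquare

variable {M : Type u} [Category.{v} M] [ModelCategory M]

/-- A commutative square
```
X₁ --> X₂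
|      |
v      v
X₃ --> X₄
```
is a model square (its vertex `X₁` is a model of the homotopy pullback) if there is a weak
equivalence, from the cospan `X₃ ⟶ X₄ ⟵ X₂` to a cospan `C ⟶ D ⟵ B` of fibrant objects at
least one of whose morphisms is a fibration, such that the universal morphism
`X₁ ⟶ B ×_D C` is a weak equivalence. -/
def IsModelSquare (sq : Square M) : Prop :=
  ∃ (B C D : M) (r : B ⟶ D) (s : C ⟶ D)
    (b : sq.X₂ ⟶ B) (c : sq.X₃ ⟶ C) (d : sq.X₄ ⟶ D)
    (hb : sq.f₂₄ ≫ d = b ≫ r) (hc : sq.f₃₄ ≫ d = c ≫ s),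
    IsFibrant B ∧ IsFibrant C ∧ IsFibrant D ∧ (Fibration r ∨ Fibration s) ∧
    WeakEquivalence b ∧ WeakEquivalence c ∧ WeakEquivalence d ∧
    WeakEquivalence (pullback.lift (f := r) (g := s) (sq.f₁₂ ≫ b) (sq.f₁₃ ≫ c)
      (by rw [Category.assoc, Category.assoc, ← hb, ← hc, ← Category.assoc, sq.fac,
        Category.assoc]))

lemma isModelSquare_of_isPullback (sq : Square M)
    (h : IsPullback sq.f₁₂ sq.f₁₃ sq.f₂₄ sq.f₃₄)
    (h₂ : IsFibrant sq.X₂) (h₃ : IsFibrant sq.X₃) (h₄ : IsFibrant sq.X₄)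
    (hfib : Fibration sq.f₂₄ ∨ Fibration sq.f₃₄) : IsModelSquare sq := by
  refine ⟨sq.X₂, sq.X₃, sq.X₄, sq.f₂₄, sq.f₃₄, 𝟙 _, 𝟙 _, 𝟙 _, by simp, by simp, h₂, h₃, h₄,
    hfib, inferInstance, inferInstance, inferInstance, ?_⟩
  have : pullback.lift (f := sq.f₂₄) (g := sq.f₃₄) (sq.f₁₂ ≫ 𝟙 _) (sq.f₁₃ ≫ 𝟙 _)
      (by simpa using sq.fac) = h.isoPullback.hom := by
    apply pullback.hom_ext
    · rw [pullback.lift_fst, h.isoPullback_hom_fst, Category.comp_id]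
    · rw [pullback.lift_snd, h.isoPullback_hom_snd, Category.comp_id]
  rw [this]
  infer_instance

end ModelSquare

section HoFibSeq

variable (M : Type u) [Category.{v} M] [ModelCategory M] [HasZeroObject M] [HasZeroMorphisms M]

/-- A homotopy fiber sequence `X₁ ⟶ X₂ ⟶ X₄` is a model square whose lower left vertex `X₃`
is acyclic. -/
def IsHoFibSeq : ObjectProperty (Square M) := fun sq =>
  IsModelSquare sq ∧ WeakEquivalence (0 : (0 : M) ⟶ sq.X₃)

/-- The category `h(M)` of homotopy fiber sequences; its morphisms are commutative cubes. -/
abbrev HoFibSeq := (IsHoFibSeq M).FullSubcategory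

/-- The objectwise weak equivalences of `h(M)`. -/
def seqWeq : MorphismProperty (HoFibSeq M) := fun _ _ φ =>
  WeakEquivalence φ.hom.τ₁ ∧ WeakEquivalence φ.hom.τ₂ ∧
    WeakEquivalence φ.hom.τ₃ ∧ WeakEquivalence φ.hom.τ₄

/-- The restriction functor from `h(M)` to the category of morphisms of `M`, which sends
`X₁ ⟶ X₂ ⟶ X₄` to `X₂ ⟶ X₄`. -/
@[simps]
def restr : HoFibSeq M ⥤ Arrow M where
  obj x := Arrow.mk x.obj.f₂₄
  map φ := Arrow.homMk φ.hom.τ₂ φ.hom.τ₄ φ.hom.comm₂₄.symm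

/-- The functor `h(M) ⥤ M` which sends `X₁ ⟶ X₂ ⟶ X₄` to `X₁`. -/
@[simps]
def fiberObj : HoFibSeq M ⥤ M where
  obj x := x.obj.X₁
  map φ := φ.hom.τ₁

/-- The localization of the restriction functor, from `Ho(h(M))` to the homotopy category of
the category of morphisms of `M` (with objectwise weak equivalences). -/
noncomputable def hoRestr : (seqWeq M).Localization ⥤ (weakEquivalences M).arrow.Localization :=
  Localization.Construction.lift (restr M ⋙ (weakEquivalences M).arrow.Q)
    (fun _ _ _ hφ => (weakEquivalences M).arrow.Q_inverts _
      ⟨(weakEquivalence_iff _).1 hφ.2.1, (weakEquivalence_iff _).1 hφ.2.2.2⟩)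

/-- The localization `Ho(h(M)) ⥤ Ho(M)` of the functor `X₁ ⟶ X₂ ⟶ X₄ ↦ X₁`. -/
noncomputable def hoFiberObj : (seqWeq M).Localization ⥤ HoCat M :=
  Localization.Construction.lift (fiberObj M ⋙ toHo M)
    (fun _ _ _ hφ => (weakEquivalences M).Q_inverts _ ((weakEquivalence_iff _).1 hφ.1))

variable {M}

variable {x y : HoFibSeq M}

/-- `Ξ : x ⟶ y` in `Ho(h(M))` extends a morphism `ξ` between the restrictions of `x` and `y`. -/
def Extends (Ξ : (seqWeq M).Q.obj x ⟶ (seqWeq M).Q.obj y)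
    (ξ : (weakEquivalences M).arrow.Q.obj (Arrow.mk x.obj.f₂₄) ⟶
      (weakEquivalences M).arrow.Q.obj (Arrow.mk y.obj.f₂₄)) : Prop :=
  (hoRestr M).map Ξ = ξ

/-- The morphism `X₁ ⟶ Y₁` in `Ho(M)` that underlies a morphism `Ξ : x ⟶ y` in `Ho(h(M))`. -/
noncomputable def onFiber (Ξ : (seqWeq M).Q.obj x ⟶ (seqWeq M).Q.obj y) :
    (toHo M).obj x.obj.X₁ ⟶ (toHo M).obj y.obj.X₁ :=
  (hoFiberObj M).map Ξ

end HoFibSeq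

/-! ### Fibers of fibrations -/

section BaseChange

variable {M : Type u} [Category.{v} M] [ModelCategory M]

lemma weakEquivalence_of_isPullback {A B C D : M} {f : A ⟶ B} {g : A ⟶ C} {h : B ⟶ D}
    {k : C ⟶ D} (sq : IsPullback f g h k) [Fibration h] [WeakEquivalence h] :
    WeakEquivalence g := by
  rw [weakEquivalence_iff]
  exact (MorphismProperty.of_isPullback sq (mem_trivialFibrations h)).2

lemma fibration_of_isPullback {A B C D : M} {f : A ⟶ B} {g : A ⟶ C} {h : B ⟶ D}
    {k : C ⟶ D} (sq : IsPullback f g h k) [Fibration h] : Fibration g := by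
  rw [fibration_iff]
  exact MorphismProperty.of_isPullback sq (mem_fibrations h)

lemma weakEquivalence_prod_map {X Y : M} (f : X ⟶ Y) [Fibration f] [WeakEquivalence f] :
    WeakEquivalence (prod.map f f) := by
  have : trivialFibrations M (prod.map f f) := by
    apply MorphismProperty.limMap
    rintro (_ | _) <;> exact mem_trivialFibrations f
  rw [weakEquivalence_iff]
  exact this.2

end BaseChange

lemma isFibrant_zero (M : Type u) [Category.{v} M] [ModelCategory M] [HasZeroObject M] : IsFibrant (0 : M) := by
  have : IsIso (terminal.from (0 : M)) :=
    isIso_of_isTerminal (isZero_zero M).isTerminal terminalIsTerminal _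
  infer_instance

section Kernels

variable {M : Type u} [Category.{v} M] [ModelCategory M] [HasZeroObject M] [HasZeroMorphisms M]

lemma isPullback_kernel {U V : M} (p : U ⟶ V) :
    IsPullback (kernel.ι p) (0 : kernel p ⟶ 0) p (0 : (0 : M) ⟶ V) where
  w := by simp
  isLimit' := ⟨PullbackCone.IsLimit.mk _
    (fun s => kernel.lift p s.fst (by rw [s.condition]; simp))
    (fun s => by simp) (fun s => (isZero_zero M).eq_of_tgt _ _)
    (fun s m hm _ => by
      rw [← cancel_mono (kernel.ι p), hm, kernel.lift_ι])⟩

/-- The homotopy fiber sequence `K ⟶ U ⟶ V` (with implicit vertex `0`) given by the kernel of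
a fibration `p : U ⟶ V` between fibrant objects. -/
noncomputable def kernelSeq {U V : M} (p : U ⟶ V) [hp : Fibration p] [hU : IsFibrant U]
    [hV : IsFibrant V] : HoFibSeq M where
  obj :=
    { f₁₂ := kernel.ι p
      f₁₃ := (0 : kernel p ⟶ 0)
      f₂₄ := p
      f₃₄ := (0 : (0 : M) ⟶ V)
      fac := by simp }
  property := by
    refine ⟨isModelSquare_of_isPullback _ (isPullback_kernel p) hU (isFibrant_zero M) hV
      (Or.inl hp), ?_⟩
    have : (0 : (0 : M) ⟶ 0) = 𝟙 _ := (isZero_zero M).eq_of_tgt _ _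
    dsimp
    rw [this]
    infer_instance

/-- The kernel of a composite `q ≫ p` maps to the kernel of `p` by a base change of `q`. -/
lemma isPullback_kernel_map {U V W : M} (q : U ⟶ V) (p : V ⟶ W) (r : U ⟶ W) (h : q ≫ p = r) :
    IsPullback (kernel.ι r) (kernel.lift p (kernel.ι r ≫ q) (by simp [h])) q (kernel.ι p) := by
  subst h
  refine IsPullback.of_bot ?_ (by simp) (isPullback_kernel p)
  convert isPullback_kernel (q ≫ p) using 1
  exact (isZero_zero M).eq_of_tgt _ _

/-- A weak equivalence between fibrations over the same object induces a weak equivalence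
between their kernels. -/
lemma weakEquivalence_kernel_lift {E E' B : M} (e : E ⟶ B) (e' : E' ⟶ B) (h : E ⟶ E')
    (w : h ≫ e' = e) [Fibration e] [Fibration e'] [WeakEquivalence h] :
    WeakEquivalence (kernel.lift e' (kernel.ι e ≫ h) (by simp [w])) := by
  let l : E ⟶ pullback e e' := pullback.lift (𝟙 E) h (by simp [w])
  let F := MorphismProperty.factorizationData (trivialCofibrations M) (fibrations M) l
  have hi : WeakEquivalence F.i := by
    rw [weakEquivalence_iff]; exact F.hi.2
  have hp : Fibration F.p := by
    rw [fibration_iff]; exact F.hp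
  let a : F.Z ⟶ E := F.p ≫ pullback.fst e e'
  let b : F.Z ⟶ E' := F.p ≫ pullback.snd e e'
  have ha : F.i ≫ a = 𝟙 E := by
    simp only [a, F.fac_assoc, l, pullback.lift_fst]
  have hb : F.i ≫ b = h := by
    simp only [b, F.fac_assoc, l, pullback.lift_snd]
  have hab : a ≫ e = b ≫ e' := by
    simp only [a, b, Category.assoc, pullback.condition]
  have : WeakEquivalence a := weakEquivalence_of_precomp_of_fac ha
  have : WeakEquivalence b := weakEquivalence_of_precomp_of_fac hb
  have ka := weakEquivalence_of_isPullback (isPullback_kernel_map a e (b ≫ e') hab)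
  have kb := weakEquivalence_of_isPullback (isPullback_kernel_map b e' (b ≫ e') rfl)
  let ki : kernel e ⟶ kernel (b ≫ e') := kernel.lift _ (kernel.ι e ≫ F.i) (by
    rw [Category.assoc, reassoc_of% hb, w]; exact kernel.condition e)
  have : WeakEquivalence ki := by
    have h0 : (kernel.ι (b ≫ e') ≫ a) ≫ e = 0 :=
      (Category.assoc _ _ _).trans ((congrArg _ hab).trans (kernel.condition _))
    refine weakEquivalence_of_postcomp_of_fac (fg := 𝟙 _) (g := kernel.lift e
      (kernel.ι (b ≫ e') ≫ a) h0) ?_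
    rw [← cancel_mono (kernel.ι e)]
    simp [ki, ha]
  have : kernel.lift e' (kernel.ι e ≫ h) (by simp [w]) =
      ki ≫ kernel.lift e' (kernel.ι (b ≫ e') ≫ b) (by simp) := by
    rw [← cancel_mono (kernel.ι e')]
    simp [ki, hb]
  rw [this]
  infer_instance

end Kernels

/-! ### Path spaces and loop spaces -/

section Paths

variable (M : Type u) [Category.{v} M] [ModelCategory M] [HasZeroObject M] [HasZeroMorphisms M]

/-- A path space functor: a factorization `X ⟶ Path X ⟶ X ⨯ X` of the diagonal into a weak
equivalence `s` followed by a fibration `(d₀, d₁)`, functorial in `X`. -/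
structure PathSpaceFunctor where
  /-- the functor `Path` -/
  Path : M ⥤ M
  /-- constant paths -/
  s (X : M) : X ⟶ Path.obj X
  /-- start points -/
  d₀ (X : M) : Path.obj X ⟶ X
  /-- end points -/
  d₁ (X : M) : Path.obj X ⟶ X
  s_naturality {X Y : M} (f : X ⟶ Y) : s X ≫ Path.map f = f ≫ s Y
  d₀_naturality {X Y : M} (f : X ⟶ Y) : Path.map f ≫ d₀ Y = d₀ X ≫ f
  d₁_naturality {X Y : M} (f : X ⟶ Y) : Path.map f ≫ d₁ Y = d₁ X ≫ f
  s_d₀ (X : M) : s X ≫ d₀ X = 𝟙 X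
  s_d₁ (X : M) : s X ≫ d₁ X = 𝟙 X
  weakEquivalence_s (X : M) : WeakEquivalence (s X)
  fibration_d (X : M) : Fibration (prod.lift (d₀ X) (d₁ X))

/-- A based path space functor: an endofunctor `Path₀` with a natural transformation
`π` from `Path₀` to the identity whose components at fibrant objects are fibrations
with acyclic domain. -/
structure BasedPathSpaceFunctor where
  /-- the functor `Path₀` -/
  Path₀ : M ⥤ M
  /-- end points -/
  π (X : M) : Path₀.obj X ⟶ X
  π_naturality {X Y : M} (f : X ⟶ Y) : Path₀.map f ≫ π Y = π X ≫ f
  fibration_π (X : M) [IsFibrant X] : Fibration (π X)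
  acyclic (X : M) [IsFibrant X] : WeakEquivalence (0 : (0 : M) ⟶ Path₀.obj X)

variable {M}

namespace BasedPathSpaceFunctor

variable (B : BasedPathSpaceFunctor M)

/-- The loop space `Ω X`: the kernel of `π : Path₀ X ⟶ X`. -/
noncomputable abbrev loopObj (X : M) : M := kernel (B.π X)

/-- The homotopy kernel `K_f = Path₀ Y ×_Y X` of `f : X ⟶ Y`. -/
noncomputable abbrev hoKernel {X Y : M} (f : X ⟶ Y) : M := pullback (B.π Y) f

/-- The universal morphism `δ_f : Ω Y ⟶ K_f`. -/
noncomputable def δ {X Y : M} (f : X ⟶ Y) : B.loopObj Y ⟶ B.hoKernel f :=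
  pullback.lift (kernel.ι (B.π Y)) 0 (by simp)

/-- The homotopy fiber sequence `K_g ⟶ X ⟶ Y` (with implicit vertex `Path₀ Y`) of a morphism
`g : X ⟶ Y` between fibrant objects. -/
noncomputable def hoKernelSeq {X Y : M} (g : X ⟶ Y) [hX : IsFibrant X] [hY : IsFibrant Y] :
    HoFibSeq M where
  obj :=
    { f₁₂ := pullback.snd (B.π Y) g
      f₁₃ := pullback.fst (B.π Y) g
      f₂₄ := g
      f₃₄ := B.π Y
      fac := pullback.condition.symm }
  property := by
    have := B.fibration_π Y
    exact ⟨isModelSquare_of_isPullback _ (IsPullback.of_hasPullback _ _).flip hX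
      (isFibrant_of_fibration (B.π Y)) hY (Or.inr (B.fibration_π Y)), B.acyclic Y⟩

end BasedPathSpaceFunctor

namespace PathSpaceFunctor

variable (P : PathSpaceFunctor M)

/-- `Path X` as a path object of `X`. -/
def pathObject (X : M) : PathObject X where
  P := P.Path.obj X
  p₀ := P.d₀ X
  p₁ := P.d₁ X
  ι := P.s X
  ι_p₀ := P.s_d₀ X
  ι_p₁ := P.s_d₁ X
  weakEquivalence_ι := P.weakEquivalence_s X

instance (X : M) : (P.pathObject X).IsGood := ⟨P.fibration_d X⟩

/-- The morphism `(d₀, d₁) : Path X ⟶ X ⨯ X`. -/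
noncomputable abbrev d (X : M) : P.Path.obj X ⟶ X ⨯ X := prod.lift (P.d₀ X) (P.d₁ X)

lemma d_fst (X : M) : P.d X ≫ prod.fst = P.d₀ X := prod.lift_fst _ _

lemma d_snd (X : M) : P.d X ≫ prod.snd = P.d₁ X := prod.lift_snd _ _

lemma kernel_d₀ (X : M) : kernel.ι (P.d X) ≫ P.d₀ X = 0 := by
  rw [← P.d_fst, kernel.condition_assoc, zero_comp]

lemma kernel_d₁ (X : M) : kernel.ι (P.d X) ≫ P.d₁ X = 0 := by
  rw [← P.d_snd, kernel.condition_assoc, zero_comp]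

/-- Quillen's loop space functor `Ω^Q`: the kernel of `Path X ⟶ X ⨯ X`. -/
noncomputable def loop : M ⥤ M where
  obj X := kernel (P.d X)
  map {X Y} f := kernel.map (P.d X) (P.d Y) (P.Path.map f) (prod.map f f) (by
    apply Limits.prod.hom_ext
    · simp only [Category.assoc, prod.lift_fst, prod.map_fst, prod.lift_fst_assoc]
      exact (P.d₀_naturality f).symm
    · simp only [Category.assoc, prod.lift_snd, prod.map_snd, prod.lift_snd_assoc]
      exact (P.d₁_naturality f).symm)
  map_id X := by
    rw [← cancel_mono (kernel.ι _)]
    simp [kernel.map]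
  map_comp f g := by
    rw [← cancel_mono (kernel.ι _)]
    simp [kernel.map]

/-- The inclusion of the loops into the paths. -/
noncomputable def loopι (X : M) : P.loop.obj X ⟶ P.Path.obj X := kernel.ι (P.d X)

lemma loopι_d₀ (X : M) : P.loopι X ≫ P.d₀ X = 0 := P.kernel_d₀ X

lemma loopι_d₁ (X : M) : P.loopι X ≫ P.d₁ X = 0 := P.kernel_d₁ X

/-- A path whose end points are the base point, seen as a loop. -/
noncomputable def loopLift {A X : M} (a : A ⟶ P.Path.obj X) (h₀ : a ≫ P.d₀ X = 0)
    (h₁ : a ≫ P.d₁ X = 0) : A ⟶ P.loop.obj X :=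
  kernel.lift (P.d X) a (by
    apply Limits.prod.hom_ext
    · rw [Category.assoc, P.d_fst, h₀, zero_comp]
    · rw [Category.assoc, P.d_snd, h₁, zero_comp])

lemma weakEquivalence_loop_map_of_fibration {X Y : M} (f : X ⟶ Y) [IsFibrant X]
    [Fibration f] [WeakEquivalence f] : WeakEquivalence (P.loop.map f) := by
  have := P.fibration_d X
  have := P.fibration_d Y
  have := P.weakEquivalence_s X
  have := P.weakEquivalence_s Y
  have := weakEquivalence_prod_map f
  have hP : WeakEquivalence (P.Path.map f) := by
    have h : P.s X ≫ P.Path.map f = f ≫ P.s Y := P.s_naturality f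
    have : WeakEquivalence (f ≫ P.s Y) := inferInstance
    exact weakEquivalence_of_precomp_of_fac h
  have hd : P.Path.map f ≫ P.d Y = P.d X ≫ prod.map f f := by
    apply Limits.prod.hom_ext
    · simp only [Category.assoc, prod.lift_fst, prod.map_fst, prod.lift_fst_assoc]
      exact P.d₀_naturality f
    · simp only [Category.assoc, prod.lift_snd, prod.map_snd, prod.lift_snd_assoc]
      exact P.d₁_naturality f
  let h : P.Path.obj X ⟶ pullback (P.d Y) (prod.map f f) := pullback.lift (P.Path.map f) (P.d X) hd
  have hh : WeakEquivalence h :=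
    weakEquivalence_of_postcomp_of_fac (g := pullback.fst (P.d Y) (prod.map f f))
      (fg := P.Path.map f) (pullback.lift_fst _ _ _)
  have h1 := weakEquivalence_kernel_lift (P.d X) (pullback.snd (P.d Y) (prod.map f f)) h
    (pullback.lift_snd _ _ _)
  have sq := (isPullback_kernel (pullback.snd (P.d Y) (prod.map f f))).flip.paste_vert
    (IsPullback.of_hasPullback (P.d Y) (prod.map f f)).flip
  have sq' : IsPullback (0 : _ ⟶ (0 : M)) (kernel.ι (pullback.snd (P.d Y) (prod.map f f)) ≫
      pullback.fst (P.d Y) (prod.map f f)) 0 (P.d Y) := by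
    simpa using sq
  let e := sq'.isoIsPullback _ _ (isPullback_kernel (P.d Y)).flip
  have he : e.hom ≫ kernel.ι (P.d Y) = kernel.ι (pullback.snd (P.d Y) (prod.map f f)) ≫
      pullback.fst (P.d Y) (prod.map f f) := IsPullback.isoIsPullback_hom_snd _ _ _ _
  have h0 : (kernel.ι (P.d X) ≫ h) ≫ pullback.snd (P.d Y) (prod.map f f) = 0 := by
    rw [Category.assoc, pullback.lift_snd, kernel.condition]
  have key : kernel.map (P.d X) (P.d Y) (P.Path.map f) (prod.map f f) hd.symm =
      kernel.lift (pullback.snd (P.d Y) (prod.map f f)) (kernel.ι (P.d X) ≫ h)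
        h0 ≫ e.hom := by
    refine (cancel_mono (kernel.ι (P.d Y))).1 ?_
    refine Eq.trans ?_ (Category.assoc _ _ _).symm
    rw [he, kernel.lift_ι_assoc]
    refine (kernel.lift_ι _ _ _).trans ?_
    exact ((Category.assoc _ _ _).trans (congrArg _ (pullback.lift_fst _ _ _))).symm
  change WeakEquivalence (kernel.map (P.d X) (P.d Y) (P.Path.map f) (prod.map f f) hd.symm)
  rw [key]
  have h2 : WeakEquivalence e.hom := inferInstance
  rw [weakEquivalence_iff] at h1 h2 ⊢
  exact (weakEquivalences M).comp_mem _ _ h1 h2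

lemma weakEquivalence_loop_map {X Y : M} (f : X ⟶ Y) [IsFibrant X] [IsFibrant Y]
    [WeakEquivalence f] : WeakEquivalence (P.loop.map f) := by
  let F : FibrantBrownFactorization f := Classical.arbitrary _
  have hi : WeakEquivalence F.i := by
    rw [weakEquivalence_iff]; exact F.hi.2
  have hp : Fibration F.p := by
    rw [fibration_iff]; exact F.hp
  have : IsFibrant F.Z := isFibrant_of_fibration F.p
  have := P.weakEquivalence_loop_map_of_fibration F.p
  have := P.weakEquivalence_loop_map_of_fibration F.r
  have h : P.loop.map F.i ≫ P.loop.map F.r = 𝟙 _ := by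
    rw [← P.loop.map_comp, F.i_r, P.loop.map_id]
  have : WeakEquivalence (P.loop.map F.i) := weakEquivalence_of_postcomp_of_fac h
  rw [← F.fac, P.loop.map_comp]
  infer_instance

instance : (P.loop ⋙ toHo M).HasRightDerivedFunctor (weakEquivalences M) := by
  have h : (FibrantObject.localizerMorphism M).Derives (P.loop ⋙ toHo M) := by
    intro X Y f hf
    have : WeakEquivalence f.hom := (weakEquivalence_iff _).2 hf
    exact (weakEquivalences M).Q_inverts _
      ((weakEquivalence_iff _).1 (P.weakEquivalence_loop_map f.hom))
  have := h.hasPointwiseRightDerivedFunctor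
  infer_instance

/-- The right derived functor `ℝΩ^Q : Ho(M) ⥤ Ho(M)` (a Kan extension). -/
noncomputable def RLoop : HoCat M ⥤ HoCat M :=
  (P.loop ⋙ toHo M).totalRightDerived (toHo M) (weakEquivalences M)

/-- The canonical morphism `Ω^Q X ⟶ ℝΩ^Q X` in `Ho(M)`, which is an isomorphism when `X` is
fibrant. -/
noncomputable def RLoopUnit (X : M) :
    (toHo M).obj (P.loop.obj X) ⟶ P.RLoop.obj ((toHo M).obj X) :=
  ((P.loop ⋙ toHo M).totalRightDerivedUnit (toHo M) (weakEquivalences M)).app X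

/-- The based path space functor `Path₀^Q` attached to `Path`: the kernel of `d₀`, with the
projection induced by `d₁`. -/
noncomputable def based : BasedPathSpaceFunctor M where
  Path₀ :=
    { obj X := kernel (P.d₀ X)
      map {X Y} f := kernel.map (P.d₀ X) (P.d₀ Y) (P.Path.map f) f
        (P.d₀_naturality f).symm
      map_id X := by
        rw [← cancel_mono (kernel.ι _)]
        simp [kernel.map]
      map_comp f g := by
        rw [← cancel_mono (kernel.ι _)]
        simp [kernel.map] }
  π X := kernel.ι (P.d₀ X) ≫ P.d₁ X
  π_naturality f := by
    simp [kernel.map, P.d₁_naturality]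
  fibration_π X hX := by
    have hd := P.fibration_d X
    have sq : IsPullback (kernel.ι (P.d₀ X)) (kernel.ι (P.d₀ X) ≫ P.d₁ X)
        (P.d X) (prod.lift 0 (𝟙 X)) :=
      ⟨⟨by
        apply Limits.prod.hom_ext
        · rw [Category.assoc, Category.assoc, P.d_fst, prod.lift_fst, kernel.condition, comp_zero]
        · rw [Category.assoc, Category.assoc, P.d_snd, prod.lift_snd, Category.comp_id]⟩, ⟨PullbackCone.IsLimit.mk _
        (fun s => kernel.lift _ s.fst (by
          have := s.condition =≫ prod.fst
          rwa [Category.assoc, Category.assoc, P.d_fst, prod.lift_fst, comp_zero] at this))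
        (fun s => by simp)
        (fun s => by
          have := s.condition =≫ prod.snd
          rw [Category.assoc, Category.assoc, P.d_snd, prod.lift_snd, Category.comp_id] at this
          rwa [kernel.lift_ι_assoc])
        (fun s m hm _ => by
          rw [← cancel_mono (kernel.ι (P.d₀ X)), hm, kernel.lift_ι])⟩⟩
    exact fibration_of_isPullback sq
  acyclic X hX := by
    have h1 : WeakEquivalence (P.d₀ X) := inferInstanceAs (WeakEquivalence (P.pathObject X).p₀)
    have h2 : Fibration (P.d₀ X) := inferInstanceAs (Fibration (P.pathObject X).p₀)
    have h3 := weakEquivalence_of_isPullback (isPullback_kernel (P.d₀ X))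
    exact weakEquivalence_of_postcomp_of_fac
      (f := (0 : (0 : M) ⟶ kernel (P.d₀ X))) (g := (0 : kernel (P.d₀ X) ⟶ 0))
      (fg := 𝟙 (0 : M)) ((isZero_zero M).eq_of_tgt _ _)

lemma kernel_ι_ι_d (X : M) :
    (kernel.ι (kernel.ι (P.d₀ X) ≫ P.d₁ X) ≫ kernel.ι (P.d₀ X)) ≫ P.d X = 0 := by
  apply Limits.prod.hom_ext
  · rw [Category.assoc, P.d_fst, Category.assoc, kernel.condition, comp_zero, zero_comp]
  · rw [Category.assoc, P.d_snd, Category.assoc, kernel.condition, zero_comp]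

/-- The canonical isomorphism between Quillen's loop space `Ω^Q X` and the loop space `Ω X` of
the based path space functor `Path₀^Q` (as subobjects of `Path X`). -/
noncomputable def loopIso (X : M) : P.loop.obj X ≅ P.based.loopObj X :=
  show kernel (P.d X) ≅ kernel (kernel.ι (P.d₀ X) ≫ P.d₁ X) from
  { hom := kernel.lift _ (kernel.lift _ (kernel.ι (P.d X)) (P.kernel_d₀ X))
      (by rw [kernel.lift_ι_assoc, P.kernel_d₁])
    inv := kernel.lift _ (kernel.ι (kernel.ι (P.d₀ X) ≫ P.d₁ X) ≫ kernel.ι (P.d₀ X))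
      (P.kernel_ι_ι_d X)
    hom_inv_id := by
      rw [← cancel_mono (kernel.ι _), Category.assoc, kernel.lift_ι, kernel.lift_ι_assoc,
        kernel.lift_ι, Category.id_comp]
    inv_hom_id := by
      rw [← cancel_mono (kernel.ι _), ← cancel_mono (kernel.ι _), Category.assoc,
        Category.assoc, Category.assoc, kernel.lift_ι_assoc, kernel.lift_ι, kernel.lift_ι,
        Category.id_comp] }

end PathSpaceFunctor

/-! ### Products, group laws and actions in `Ho(M)` -/

/-- The morphism to a product with given components. -/
def pair {C : Type*} [Category C] {X Y : C} {c : BinaryFan X Y} (hc : IsLimit c) {A : C}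
    (a : A ⟶ X) (b : A ⟶ Y) : A ⟶ c.pt :=
  hc.lift (BinaryFan.mk a b)

/-- The image under `γ : M ⥤ Ho(M)` of the product cone of `A` and `B`. -/
noncomputable def hoFan (A B : M) : BinaryFan ((toHo M).obj A) ((toHo M).obj B) :=
  BinaryFan.mk (P := (toHo M).obj (A ⨯ B)) ((toHo M).map prod.fst) ((toHo M).map prod.snd)

/-- The multiplication `m : G × G ⟶ G` makes `G` a group object of `Ho(M)` whose unit is the
zero morphism. -/
def IsGroupLaw {G : HoCat M} {c : BinaryFan G G} (hc : IsLimit c) (m : c.pt ⟶ G) : Prop :=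
  (∀ (A : HoCat M) (a₁ a₂ a₃ : A ⟶ G),
    pair hc (pair hc a₁ a₂ ≫ m) a₃ ≫ m = pair hc a₁ (pair hc a₂ a₃ ≫ m) ≫ m) ∧
  (∀ (A : HoCat M) (a : A ⟶ G), pair hc (hoZero A G) a ≫ m = a ∧ pair hc a (hoZero A G) ≫ m = a) ∧
  (∀ (A : HoCat M) (a : A ⟶ G), ∃ b : A ⟶ G,
    pair hc a b ≫ m = hoZero A G ∧ pair hc b a ≫ m = hoZero A G)

/-- The morphism `R : G' × X ⟶ X` is a left action on `X` of the group object `G` with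
multiplication `m`, which is identified with `G'` by `e : G ⟶ G'`. -/
def IsLeftAction {G G' X : HoCat M} {cG : BinaryFan G G} (hG : IsLimit cG) (m : cG.pt ⟶ G)
    (e : G ⟶ G') {c : BinaryFan G' X} (hc : IsLimit c) (R : c.pt ⟶ X) : Prop :=
  (∀ (A : HoCat M) (x : A ⟶ X), pair hc (hoZero A G ≫ e) x ≫ R = x) ∧
  (∀ (A : HoCat M) (a b : A ⟶ G) (x : A ⟶ X),
    pair hc ((pair hG a b ≫ m) ≫ e) x ≫ R = pair hc (a ≫ e) (pair hc (b ≫ e) x ≫ R) ≫ R)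

namespace PathSpaceFunctor

variable (P : PathSpaceFunctor M)

/-! ### Concatenation of loops -/

/-- The object of pairs of composable paths whose composite is a loop: the start point of the
first path and the end point of the second path are the base point, and the end point of the
first path is the start point of the second one. -/
noncomputable abbrev brokenLoop (V : M) : M :=
  kernel (prod.lift (pullback.fst (P.d₁ V) (P.d₀ V) ≫ P.d₀ V)
    (pullback.snd (P.d₁ V) (P.d₀ V) ≫ P.d₁ V))

/-- Two loops, seen as a pair of composable paths. -/
noncomputable def toBroken (V : M) {A : M} (a b : A ⟶ P.loop.obj V) : A ⟶ P.brokenLoop V :=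
  kernel.lift _ (pullback.lift (a ≫ P.loopι V) (b ≫ P.loopι V)
    (by rw [Category.assoc, Category.assoc, P.loopι_d₀, P.loopι_d₁, comp_zero, comp_zero]))
    (by
      apply Limits.prod.hom_ext
      · rw [Category.assoc, prod.lift_fst, pullback.lift_fst_assoc, Category.assoc, P.loopι_d₀,
          comp_zero, zero_comp]
      · rw [Category.assoc, prod.lift_snd, pullback.lift_snd_assoc, Category.assoc, P.loopι_d₁,
          comp_zero, zero_comp])

/-- The morphism `m : Ω^Q V × Ω^Q V ⟶ Ω^Q V` of `Ho(M)` is the concatenation of loops (first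
loop first): the pair of composable paths `(γ₁, γ₂)` coincides, in `Ho(M)`, with the pair
`(m(γ₁, γ₂), 0)`. As `γ ↦ (γ, 0)` is a weak equivalence for fibrant `V`, this determines `m`. -/
def IsConcat (V : M) (m : (toHo M).obj (P.loop.obj V ⨯ P.loop.obj V) ⟶
    (toHo M).obj (P.loop.obj V)) : Prop :=
  m ≫ (toHo M).map (P.toBroken V (𝟙 _) 0) = (toHo M).map (P.toBroken V prod.fst prod.snd)

/-! ### Quillen's action on the fiber of a fibration -/

/-- A path object `I.P` of `U` over the path object `Path V`, for `p : U ⟶ V`, such that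
`I.P ⟶ Path V ×_(V × V) (U × U)` is a fibration. -/
structure LiftedPathObject {U V : M} (p : U ⟶ V) where
  /-- the path object of `U` -/
  I : PathObject U
  /-- the image in `V` of a path in `U` -/
  q : I.P ⟶ P.Path.obj V
  ι_q : I.ι ≫ q = p ≫ P.s V
  q_d₀ : q ≫ P.d₀ V = I.p₀ ≫ p
  q_d₁ : q ≫ P.d₁ V = I.p₁ ≫ p
  fibration : Fibration (pullback.lift (f := P.d V) (g := prod.map p p) q
    (prod.lift I.p₀ I.p₁) (by
      apply Limits.prod.hom_ext
      · rw [Category.assoc, Category.assoc, P.d_fst, prod.map_fst, prod.lift_fst_assoc, q_d₀]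
      · rw [Category.assoc, Category.assoc, P.d_snd, prod.map_snd, prod.lift_snd_assoc, q_d₁]))

namespace LiftedPathObject

variable {P} {U V : M} {p : U ⟶ V} (L : P.LiftedPathObject p)

/-- The object of those paths in `U` whose end points both lie in the fiber `K = ker p`. -/
noncomputable abbrev fiberPaths : M :=
  pullback (prod.lift L.I.p₀ L.I.p₁) (prod.map (kernel.ι p) (kernel.ι p))

/-- The start point, in the fiber, of a path. -/
noncomputable def startPt : L.fiberPaths ⟶ kernel p := pullback.snd _ _ ≫ prod.fst

/-- The end point, in the fiber, of a path. -/
noncomputable def endPt : L.fiberPaths ⟶ kernel p := pullback.snd _ _ ≫ prod.snd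

lemma startPt_ι : L.startPt ≫ kernel.ι p = pullback.fst _ _ ≫ L.I.p₀ := by
  have h := pullback.condition (f := prod.lift L.I.p₀ L.I.p₁)
    (g := prod.map (kernel.ι p) (kernel.ι p)) =≫ prod.fst
  rw [Category.assoc, Category.assoc, prod.lift_fst, prod.map_fst] at h
  rw [startPt, Category.assoc, ← h]

lemma endPt_ι : L.endPt ≫ kernel.ι p = pullback.fst _ _ ≫ L.I.p₁ := by
  have h := pullback.condition (f := prod.lift L.I.p₀ L.I.p₁)
    (g := prod.map (kernel.ι p) (kernel.ι p)) =≫ prod.snd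
  rw [Category.assoc, Category.assoc, prod.lift_snd, prod.map_snd] at h
  rw [endPt, Category.assoc, ← h]

/-- The loop in `V` that is the image of a path in `U` with end points in the fiber. -/
noncomputable def imageLoop : L.fiberPaths ⟶ P.loop.obj V :=
  P.loopLift (pullback.fst _ _ ≫ L.q)
    (by rw [Category.assoc, L.q_d₀, ← Category.assoc, ← L.startPt_ι, Category.assoc,
      kernel.condition, comp_zero])
    (by rw [Category.assoc, L.q_d₁, ← Category.assoc, ← L.endPt_ι, Category.assoc,
      kernel.condition, comp_zero])

/-- The morphism `u ↦ (p(u), u(1))` from the paths in `U` with end points in the fiber `K` to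
`Ω^Q V ⨯ K`; it is a trivial fibration if `p` is a fibration between fibrant objects. -/
noncomputable def loopEnd : L.fiberPaths ⟶ P.loop.obj V ⨯ kernel p :=
  prod.lift L.imageLoop L.endPt

end LiftedPathObject

/-- The morphism `ρ : Ω^Q V × K ⟶ K` of `Ho(M)` is Quillen's left action on the kernel `K` of a
fibration `p : U ⟶ V` between fibrant objects: lift a loop `γ` of `V` to a path of `U` that ends
at `x` in `K`; then `ρ(γ, x)` is the start point of the lifted path. As `L.loopEnd` is a trivial
fibration, this determines `ρ`; the result does not depend on `L`. -/
def IsQuillenAction {U V : M} (p : U ⟶ V)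
    (ρ : (toHo M).obj (P.loop.obj V ⨯ kernel p) ⟶ (toHo M).obj (kernel p)) : Prop :=
  ∃ L : P.LiftedPathObject p, (toHo M).map L.loopEnd ≫ ρ = (toHo M).map L.startPt

/-! ### Fibration sequences -/

/-- The sequence `X ⟶ Y ⟶ Z` of `Ho(M)` together with `R : ℝΩ^Q(Z) × X ⟶ X` is isomorphic, by
means of the isomorphisms `i`, `j`, `k`, to the sequence `K ⟶ U ⟶ V` implemented by the kernel `K`
of `p : U ⟶ V` together with Quillen's action. -/
def IsFibSeqVia {X Y Z : HoCat M} (a : X ⟶ Y) (b : Y ⟶ Z)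
    {c : BinaryFan (P.RLoop.obj Z) X} (hc : IsLimit c) (R : c.pt ⟶ X) {U V : M} (p : U ⟶ V)
    (i : X ≅ (toHo M).obj (kernel p)) (j : Y ≅ (toHo M).obj U) (k : Z ≅ (toHo M).obj V) : Prop :=
  a ≫ j.hom = i.hom ≫ (toHo M).map (kernel.ι p) ∧
  b ≫ k.hom = j.hom ≫ (toHo M).map p ∧
  P.IsQuillenAction p
    (pair hc ((toHo M).map prod.fst ≫ P.RLoopUnit V ≫ P.RLoop.map k.inv)
      ((toHo M).map prod.snd ≫ i.inv) ≫ R ≫ i.hom)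

/-- The sequence `X ⟶ Y ⟶ Z` of `Ho(M)` together with `R : ℝΩ^Q(Z) × X ⟶ X` is a fibration
sequence in the sense of Quillen. -/
def IsFibrationSequence {X Y Z : HoCat M} (a : X ⟶ Y) (b : Y ⟶ Z)
    {c : BinaryFan (P.RLoop.obj Z) X} (hc : IsLimit c) (R : c.pt ⟶ X) : Prop :=
  ∃ (U V : M) (p : U ⟶ V) (i : X ≅ (toHo M).obj (kernel p)) (j : Y ≅ (toHo M).obj U)
    (k : Z ≅ (toHo M).obj V),
    Fibration p ∧ IsFibrant U ∧ IsFibrant V ∧ P.IsFibSeqVia a b hc R p i j k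

/-- Quillen's connecting morphism `Δ^Q : ℝΩ^Q(Z) ⟶ X`, the composite of `(id, 0)` and `R`. -/
noncomputable def connectingQ {X Z : HoCat M} {c : BinaryFan (P.RLoop.obj Z) X} (hc : IsLimit c)
    (R : c.pt ⟶ X) : P.RLoop.obj Z ⟶ X :=
  pair hc (𝟙 _) (hoZero _ _) ≫ R

/-- For a morphism `Ξ` of `Ho(h(M))` from `K_g ⟶ 𝒳 ⟶ 𝔛` to `x : X ⟶ 𝒳 ⟶ 𝔛`, the connecting
morphism `Δ : Ω 𝔛 ⟶ K_g ⟶ X`, the composite of `γ(δ_g)` and of the fiber component of `Ξ`. The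
source `Ω 𝔛` is formed with `Path₀^Q`, and it is replaced by the isomorphic object `Ω^Q 𝔛`. -/
noncomputable def connecting (x : HoFibSeq M) [IsFibrant x.obj.X₂] [IsFibrant x.obj.X₄]
    (Ξ : (seqWeq M).Q.obj (P.based.hoKernelSeq x.obj.f₂₄) ⟶ (seqWeq M).Q.obj x) :
    (toHo M).obj (P.loop.obj x.obj.X₄) ⟶ (toHo M).obj x.obj.X₁ :=
  (toHo M).map (P.loopIso x.obj.X₄).hom ≫ (toHo M).map (P.based.δ x.obj.f₂₄) ≫ onFiber Ξ

end PathSpaceFunctor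

end Paths

end HoFib

/-!
A homotopy fiber sequence is determined up to objectwise weak equivalence by its underlying morphism
`g : 𝒳 ⟶ 𝔛`: with a functorial factorization, `g` has a functorial model whose vertex `X₃` is a
replacement of `0`, and every homotopy fiber sequence is connected to the model of its restriction
by natural weak equivalences. Hence the restriction functor induces an equivalence of homotopy
categories (`isEquivalence_hoRestr`). This yields existence and uniqueness of every morphism of
`Ho(h(M))` that extends a given one, and it reduces every compatibility between such morphisms to
an identity between morphisms of arrows (`onFiber_comparison`).

Write `E ⟶ V` for the fibration `Path₀ V ⟶ V`, with `E` acyclic. The object `E ×_V E` is a strict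
groupoid over `E`, and it acts strictly on `K_g = E ×_V X` for every `g : X ⟶ V`: the pair
`(e₀, e₁)` sends `(e₁, x)` to `(e₀, x)`. Acyclicity of `E` turns the fiber product
`E ×_V E ×_V X = (E ×_V E) ×_E K_g` into the product `(E ×_V E) × K_g` in `Ho(M)`
(`weakEquivalence_segal`), so the groupoid becomes a group object of `Ho(M)` that acts on `K_g`. The
associativity, unit and inverse laws hold strictly in `M`, before localization. The morphism
`l ↦ (l, 0)` from `Ω V` to `E ×_V E` is a weak equivalence, which transports this structure to
`Ω V`.

Two comparisons rest on one homotopy lemma (`toHo_map_kernel_lift_eq`): morphisms `f` and `g` to a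
fibration that agree on a weakly equivalent object induce the same morphism on fibers in `Ho(M)`.
Applied to the constant paths in `Path V`, it shows that the pairs of composable loops `(l, 0)` and
`(0, l)` coincide in `Ho(M)`, so the group law is concatenation (`isConcat_loopMul`). Applied to
the constant paths in a path object of `U`, for a fibration `p : U ⟶ V`, it shows that Quillen's
action on `ker p` is the restriction of the action on `K_p` along the weak equivalence
`ker p ⟶ K_p` (`isQuillenAction_of_comp`).

The action on the fiber `X` of a homotopy fiber sequence is transported along the canonical
isomorphism of `K_g` with `X` in `Ho(M)` (`derivedAct`). On `K_g` it sends `(l, 0)` to `δ_g(l)`, whence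
the equality of the two connecting morphisms (`connectingQ_derivedAct`).
-/

namespace HoFib

/-! ### Homotopy invariance of pullbacks of fibrant objects -/

section Cogluing

variable {M : Type u} [Category.{v} M] [ModelCategory M]

/-- The base change along an arbitrary morphism `u` preserves weak equivalences between fibrations
over the same object. This is Ken Brown's argument: the graph of `h` is factored so that `h` becomes
a section of a trivial fibration followed by a trivial fibration. -/
lemma weakEquivalence_baseChange {E E' B B' F F' : M} {e : E ⟶ B} {e' : E' ⟶ B} {u : B' ⟶ B}
    {a : F ⟶ E} {q : F ⟶ B'} {a' : F' ⟶ E'} {q' : F' ⟶ B'} (sq : IsPullback a q e u)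
    (sq' : IsPullback a' q' e' u) (h : E ⟶ E') (w : h ≫ e' = e) [Fibration e] [Fibration e']
    [WeakEquivalence h] (k : F ⟶ F') (hk : k ≫ a' = a ≫ h) (hk' : k ≫ q' = q) :
    WeakEquivalence k := by
  let D := MorphismProperty.factorizationData (trivialCofibrations M) (fibrations M)
    (pullback.lift (f := e) (g := e') (𝟙 E) h (by simp [w]))
  have hi : WeakEquivalence D.i := by rw [weakEquivalence_iff]; exact D.hi.2
  have hp : Fibration D.p := by rw [fibration_iff]; exact D.hp
  let c : D.Z ⟶ E := D.p ≫ pullback.fst e e'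
  let d : D.Z ⟶ E' := D.p ≫ pullback.snd e e'
  have hc : D.i ≫ c = 𝟙 E := by simp only [c, D.fac_assoc, pullback.lift_fst]
  have hd : D.i ≫ d = h := by simp only [d, D.fac_assoc, pullback.lift_snd]
  have hcd : c ≫ e = d ≫ e' := by simp only [c, d, Category.assoc, pullback.condition]
  have : WeakEquivalence c := weakEquivalence_of_precomp_of_fac hc
  have : WeakEquivalence d := weakEquivalence_of_precomp_of_fac hd
  have sqZ := IsPullback.of_hasPullback (c ≫ e) u
  let kc : pullback (c ≫ e) u ⟶ F := sq.lift (pullback.fst _ _ ≫ c) (pullback.snd _ _)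
    ((Category.assoc _ _ _).trans sqZ.w)
  let kd : pullback (c ≫ e) u ⟶ F' := sq'.lift (pullback.fst _ _ ≫ d) (pullback.snd _ _)
    ((Category.assoc _ _ _).trans ((congrArg _ hcd.symm).trans sqZ.w))
  have sqc : IsPullback (pullback.fst (c ≫ e) u) kc c a :=
    IsPullback.of_bot (by simpa [kc] using sqZ) (by simp [kc]) sq
  have sqd : IsPullback (pullback.fst (c ≫ e) u) kd d a' :=
    IsPullback.of_bot (by simpa [kd, ← hcd] using sqZ) (by simp [kd]) sq'
  have := weakEquivalence_of_isPullback sqc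
  have := weakEquivalence_of_isPullback sqd
  let ki : F ⟶ pullback (c ≫ e) u := sqZ.lift (a ≫ D.i) q (by
    rw [Category.assoc, reassoc_of% hc, sq.w])
  have hki : ki ≫ kc = 𝟙 _ := by
    apply sq.hom_ext <;> simp [ki, kc, hc]
  have : WeakEquivalence ki := weakEquivalence_of_postcomp_of_fac hki
  have : k = ki ≫ kd := by
    apply sq'.hom_ext <;> simp [ki, kd, hd, hk, hk']
  rw [this]
  infer_instance

/-- The base change of a section of a trivial fibration along a fibration is a weak equivalence:
it is the base change along `i` of the graph of `e`, a weak equivalence over `Z` from `e` to the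
pullback of `e ≫ r` along `r`. -/
lemma weakEquivalence_of_isPullback_section {E F X Z : M} {a : F ⟶ E} {q : F ⟶ X} {e : E ⟶ Z}
    {i : X ⟶ Z} (sq : IsPullback a q e i) [Fibration e] (r : Z ⟶ X) [Fibration r]
    [WeakEquivalence r] (hir : i ≫ r = 𝟙 X) : WeakEquivalence a := by
  have sqr := IsPullback.of_hasPullback (e ≫ r) r
  let h : E ⟶ pullback (e ≫ r) r := sqr.lift (𝟙 E) e (by simp)
  have hh : h ≫ pullback.fst (e ≫ r) r = 𝟙 E := sqr.lift_fst _ _ _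
  have : WeakEquivalence h := weakEquivalence_of_postcomp_of_fac hh
  let l : E ⟶ pullback (e ≫ r) r := sqr.lift (𝟙 E) (e ≫ r ≫ i) (by simp [hir])
  have sq' : IsPullback l (e ≫ r) (pullback.snd (e ≫ r) r) i := by
    refine IsPullback.of_right ?_ (by simp [l]) sqr
    simpa [l, hir] using IsPullback.id_horiz (e ≫ r)
  refine weakEquivalence_baseChange sq sq' h (sqr.lift_snd _ _ _) a ?_ ?_
  · apply sqr.hom_ext
    · simp [l, h]
    · simp [l, h, sq.w, reassoc_of% sq.w, reassoc_of% hir]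
  · simp [reassoc_of% sq.w, hir]

/-- The base change of a weak equivalence between fibrant objects along a fibration is a weak
equivalence. -/
lemma weakEquivalence_of_isPullback_fibration {E E' X Y : M} {f' : E' ⟶ E} {p' : E' ⟶ X}
    {p : E ⟶ Y} {f : X ⟶ Y} (sq : IsPullback f' p' p f) [Fibration p] [WeakEquivalence f]
    [IsFibrant X] [IsFibrant Y] : WeakEquivalence f' := by
  let D : FibrantBrownFactorization f := Classical.arbitrary _
  have hp : Fibration D.p := by rw [fibration_iff]; exact D.hp
  have sqp := IsPullback.of_hasPullback p D.p
  let l : E' ⟶ pullback p D.p := sqp.lift f' (p' ≫ D.i) (by simp [sq.w])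
  have sql : IsPullback l p' (pullback.snd p D.p) D.i :=
    IsPullback.of_right (by simpa [l] using sq) (by simp [l]) sqp
  have : WeakEquivalence l := weakEquivalence_of_isPullback_section sql D.r D.i_r
  have hl : f' = l ≫ pullback.fst p D.p := (sqp.lift_fst _ _ _).symm
  rw [hl]
  infer_instance

variable {B C D B' C' D' Q Q' : M} {r : B ⟶ D} {s : C ⟶ D} {r' : B' ⟶ D'} {s' : C' ⟶ D'}
  {f : Q ⟶ B} {g : Q ⟶ C} {f' : Q' ⟶ B'} {g' : Q' ⟶ C'}

/-- The cogluing lemma, when the fibrations are `r` and `r'`. The base change of `r'` along `d` is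
inserted between `r` and `r'`: the first comparison is a weak equivalence of fibrations over `D`,
the second one a base change of weak equivalences between fibrant objects. -/
lemma weakEquivalence_cogluing_left (sq : IsPullback f g r s) (sq' : IsPullback f' g' r' s')
    (b : B ⟶ B') (c : C ⟶ C') (d : D ⟶ D') (hb : r ≫ d = b ≫ r') (hc : s ≫ d = c ≫ s')
    [IsFibrant C] [IsFibrant D] [IsFibrant C'] [IsFibrant D']
    [Fibration r] [Fibration r'] [WeakEquivalence b] [WeakEquivalence c] [WeakEquivalence d]
    (k : Q ⟶ Q') (hk : k ≫ f' = f ≫ b) (hk' : k ≫ g' = g ≫ c) : WeakEquivalence k := by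
  have : Fibration g' := fibration_of_isPullback sq'
  have sq₁ := IsPullback.of_hasPullback g' c
  have : WeakEquivalence (pullback.fst g' c) := weakEquivalence_of_isPullback_fibration sq₁
  have sq₂ := IsPullback.of_hasPullback r' d
  have : WeakEquivalence (pullback.fst r' d) := weakEquivalence_of_isPullback_fibration sq₂
  let h : B ⟶ pullback r' d := sq₂.lift b r hb.symm
  have hh : h ≫ pullback.fst r' d = b := sq₂.lift_fst _ _ _
  have : WeakEquivalence h := weakEquivalence_of_postcomp_of_fac hh
  let l : pullback g' c ⟶ pullback r' d := sq₂.lift (pullback.fst _ _ ≫ f')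
    (pullback.snd _ _ ≫ s) (by
      rw [Category.assoc, Category.assoc, hc, ← reassoc_of% sq₁.w, sq'.w])
  have sq₃ : IsPullback l (pullback.snd g' c) (pullback.snd r' d) s := by
    refine IsPullback.of_right ?_ (by simp [l]) sq₂
    have := sq₁.paste_horiz sq'
    simpa [l, hc] using this
  let k' : Q ⟶ pullback g' c := sq₁.lift k g hk'
  have : WeakEquivalence k' := by
    refine weakEquivalence_baseChange sq sq₃ h (sq₂.lift_snd _ _ _) k' ?_
      (sq₁.lift_snd _ _ _)
    apply sq₂.hom_ext
    · simp [k', l, h, hk]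
    · simp [k', l, h, sq.w]
  have hk : k = k' ≫ pullback.fst g' c := (sq₁.lift_fst _ _ _).symm
  rw [hk]
  infer_instance

/-- The cogluing lemma for cospans of fibrant objects. The fibration may be the other leg in the
second cospan. -/
lemma weakEquivalence_cogluing (sq : IsPullback f g r s) (sq' : IsPullback f' g' r' s')
    (b : B ⟶ B') (c : C ⟶ C') (d : D ⟶ D') (hb : r ≫ d = b ≫ r') (hc : s ≫ d = c ≫ s')
    [IsFibrant B] [IsFibrant C] [IsFibrant D] [IsFibrant B'] [IsFibrant C'] [IsFibrant D']
    (hr : Fibration r ∨ Fibration s) (hr' : Fibration r' ∨ Fibration s')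
    [WeakEquivalence b] [WeakEquivalence c] [WeakEquivalence d]
    (k : Q ⟶ Q') (hk : k ≫ f' = f ≫ b) (hk' : k ≫ g' = g ≫ c) : WeakEquivalence k := by
  -- by symmetry `r` is a fibration; if `r'` is not, it is replaced by a fibration
  wlog h : Fibration r generalizing B C B' C' f g f' g' r s r' s' b c
  · exact this sq.flip sq'.flip c b hc hb hr.symm hr'.symm hk' hk (hr.resolve_left h)
  rcases hr' with h' | h'
  · exact weakEquivalence_cogluing_left sq sq' b c d hb hc k hk hk'
  let F := MorphismProperty.factorizationData (trivialCofibrations M) (fibrations M) r'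
  have hi : WeakEquivalence F.i := by rw [weakEquivalence_iff]; exact F.hi.2
  have hp : Fibration F.p := by rw [fibration_iff]; exact F.hp
  have : IsFibrant F.Z := isFibrant_of_fibration F.p
  have sq'' := IsPullback.of_hasPullback F.p s'
  let l : Q' ⟶ pullback F.p s' := sq''.lift (f' ≫ F.i) g' (by simp [sq'.w])
  have : WeakEquivalence l :=
    weakEquivalence_cogluing_left sq'.flip sq''.flip (𝟙 C') F.i (𝟙 D') (by simp) (by simp) l
      (by simp [l]) (by simp [l])
  have : WeakEquivalence (k ≫ l) :=
    weakEquivalence_cogluing_left sq sq'' (b ≫ F.i) c d (by simp [hb]) hc (k ≫ l)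
      (by simp [l, reassoc_of% hk]) (by simp [l, hk'])
  exact weakEquivalence_of_postcomp k l

end Cogluing

/-! ### Fiberwise homotopies -/

section Fiberwise

variable {M : Type u} [Category.{v} M] [ModelCategory M] [HasZeroObject M] [HasZeroMorphisms M]

instance isIso_toHo_map {A B : M} (w : A ⟶ B) [hw : WeakEquivalence w] :
    IsIso ((toHo M).map w) :=
  Localization.inverts (toHo M) (weakEquivalences M) w ((weakEquivalence_iff w).1 hw)

/-- Two morphisms `f` and `g` over `B` to a fibration `t : T ⟶ B` which agree on `A ⟶ I`, for a weak
equivalence `s : A ⟶ I`, are fiberwise homotopic. In particular they induce the same morphism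
on fibers in `Ho(M)`. -/
lemma toHo_map_kernel_lift_eq {A I T B Z : M} (s : A ⟶ I) [WeakEquivalence s] (f g : I ⟶ T)
    (hs : s ≫ f = s ≫ g) (t : T ⟶ B) [Fibration t] (hfg : f ≫ t = g ≫ t) (k : Z ⟶ I)
    (hf : (k ≫ f) ≫ t = 0) (hg : (k ≫ g) ≫ t = 0) :
    (toHo M).map (kernel.lift t (k ≫ f) hf) = (toHo M).map (kernel.lift t (k ≫ g) hg) := by
  -- replace `s` by a trivial cofibration
  let D := MorphismProperty.factorizationData (cofibrations M) (trivialFibrations M) s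
  have hi : Cofibration D.i := by rw [cofibration_iff]; exact D.hi
  have hp : Fibration D.p := by rw [fibration_iff]; exact D.hp.1
  have hp' : WeakEquivalence D.p := by rw [weakEquivalence_iff]; exact D.hp.2
  have hi' : WeakEquivalence D.i := weakEquivalence_of_postcomp_of_fac D.fac
  -- a path object of `T` in the category of objects over `B`
  let J := MorphismProperty.factorizationData (trivialCofibrations M) (fibrations M)
    (pullback.lift (f := t) (g := t) (𝟙 T) (𝟙 T) rfl)
  have hj : WeakEquivalence J.i := by rw [weakEquivalence_iff]; exact J.hi.2
  have hj' : Fibration J.p := by rw [fibration_iff]; exact J.hp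
  let y₀ : J.Z ⟶ T := J.p ≫ pullback.fst t t
  let y₁ : J.Z ⟶ T := J.p ≫ pullback.snd t t
  have hy₀ : J.i ≫ y₀ = 𝟙 T := by simp only [y₀, J.fac_assoc, pullback.lift_fst]
  have hy₁ : J.i ≫ y₁ = 𝟙 T := by simp only [y₁, J.fac_assoc, pullback.lift_snd]
  have : WeakEquivalence y₀ := weakEquivalence_of_precomp_of_fac hy₀
  have : WeakEquivalence y₁ := weakEquivalence_of_precomp_of_fac hy₁
  have hy : y₀ ≫ t = y₁ ≫ t := by simp only [y₀, y₁, Category.assoc, pullback.condition]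
  have hsq : CommSq (s ≫ f ≫ J.i) D.i J.p
      (pullback.lift (f := t) (g := t) (D.p ≫ f) (D.p ≫ g) (by simp [hfg])) := ⟨by
    apply pullback.hom_ext
    · simp only [Category.assoc, J.fac_assoc, pullback.lift_fst, D.fac_assoc, Category.comp_id]
    · simp only [Category.assoc, J.fac_assoc, pullback.lift_snd, D.fac_assoc, Category.comp_id,
        hs]⟩
  let H := hsq.lift
  have hH₀ : H ≫ y₀ = D.p ≫ f := by
    rw [← Category.assoc, hsq.fac_right, pullback.lift_fst]
  have hH₁ : H ≫ y₁ = D.p ≫ g := by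
    rw [← Category.assoc, hsq.fac_right, pullback.lift_snd]
  -- both end point maps of the fibers are inverse, in `Ho(M)`, to the constant paths
  have w₀ := weakEquivalence_of_isPullback (isPullback_kernel_map y₀ t (y₀ ≫ t) rfl)
  have w₁ := weakEquivalence_of_isPullback (isPullback_kernel_map y₁ t (y₀ ≫ t) hy.symm)
  let j : kernel t ⟶ kernel (y₀ ≫ t) := kernel.lift _ (kernel.ι t ≫ J.i)
    (by rw [Category.assoc, reassoc_of% hy₀, kernel.condition])
  have h₀ : j ≫ kernel.lift t (kernel.ι (y₀ ≫ t) ≫ y₀) (by simp) = 𝟙 _ := by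
    rw [← cancel_mono (kernel.ι t)]; simp [j, hy₀]
  have h₁ : j ≫ kernel.lift t (kernel.ι (y₀ ≫ t) ≫ y₁) (by simp [← hy]) = 𝟙 _ := by
    rw [← cancel_mono (kernel.ι t)]; simp [j, hy₁]
  have hj : WeakEquivalence j := weakEquivalence_of_postcomp_of_fac h₀
  have key : (toHo M).map (kernel.lift t (kernel.ι (y₀ ≫ t) ≫ y₀) (by simp)) =
      (toHo M).map (kernel.lift t (kernel.ι (y₀ ≫ t) ≫ y₁) (by simp [← hy])) := by
    rw [← cancel_epi ((toHo M).map j), ← Functor.map_comp, ← Functor.map_comp, h₀, h₁]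
  -- lift along the base change of the trivial fibration `D.p`
  let m : pullback D.p k ⟶ kernel (y₀ ≫ t) := kernel.lift _ (pullback.fst D.p k ≫ H) (by
    rw [Category.assoc, reassoc_of% hH₀, pullback.condition_assoc]
    simpa using pullback.snd D.p k ≫= hf)
  have e₀ : pullback.snd D.p k ≫ kernel.lift t (k ≫ f) hf =
      m ≫ kernel.lift t (kernel.ι (y₀ ≫ t) ≫ y₀) (by simp) := by
    rw [← cancel_mono (kernel.ι t)]
    simp [m, hH₀, pullback.condition_assoc]
  have e₁ : pullback.snd D.p k ≫ kernel.lift t (k ≫ g) hg =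
      m ≫ kernel.lift t (kernel.ι (y₀ ≫ t) ≫ y₁) (by simp [← hy]) := by
    rw [← cancel_mono (kernel.ι t)]
    simp [m, hH₁, pullback.condition_assoc]
  rw [← cancel_epi ((toHo M).map (pullback.snd D.p k)), ← Functor.map_comp, ← Functor.map_comp,
    e₀, e₁, Functor.map_comp, Functor.map_comp, key]

end Fiberwise

/-! ### Functorial fibrant models of homotopy fiber sequences -/

section Models

variable {M : Type u} [Category.{v} M] [ModelCategory M]
  [MorphismProperty.HasFunctorialFactorization (trivialCofibrations M) (fibrations M)]

/-- A functorial factorization of `f` into a trivial cofibration followed by a fibration. -/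
noncomputable abbrev fac {X Y : M} (f : X ⟶ Y) :
    MorphismProperty.MapFactorizationData (trivialCofibrations M) (fibrations M) f :=
  (MorphismProperty.functorialFactorizationData (trivialCofibrations M)
    (fibrations M)).factorizationData f

/-- The functoriality of the factorization `fac`. -/
noncomputable abbrev facMap {X Y X' Y' : M} {f : X ⟶ Y} {f' : X' ⟶ Y'} (a : X ⟶ X') (b : Y ⟶ Y')
    (w : f ≫ b = a ≫ f') : (fac f).Z ⟶ (fac f').Z :=
  (MorphismProperty.functorialFactorizationData (trivialCofibrations M)
    (fibrations M)).mapZ (Arrow.homMk a b w.symm)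

instance {X Y : M} (f : X ⟶ Y) : WeakEquivalence (fac f).i := by
  rw [weakEquivalence_iff]; exact (fac f).hi.2

instance fibration_fac_p {X Y : M} (f : X ⟶ Y) : Fibration (fac f).p := by
  rw [fibration_iff]; exact (fac f).hp

instance {X Y : M} (f : X ⟶ Y) [IsFibrant Y] : IsFibrant (fac f).Z :=
  isFibrant_of_fibration (fac f).p

lemma i_facMap {X Y X' Y' : M} {f : X ⟶ Y} {f' : X' ⟶ Y'} (a : X ⟶ X') (b : Y ⟶ Y')
    (w : f ≫ b = a ≫ f') : (fac f).i ≫ facMap a b w = a ≫ (fac f').i :=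
  MorphismProperty.FunctorialFactorizationData.i_mapZ _ _

lemma facMap_p {X Y X' Y' : M} {f : X ⟶ Y} {f' : X' ⟶ Y'} (a : X ⟶ X') (b : Y ⟶ Y')
    (w : f ≫ b = a ≫ f') : facMap a b w ≫ (fac f').p = (fac f).p ≫ b :=
  MorphismProperty.FunctorialFactorizationData.mapZ_p _ _

lemma facMap_id {X Y : M} (f : X ⟶ Y) : facMap (f := f) (𝟙 X) (𝟙 Y) (by simp) = 𝟙 _ :=
  MorphismProperty.FunctorialFactorizationData.mapZ_id _ f

lemma facMap_comp {X Y X' Y' X'' Y'' : M} {f : X ⟶ Y} {f' : X' ⟶ Y'} {f'' : X'' ⟶ Y''}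
    (a : X ⟶ X') (b : Y ⟶ Y') (w : f ≫ b = a ≫ f') (a' : X' ⟶ X'') (b' : Y' ⟶ Y'')
    (w' : f' ≫ b' = a' ≫ f'') (w'' : f ≫ b ≫ b' = (a ≫ a') ≫ f'') :
    facMap (a ≫ a') (b ≫ b') w'' = facMap a b w ≫ facMap a' b' w' :=
  (congrArg _ (Arrow.hom_ext _ (Arrow.homMk a b w.symm ≫ Arrow.homMk a' b' w'.symm) rfl rfl)).trans
    (MorphismProperty.FunctorialFactorizationData.mapZ_comp _ _ _)

lemma facMap_congr {X Y X' Y' : M} {f : X ⟶ Y} {f' : X' ⟶ Y'} {a a' : X ⟶ X'} {b b' : Y ⟶ Y'}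
    (w : f ≫ b = a ≫ f') (ha : a = a') (hb : b = b') :
    facMap a b w = facMap a' b' (by rw [← ha, ← hb, w]) := by
  subst ha hb
  rfl

lemma weakEquivalence_facMap {X Y X' Y' : M} {f : X ⟶ Y} {f' : X' ⟶ Y'} (a : X ⟶ X')
    (b : Y ⟶ Y') (w : f ≫ b = a ≫ f') [WeakEquivalence a] : WeakEquivalence (facMap a b w) :=
  have : WeakEquivalence ((fac f).i ≫ facMap a b w) := by rw [i_facMap]; infer_instance
  weakEquivalence_of_precomp (fac f).i _

variable (M) in
/-- Functorial fibrant replacement. -/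
noncomputable def fibRepl : M ⥤ M where
  obj X := (fac (terminal.from X)).Z
  map f := facMap f (𝟙 _) (Subsingleton.elim _ _)
  map_id X := facMap_id _
  map_comp f g := by
    rw [← facMap_comp _ _ _ _ _ _ (Subsingleton.elim _ _)]
    exact facMap_congr _ rfl (Category.comp_id _).symm

/-- The morphism to the fibrant replacement. -/
noncomputable def toFibRepl (X : M) : X ⟶ (fibRepl M).obj X := (fac (terminal.from X)).i

instance (X : M) : WeakEquivalence (toFibRepl X) :=
  inferInstanceAs (WeakEquivalence (fac (terminal.from X)).i)

instance (X : M) : IsFibrant ((fibRepl M).obj X) :=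
  have : IsFibrant (⊤_ M) := by
    have : terminal.from (⊤_ M) = 𝟙 _ := Subsingleton.elim _ _
    rw [isFibrant_iff, this]
    infer_instance
  inferInstanceAs (IsFibrant (fac (terminal.from X)).Z)

lemma toFibRepl_naturality {X Y : M} (f : X ⟶ Y) :
    toFibRepl X ≫ (fibRepl M).map f = f ≫ toFibRepl Y :=
  i_facMap f (𝟙 _) (Subsingleton.elim _ _)

instance {X Y : M} (f : X ⟶ Y) [WeakEquivalence f] : WeakEquivalence ((fibRepl M).map f) :=
  weakEquivalence_of_precomp_of_fac (toFibRepl_naturality f)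

/-- The upper left vertex of `modelSquare`. -/
noncomputable abbrev modelVertex (sq : Square M) : M :=
  pullback ((fibRepl M).map sq.f₂₄) (fac ((fibRepl M).map sq.f₃₄)).p

lemma isPullback_modelVertex (sq : Square M) :
    IsPullback (pullback.fst _ _ : modelVertex sq ⟶ _) (pullback.snd _ _)
      ((fibRepl M).map sq.f₂₄) (fac ((fibRepl M).map sq.f₃₄)).p :=
  IsPullback.of_hasPullback _ _

/-- The functoriality of the lower left vertex of `modelSquare`. -/
noncomputable abbrev modelMap₃ {sq sq' : Square M} (φ : sq ⟶ sq') :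
    (fac ((fibRepl M).map sq.f₃₄)).Z ⟶ (fac ((fibRepl M).map sq'.f₃₄)).Z :=
  facMap ((fibRepl M).map φ.τ₃) ((fibRepl M).map φ.τ₄)
    (by rw [← Functor.map_comp, ← Functor.map_comp, φ.comm₃₄])

/-- The functoriality of the upper left vertex of `modelSquare`. -/
noncomputable def modelMap₁ {sq sq' : Square M} (φ : sq ⟶ sq') :
    modelVertex sq ⟶ modelVertex sq' :=
  (isPullback_modelVertex sq').lift (pullback.fst _ _ ≫ (fibRepl M).map φ.τ₂)
    (pullback.snd _ _ ≫ modelMap₃ φ) (by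
      rw [Category.assoc, Category.assoc, facMap_p, ← Functor.map_comp, ← φ.comm₂₄,
        Functor.map_comp, pullback.condition_assoc])

lemma modelMap₁_fst {sq sq' : Square M} (φ : sq ⟶ sq') :
    modelMap₁ φ ≫ pullback.fst _ _ = pullback.fst _ _ ≫ (fibRepl M).map φ.τ₂ :=
  IsPullback.lift_fst _ _ _ _

lemma modelMap₁_snd {sq sq' : Square M} (φ : sq ⟶ sq') :
    modelMap₁ φ ≫ pullback.snd _ _ = pullback.snd _ _ ≫ modelMap₃ φ :=
  IsPullback.lift_snd _ _ _ _

variable (M) in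
/-- The functor which replaces the vertices `X₂`, `X₃`, `X₄` of a square by fibrant objects and
`X₃ ⟶ X₄` by a fibration, and then `X₁` by the pullback. The vertex `X₁` plays no role. -/
noncomputable def modelSquare : Square M ⥤ Square M where
  obj sq :=
    { f₁₂ := pullback.fst ((fibRepl M).map sq.f₂₄) (fac ((fibRepl M).map sq.f₃₄)).p
      f₁₃ := pullback.snd _ _
      f₂₄ := (fibRepl M).map sq.f₂₄
      f₃₄ := (fac ((fibRepl M).map sq.f₃₄)).p
      fac := pullback.condition }
  map φ :=
    { τ₁ := modelMap₁ φ
      τ₂ := (fibRepl M).map φ.τ₂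
      τ₃ := modelMap₃ φ
      τ₄ := (fibRepl M).map φ.τ₄
      comm₁₂ := (modelMap₁_fst φ).symm
      comm₁₃ := (modelMap₁_snd φ).symm
      comm₂₄ := by rw [← Functor.map_comp, ← Functor.map_comp, φ.comm₂₄]
      comm₃₄ := (facMap_p _ _ _).symm }
  map_id sq := by
    have h : modelMap₃ (𝟙 sq) = 𝟙 _ :=
      (facMap_congr _ ((fibRepl M).map_id _) ((fibRepl M).map_id _)).trans (facMap_id _)
    refine Square.hom_ext ?_ ((fibRepl M).map_id _) h ((fibRepl M).map_id _)
    refine (isPullback_modelVertex sq).hom_ext ((modelMap₁_fst _).trans ?_)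
      ((modelMap₁_snd _).trans ?_)
    · exact ((congrArg _ ((fibRepl M).map_id _)).trans (Category.comp_id _)).trans
        (Category.id_comp _).symm
    · rw [h]
      exact (Category.comp_id _).trans (Category.id_comp _).symm
  map_comp {sq₁ sq₂ sq₃} φ ψ := by
    have h : modelMap₃ (φ ≫ ψ) = modelMap₃ φ ≫ modelMap₃ ψ :=
      (facMap_congr _ ((fibRepl M).map_comp _ _) ((fibRepl M).map_comp _ _)).trans
        (facMap_comp _ _ _ _ _ _ _)
    refine Square.hom_ext ?_ ((fibRepl M).map_comp _ _) h ((fibRepl M).map_comp _ _)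
    change modelMap₁ (φ ≫ ψ) = modelMap₁ φ ≫ modelMap₁ ψ
    refine (isPullback_modelVertex sq₃).hom_ext ?_ ?_
    · rw [Category.assoc, modelMap₁_fst, modelMap₁_fst, ← Category.assoc, modelMap₁_fst,
        Category.assoc, ← Functor.map_comp]
      rfl
    · rw [Category.assoc, modelMap₁_snd, modelMap₁_snd, ← Category.assoc, modelMap₁_snd,
        Category.assoc, h]

/-- The morphism from the upper left vertex of a square to that of its fibrant model. -/
noncomputable def toModelVertex (sq : Square M) : sq.X₁ ⟶ modelVertex sq :=
  (isPullback_modelVertex sq).lift (sq.f₁₂ ≫ toFibRepl _)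
    (sq.f₁₃ ≫ toFibRepl _ ≫ (fac ((fibRepl M).map sq.f₃₄)).i) (by
      simp only [Category.assoc, MorphismProperty.MapFactorizationData.fac,
        toFibRepl_naturality]
      rw [← Category.assoc, sq.fac, Category.assoc])

lemma toModelVertex_fst (sq : Square M) :
    toModelVertex sq ≫ pullback.fst _ _ = sq.f₁₂ ≫ toFibRepl _ :=
  IsPullback.lift_fst _ _ _ _

lemma toModelVertex_snd (sq : Square M) : toModelVertex sq ≫ pullback.snd _ _ =
    sq.f₁₃ ≫ toFibRepl _ ≫ (fac ((fibRepl M).map sq.f₃₄)).i :=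
  IsPullback.lift_snd _ _ _ _

lemma toModelVertex_naturality {sq sq' : Square M} (φ : sq ⟶ sq') :
    φ.τ₁ ≫ toModelVertex sq' = toModelVertex sq ≫ modelMap₁ φ := by
  refine (isPullback_modelVertex sq').hom_ext ?_ ?_
  · rw [Category.assoc, Category.assoc, toModelVertex_fst, modelMap₁_fst,
      ← Category.assoc, ← Category.assoc, toModelVertex_fst, ← φ.comm₁₂, Category.assoc,
      Category.assoc, toFibRepl_naturality]
  · rw [Category.assoc, Category.assoc, toModelVertex_snd, modelMap₁_snd,
      ← Category.assoc (toModelVertex sq), toModelVertex_snd, ← Category.assoc φ.τ₁, ← φ.comm₁₃]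
    simp only [Category.assoc]
    rw [i_facMap, ← Category.assoc (toFibRepl _), toFibRepl_naturality, Category.assoc]

variable (M) in
/-- The natural transformation from a square to its fibrant model. -/
noncomputable def toModelSquare : 𝟭 (Square M) ⟶ modelSquare M where
  app sq :=
    { τ₁ := toModelVertex sq
      τ₂ := toFibRepl _
      τ₃ := toFibRepl _ ≫ (fac ((fibRepl M).map sq.f₃₄)).i
      τ₄ := toFibRepl _
      comm₁₂ := (toModelVertex_fst _).symm
      comm₁₃ := (toModelVertex_snd _).symm
      comm₂₄ := (toFibRepl_naturality _).symm
      comm₃₄ := (toFibRepl_naturality _).symm.trans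
        ((congrArg _ (MorphismProperty.MapFactorizationData.fac _).symm).trans
          (Category.assoc _ _ _).symm) }
  naturality sq sq' φ := by
    have h₃ : φ.τ₃ ≫ toFibRepl _ ≫ (fac ((fibRepl M).map sq'.f₃₄)).i =
        (toFibRepl _ ≫ (fac ((fibRepl M).map sq.f₃₄)).i) ≫ modelMap₃ φ := by
      rw [Category.assoc, i_facMap, ← Category.assoc, ← Category.assoc, toFibRepl_naturality]
    exact Square.hom_ext (toModelVertex_naturality φ) (toFibRepl_naturality _).symm h₃
      (toFibRepl_naturality _).symm

lemma isModelSquare_modelSquare (sq : Square M) : IsModelSquare ((modelSquare M).obj sq) := by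
  refine isModelSquare_of_isPullback _ (isPullback_modelVertex sq) ?_ ?_ ?_ (Or.inr ?_)
  · exact inferInstanceAs (IsFibrant ((fibRepl M).obj sq.X₂))
  · exact inferInstanceAs (IsFibrant (fac ((fibRepl M).map sq.f₃₄)).Z)
  · exact inferInstanceAs (IsFibrant ((fibRepl M).obj sq.X₄))
  · exact fibration_fac_p _

lemma weakEquivalence_modelMap₁ {sq sq' : Square M} (φ : sq ⟶ sq') (h₂ : WeakEquivalence φ.τ₂)
    (h₃ : WeakEquivalence φ.τ₃) (h₄ : WeakEquivalence φ.τ₄) : WeakEquivalence (modelMap₁ φ) := by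
  have : WeakEquivalence (modelMap₃ φ) := weakEquivalence_facMap _ _ _
  exact weakEquivalence_cogluing (isPullback_modelVertex sq) (isPullback_modelVertex sq')
    ((fibRepl M).map φ.τ₂) (modelMap₃ φ) ((fibRepl M).map φ.τ₄) ((modelSquare M).map φ).comm₂₄
    ((modelSquare M).map φ).comm₃₄ (Or.inr inferInstance) (Or.inr inferInstance) _
    (modelMap₁_fst φ) (modelMap₁_snd φ)

/-- The upper left vertex of a model square is weakly equivalent to that of its fibrant model. Both
are compared with the pullback of a cospan of fibrant objects which witnesses that the square is a
model square; the cogluing lemma applies to this pullback and its own fibrant model. -/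
lemma weakEquivalence_toModelVertex (sq : Square M) (h : IsModelSquare sq) :
    WeakEquivalence (toModelVertex sq) := by
  obtain ⟨B, C, D, r, s, b, c, d, hb, hc, hB, hC, hD, hrs, wb, wc, wd, w⟩ := h
  have sqP := IsPullback.of_hasPullback r s
  let l : sq.X₁ ⟶ pullback r s := sqP.lift (sq.f₁₂ ≫ b) (sq.f₁₃ ≫ c) (by
    rw [Category.assoc, Category.assoc, ← hb, ← hc, ← Category.assoc, sq.fac, Category.assoc])
  have hl : WeakEquivalence l := by
    convert w using 1
    apply sqP.hom_ext
    · rw [pullback.lift_fst, sqP.lift_fst]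
    · rw [pullback.lift_snd, sqP.lift_snd]
  let sq' : Square M := ⟨pullback.fst r s, pullback.snd r s, r, s, sqP.w⟩
  let φ : sq ⟶ sq' :=
    { τ₁ := l
      τ₂ := b
      τ₃ := c
      τ₄ := d
      comm₁₂ := (sqP.lift_fst _ _ _).symm
      comm₁₃ := (sqP.lift_snd _ _ _).symm
      comm₂₄ := hb
      comm₃₄ := hc }
  have h₁ : WeakEquivalence (modelMap₁ φ) := weakEquivalence_modelMap₁ φ wb wc wd
  have h₂ : WeakEquivalence (toModelVertex sq') :=
    weakEquivalence_cogluing (Q := sq'.X₁) sqP (isPullback_modelVertex sq')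
      (toFibRepl B) (toFibRepl C ≫ (fac ((fibRepl M).map s)).i) (toFibRepl D)
      ((toModelSquare M).app sq').comm₂₄ ((toModelSquare M).app sq').comm₃₄ hrs
      (Or.inr inferInstance) _ ((toModelSquare M).app sq').comm₁₂.symm
      ((toModelSquare M).app sq').comm₁₃.symm
  have h₃ : WeakEquivalence (toModelVertex sq ≫ modelMap₁ φ) := by
    rw [← toModelVertex_naturality]
    exact inferInstanceAs (WeakEquivalence (l ≫ toModelVertex sq'))
  exact weakEquivalence_of_postcomp _ (modelMap₁ φ)

end Models

/-! ### The restriction functor is an equivalence of homotopy categories -/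

section Restriction

lemma lift_map_Q {C D : Type*} [Category C] [Category D] {W : MorphismProperty C} (F : C ⥤ D)
    (hF : W.IsInvertedBy F) {X Y : C} (f : X ⟶ Y) :
    (Localization.Construction.lift F hF).map (W.Q.map f) = F.map f := by
  have := Functor.congr_hom (Localization.Construction.fac F hF) f
  exact this.trans ((Category.id_comp _).trans (Category.comp_id _))

variable (M : Type u) [Category.{v} M] [ModelCategory M] [HasZeroObject M] [HasZeroMorphisms M]

/-- The square with `X₂ ⟶ X₄` the given morphism and with `X₁ = X₃ = 0`. It is not a homotopy fiber
sequence, but `modelSquare` turns it into one. -/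
noncomputable def zeroSquare : Arrow M ⥤ Square M where
  obj g :=
    { X₁ := 0
      X₃ := 0
      f₁₂ := 0
      f₁₃ := 0
      f₂₄ := g.hom
      f₃₄ := 0
      fac := by simp }
  map φ :=
    { τ₁ := 𝟙 0
      τ₂ := φ.left
      τ₃ := 𝟙 0
      τ₄ := φ.right }

/-- The natural morphism to a homotopy fiber sequence from the square with the same restriction and
with `X₁ = X₃ = 0`. -/
noncomputable def fromZeroSquare : restr M ⋙ zeroSquare M ⟶ (IsHoFibSeq M).ι where
  app x :=
    { τ₁ := (0 : 0 ⟶ x.obj.X₁)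
      τ₂ := 𝟙 x.obj.X₂
      τ₃ := (0 : 0 ⟶ x.obj.X₃)
      τ₄ := 𝟙 x.obj.X₄
      comm₁₂ := (isZero_zero M).eq_of_src _ _
      comm₁₃ := (isZero_zero M).eq_of_src _ _
      comm₂₄ := (Category.comp_id _).trans (Category.id_comp _).symm
      comm₃₄ := (isZero_zero M).eq_of_src _ _ }
  naturality _ _ _ := Square.hom_ext ((isZero_zero M).eq_of_src _ _)
    ((Category.comp_id _).trans (Category.id_comp _).symm) ((isZero_zero M).eq_of_src _ _)
    ((Category.comp_id _).trans (Category.id_comp _).symm)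

variable [MorphismProperty.HasFunctorialFactorization (trivialCofibrations M) (fibrations M)]

variable {M} in
lemma isHoFibSeq_modelSquare (sq : Square M) (h : WeakEquivalence (0 : (0 : M) ⟶ sq.X₃)) :
    IsHoFibSeq M ((modelSquare M).obj sq) := by
  refine ⟨isModelSquare_modelSquare sq, ?_⟩
  have : (0 : (0 : M) ⟶ ((modelSquare M).obj sq).X₃) =
      (0 : (0 : M) ⟶ sq.X₃) ≫ toFibRepl _ ≫ (fac ((fibRepl M).map sq.f₃₄)).i :=
    (isZero_zero M).eq_of_src _ _
  rw [this]
  exact inferInstanceAs (WeakEquivalence ((0 : (0 : M) ⟶ sq.X₃) ≫ toFibRepl sq.X₃ ≫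
    (fac ((fibRepl M).map sq.f₃₄)).i))

instance weakEquivalence_zero_zero : WeakEquivalence (0 : (0 : M) ⟶ 0) := by
  have : (0 : (0 : M) ⟶ 0) = 𝟙 _ := (isZero_zero M).eq_of_tgt _ _
  rw [this]
  infer_instance

/-- The homotopy fiber sequence obtained from a morphism by fibrant replacement. -/
noncomputable def arrowModel : Arrow M ⥤ HoFibSeq M :=
  ObjectProperty.lift _ (zeroSquare M ⋙ modelSquare M)
    (fun _ => isHoFibSeq_modelSquare _ (weakEquivalence_zero_zero M))

/-- The functorial fibrant model of a homotopy fiber sequence. -/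
noncomputable def seqModel : HoFibSeq M ⥤ HoFibSeq M :=
  ObjectProperty.lift _ ((IsHoFibSeq M).ι ⋙ modelSquare M)
    (fun x => isHoFibSeq_modelSquare _ x.property.2)

/-- The natural morphism from a homotopy fiber sequence to its fibrant model. -/
noncomputable def toSeqModel : 𝟭 (HoFibSeq M) ⟶ seqModel M where
  app x := ObjectProperty.homMk ((toModelSquare M).app x.obj)
  naturality x y φ := by
    apply ObjectProperty.hom_ext
    exact (toModelSquare M).naturality φ.hom

/-- The natural morphism to the fibrant model of a homotopy fiber sequence from the homotopy fiber
sequence determined by its restriction. -/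
noncomputable def fromArrowModel : restr M ⋙ arrowModel M ⟶ seqModel M where
  app x := ObjectProperty.homMk ((modelSquare M).map ((fromZeroSquare M).app x))
  naturality x y φ := by
    apply ObjectProperty.hom_ext
    exact ((modelSquare M).map_comp _ _).symm.trans
      ((congrArg _ ((fromZeroSquare M).naturality φ)).trans ((modelSquare M).map_comp _ _))

/-- The natural morphism from a morphism of `M` to its fibrant replacement. -/
noncomputable def toRestrArrowModel : 𝟭 (Arrow M) ⟶ arrowModel M ⋙ restr M where
  app g := Arrow.homMk (toFibRepl g.left) (toFibRepl g.right) (toFibRepl_naturality g.hom)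
  naturality g g' φ := by
    ext
    · exact (toFibRepl_naturality φ.left).symm
    · exact (toFibRepl_naturality φ.right).symm

variable {M} in
lemma seqWeq_toSeqModel (x : HoFibSeq M) : seqWeq M ((toSeqModel M).app x) := by
  refine ⟨weakEquivalence_toModelVertex x.obj x.property.1, ?_, ?_, ?_⟩
  · exact inferInstanceAs (WeakEquivalence (toFibRepl x.obj.X₂))
  · exact inferInstanceAs
      (WeakEquivalence (toFibRepl x.obj.X₃ ≫ (fac ((fibRepl M).map x.obj.f₃₄)).i))
  · exact inferInstanceAs (WeakEquivalence (toFibRepl x.obj.X₄))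

variable {M} in
lemma seqWeq_homMk_modelSquare {sq sq' : Square M} (hx : IsHoFibSeq M ((modelSquare M).obj sq))
    (hy : IsHoFibSeq M ((modelSquare M).obj sq')) (ψ : sq ⟶ sq')
    (h₂ : WeakEquivalence ψ.τ₂) (h₃ : WeakEquivalence ψ.τ₃) (h₄ : WeakEquivalence ψ.τ₄) :
    seqWeq M (ObjectProperty.homMk ((modelSquare M).map ψ) :
      (⟨_, hx⟩ : HoFibSeq M) ⟶ ⟨_, hy⟩) :=
  have : WeakEquivalence (modelMap₃ ψ) := weakEquivalence_facMap _ _ _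
  ⟨weakEquivalence_modelMap₁ ψ h₂ h₃ h₄,
    inferInstanceAs (WeakEquivalence ((fibRepl M).map ψ.τ₂)), this,
    inferInstanceAs (WeakEquivalence ((fibRepl M).map ψ.τ₄))⟩

variable {M} in
lemma seqWeq_fromArrowModel (x : HoFibSeq M) : seqWeq M ((fromArrowModel M).app x) :=
  seqWeq_homMk_modelSquare _ _ ((fromZeroSquare M).app x)
    (inferInstanceAs (WeakEquivalence (𝟙 x.obj.X₂))) x.property.2
    (inferInstanceAs (WeakEquivalence (𝟙 x.obj.X₄)))

variable {M} in
lemma seqWeq_map_arrowModel {g g' : Arrow M} (φ : g ⟶ g')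
    (hφ : (weakEquivalences M).arrow φ) : seqWeq M ((arrowModel M).map φ) :=
  seqWeq_homMk_modelSquare _ _ ((zeroSquare M).map φ)
    ((weakEquivalence_iff _).2 hφ.1) (inferInstanceAs (WeakEquivalence (𝟙 (0 : M))))
    ((weakEquivalence_iff _).2 hφ.2)

lemma isIso_whiskerRight_Q {C D : Type*} [Category C] [Category D] {F G : C ⥤ D}
    (W : MorphismProperty D) (τ : F ⟶ G) (h : ∀ X, W (τ.app X)) :
    IsIso (Functor.whiskerRight τ W.Q) := by
  have : ∀ X, IsIso ((Functor.whiskerRight τ W.Q).app X) := fun X => W.Q_inverts _ (h X)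
  exact NatIso.isIso_of_isIso_app _

/-- A morphism of `Ho(h(M))` is determined by its restriction, which is arbitrary: homotopy fibers
are functorial, and the zigzag of natural weak equivalences `toSeqModel`, `fromArrowModel` compares
any homotopy fiber sequence with the one determined by its restriction. -/
theorem isEquivalence_hoRestr : (hoRestr M).IsEquivalence := by
  have hG : (weakEquivalences M).arrow.IsInvertedBy (arrowModel M ⋙ (seqWeq M).Q) :=
    fun _ _ φ hφ => (seqWeq M).Q_inverts _ (seqWeq_map_arrowModel φ hφ)
  have i₁ := isIso_whiskerRight_Q (seqWeq M) (toSeqModel M) seqWeq_toSeqModel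
  have i₂ := isIso_whiskerRight_Q (seqWeq M) (fromArrowModel M) seqWeq_fromArrowModel
  have i₃ := isIso_whiskerRight_Q (weakEquivalences M).arrow (toRestrArrowModel M)
    (fun g => ⟨(weakEquivalence_iff _).1 (inferInstanceAs (WeakEquivalence (toFibRepl g.left))),
      (weakEquivalence_iff _).1 (inferInstanceAs (WeakEquivalence (toFibRepl g.right)))⟩)
  let F' := Localization.Construction.lift _ hG
  let e : (weakEquivalences M).arrow.Q ⋙ F' ≅ arrowModel M ⋙ (seqWeq M).Q :=
    Localization.Lifting.iso _ (weakEquivalences M).arrow _ _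
  let _ : Localization.Lifting (seqWeq M).Q (seqWeq M) (restr M ⋙ (weakEquivalences M).arrow.Q)
      (hoRestr M) := Localization.liftingConstructionLift _ _
  let e' : (seqWeq M).Q ⋙ hoRestr M ≅ restr M ⋙ (weakEquivalences M).arrow.Q :=
    Localization.Lifting.iso _ (seqWeq M) _ _
  exact Localization.isEquivalence (seqWeq M).Q (seqWeq M) (weakEquivalences M).arrow.Q
    (weakEquivalences M).arrow (restr M ⋙ (weakEquivalences M).arrow.Q) (hoRestr M)
    (arrowModel M ⋙ (seqWeq M).Q) F'
    (Functor.associator _ _ _ ≪≫ Functor.isoWhiskerLeft (restr M) e ≪≫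
      (Functor.associator _ _ _).symm ≪≫ asIso (Functor.whiskerRight (fromArrowModel M) _) ≪≫
      (asIso (Functor.whiskerRight (toSeqModel M) (seqWeq M).Q)).symm ≪≫ Functor.leftUnitor _)
    (Functor.associator _ _ _ ≪≫ Functor.isoWhiskerLeft (arrowModel M) e' ≪≫
      (Functor.associator _ _ _).symm ≪≫
      (asIso (Functor.whiskerRight (toRestrArrowModel M) (weakEquivalences M).arrow.Q)).symm ≪≫
      Functor.leftUnitor _)

end Restriction

section OnFiber

variable {M : Type u} [Category.{v} M] [ModelCategory M] [HasZeroObject M] [HasZeroMorphisms M]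
  {x y z : HoFibSeq M}

lemma hoRestr_map_Q (φ : x ⟶ y) :
    (hoRestr M).map ((seqWeq M).Q.map φ) = (weakEquivalences M).arrow.Q.map ((restr M).map φ) :=
  lift_map_Q _ _ φ

lemma onFiber_Q_map (φ : x ⟶ y) :
    onFiber ((seqWeq M).Q.map φ) = (toHo M).map φ.hom.τ₁ :=
  lift_map_Q _ _ φ

lemma onFiber_comp (Φ : (seqWeq M).Q.obj x ⟶ (seqWeq M).Q.obj y)
    (Ψ : (seqWeq M).Q.obj y ⟶ (seqWeq M).Q.obj z) : onFiber (Φ ≫ Ψ) = onFiber Φ ≫ onFiber Ψ :=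
  (hoFiberObj M).map_comp _ _

variable (M) in
/-- The functor from the homotopy category of morphisms of `M` to `Ho(M)` which is induced
by `(X ⟶ Y) ↦ X`. -/
noncomputable def hoSource : (weakEquivalences M).arrow.Localization ⥤ HoCat M :=
  Localization.Construction.lift (Arrow.leftFunc ⋙ toHo M)
    (fun _ _ _ hφ => (weakEquivalences M).Q_inverts _ hφ.1)

/-- The morphisms `X₁ ⟶ X₂` of homotopy fiber sequences are natural with respect to the morphisms
of `Ho(h(M))`. -/
lemma onFiber_comp_map_f₁₂ (Φ : (seqWeq M).Q.obj x ⟶ (seqWeq M).Q.obj y) :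
    onFiber Φ ≫ (toHo M).map y.obj.f₁₂ =
      (toHo M).map x.obj.f₁₂ ≫ (hoSource M).map ((hoRestr M).map Φ) := by
  let τ : (seqWeq M).Q ⋙ hoFiberObj M ⟶ (seqWeq M).Q ⋙ hoRestr M ⋙ hoSource M :=
    { app x := (toHo M).map x.obj.f₁₂
      naturality a b φ := by
        have h₁ := onFiber_Q_map φ
        have h₂ : (hoSource M).map ((hoRestr M).map ((seqWeq M).Q.map φ)) =
            (toHo M).map φ.hom.τ₂ := by
          rw [hoRestr_map_Q]
          exact lift_map_Q _ _ _
        refine (congrArg (· ≫ (toHo M).map b.obj.f₁₂) h₁).trans ?_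
        refine Eq.trans ?_ (congrArg ((toHo M).map a.obj.f₁₂ ≫ ·) h₂.symm)
        exact ((toHo M).map_comp _ _).symm.trans ((congrArg _ φ.hom.comm₁₂.symm).trans
          ((toHo M).map_comp _ _)) }
  have h := (Localization.Construction.natTransExtension τ).naturality Φ
  rw [Localization.Construction.natTransExtension_app,
    Localization.Construction.natTransExtension_app,
    Localization.Construction.NatTransExtension.app_eq,
    Localization.Construction.NatTransExtension.app_eq] at h
  exact h

end OnFiber

/-! ### Zero morphisms and products in the homotopy category -/

section Pair

variable {C : Type*} [Category C] {X Y : C} {c : BinaryFan X Y} (hc : IsLimit c) {A : C}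

lemma pair_fst (a : A ⟶ X) (b : A ⟶ Y) : pair hc a b ≫ c.fst = a :=
  hc.fac (BinaryFan.mk a b) ⟨WalkingPair.left⟩

lemma pair_snd (a : A ⟶ X) (b : A ⟶ Y) : pair hc a b ≫ c.snd = b :=
  hc.fac (BinaryFan.mk a b) ⟨WalkingPair.right⟩

lemma comp_pair {A' : C} (φ : A' ⟶ A) (a : A ⟶ X) (b : A ⟶ Y) :
    φ ≫ pair hc a b = pair hc (φ ≫ a) (φ ≫ b) :=
  BinaryFan.IsLimit.hom_ext hc
    ((Category.assoc _ _ _).trans ((congrArg (φ ≫ ·) (pair_fst hc a b)).trans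
      (pair_fst hc _ _).symm))
    ((Category.assoc _ _ _).trans ((congrArg (φ ≫ ·) (pair_snd hc a b)).trans
      (pair_snd hc _ _).symm))

end Pair

section HoBasic

variable {M : Type u} [Category.{v} M] [ModelCategory M]

lemma exists_cofibrant_iso (W : HoCat M) :
    ∃ (A : M) (_ : IsCofibrant A), Nonempty ((toHo M).obj A ≅ W) := by
  obtain ⟨A, hA, p, _, _⟩ := CofibrantObject.HoCat.exists_resolution
    ((Localization.Construction.objEquiv (weakEquivalences M)).symm W)
  exact ⟨A, hA, ⟨(hoIso (hw := by assumption) p).trans (Iso.refl _)⟩⟩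

lemma exists_fibrant_iso (W : HoCat M) :
    ∃ (A : M) (_ : IsFibrant A), Nonempty (W ≅ (toHo M).obj A) := by
  let X : M := (Localization.Construction.objEquiv (weakEquivalences M)).symm W
  let F := MorphismProperty.factorizationData (trivialCofibrations M) (fibrations M)
    (terminal.from X)
  have hi : WeakEquivalence F.i := by rw [weakEquivalence_iff]; exact F.hi.2
  have hp : Fibration F.p := by rw [fibration_iff]; exact F.hp
  refine ⟨F.Z, ?_, ⟨hoIso (B := F.Z) (hw := hi) F.i⟩⟩
  rwa [isFibrant_iff, Subsingleton.elim (terminal.from F.Z) F.p]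

/-- Morphisms of `Ho(M)` to a product of fibrant objects are determined by their components. From
a cofibrant object, homotopies of the components relative to the same cylinder are paired. -/
lemma toHo_prod_hom_ext {A B : M} [IsFibrant A] [IsFibrant B] {W : HoCat M}
    {φ ψ : W ⟶ (toHo M).obj (A ⨯ B)}
    (h₁ : φ ≫ (toHo M).map prod.fst = ψ ≫ (toHo M).map prod.fst)
    (h₂ : φ ≫ (toHo M).map prod.snd = ψ ≫ (toHo M).map prod.snd) : φ = ψ := by
  obtain ⟨C, hC, ⟨e⟩⟩ := exists_cofibrant_iso W
  have hAB : IsFibrant (A ⨯ B) := isFibrant_of_fibration (prod.fst : A ⨯ B ⟶ A)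
  rw [← cancel_epi e.hom]
  obtain ⟨f, hf⟩ := map_surjective_of_isLocalization (toHo M) C (A ⨯ B) (e.hom ≫ φ)
  obtain ⟨g, hg⟩ := map_surjective_of_isLocalization (toHo M) C (A ⨯ B) (e.hom ≫ ψ)
  have k₁ : (toHo M).map (f ≫ prod.fst) = (toHo M).map (g ≫ prod.fst) := by
    rw [Functor.map_comp, Functor.map_comp, hf, hg, Category.assoc, Category.assoc, h₁]
  have k₂ : (toHo M).map (f ≫ prod.snd) = (toHo M).map (g ≫ prod.snd) := by
    rw [Functor.map_comp, Functor.map_comp, hf, hg, Category.assoc, Category.assoc, h₂]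
  rw [← LeftHomotopyRel.iff_map_eq] at k₁ k₂
  obtain ⟨Q, _⟩ := Cylinder.exists_very_good C
  rw [← hf, ← hg, ← LeftHomotopyRel.iff_map_eq]
  refine ⟨Q, ⟨⟨prod.lift (k₁.leftHomotopy Q).h (k₂.leftHomotopy Q).h, ?_, ?_⟩⟩⟩
  · apply Limits.prod.hom_ext
    · rw [Category.assoc, prod.lift_fst, (k₁.leftHomotopy Q).h₀]
    · rw [Category.assoc, prod.lift_snd, (k₂.leftHomotopy Q).h₀]
  · apply Limits.prod.hom_ext
    · rw [Category.assoc, prod.lift_fst, (k₁.leftHomotopy Q).h₁]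
    · rw [Category.assoc, prod.lift_snd, (k₂.leftHomotopy Q).h₁]

lemma exists_toHo_prod_lift {A B : M} [IsFibrant A] [IsFibrant B] {W : HoCat M}
    (a : W ⟶ (toHo M).obj A) (b : W ⟶ (toHo M).obj B) :
    ∃ φ : W ⟶ (toHo M).obj (A ⨯ B), φ ≫ (toHo M).map prod.fst = a ∧
      φ ≫ (toHo M).map prod.snd = b := by
  obtain ⟨C, hC, ⟨e⟩⟩ := exists_cofibrant_iso W
  obtain ⟨f, hf⟩ := map_surjective_of_isLocalization (toHo M) C A (e.hom ≫ a)
  obtain ⟨g, hg⟩ := map_surjective_of_isLocalization (toHo M) C B (e.hom ≫ b)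
  refine ⟨e.inv ≫ (toHo M).map (prod.lift f g), ?_, ?_⟩
  · rw [Category.assoc, ← Functor.map_comp, prod.lift_fst, hf, e.inv_hom_id_assoc]
  · rw [Category.assoc, ← Functor.map_comp, prod.lift_snd, hg, e.inv_hom_id_assoc]

/-- The product of fibrant objects is a product in `Ho(M)`. -/
noncomputable def isLimitHoFan (A B : M) [IsFibrant A] [IsFibrant B] : IsLimit (hoFan A B) :=
  BinaryFan.IsLimit.mk _ (fun a b => (exists_toHo_prod_lift a b).choose)
    (fun a b => (exists_toHo_prod_lift a b).choose_spec.1)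
    (fun a b => (exists_toHo_prod_lift a b).choose_spec.2)
    (fun a b _ h₁ h₂ => toHo_prod_hom_ext
      (h₁.trans (exists_toHo_prod_lift a b).choose_spec.1.symm)
      (h₂.trans (exists_toHo_prod_lift a b).choose_spec.2.symm))

section HoPair

variable {A B : M} [IsFibrant A] [IsFibrant B] {W : HoCat M} (a : W ⟶ (toHo M).obj A)
  (b : W ⟶ (toHo M).obj B)

/-- The morphism of `Ho(M)` to a product of fibrant objects with given components. -/
noncomputable def hoPair : W ⟶ (toHo M).obj (A ⨯ B) := pair (isLimitHoFan A B) a b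

lemma hoPair_fst : hoPair a b ≫ (toHo M).map prod.fst = a := pair_fst (isLimitHoFan A B) a b

lemma hoPair_snd : hoPair a b ≫ (toHo M).map prod.snd = b := pair_snd (isLimitHoFan A B) a b

lemma comp_hoPair {W' : HoCat M} (φ : W' ⟶ W) : φ ≫ hoPair a b = hoPair (φ ≫ a) (φ ≫ b) :=
  comp_pair (isLimitHoFan A B) φ a b

variable {a b} in
lemma hoPair_eq {φ : W ⟶ (toHo M).obj (A ⨯ B)} (h₁ : φ ≫ (toHo M).map prod.fst = a)
    (h₂ : φ ≫ (toHo M).map prod.snd = b) : hoPair a b = φ :=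
  toHo_prod_hom_ext ((hoPair_fst a b).trans h₁.symm) ((hoPair_snd a b).trans h₂.symm)

end HoPair

end HoBasic

section HoZero

variable {M : Type u} [Category.{v} M] [ModelCategory M] [HasZeroObject M] [HasZeroMorphisms M]

/-- The zero object of `M` is terminal in `Ho(M)`. -/
instance subsingleton_hom_toHo_zero (W : HoCat M) : Subsingleton (W ⟶ (toHo M).obj 0) := by
  refine ⟨fun φ ψ => ?_⟩
  obtain ⟨C, hC, ⟨e⟩⟩ := exists_cofibrant_iso W
  have := isFibrant_zero M
  rw [← cancel_epi e.hom]
  obtain ⟨f, hf⟩ := map_surjective_of_isLocalization (toHo M) C 0 (e.hom ≫ φ)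
  obtain ⟨g, hg⟩ := map_surjective_of_isLocalization (toHo M) C 0 (e.hom ≫ ψ)
  rw [← hf, ← hg, (isZero_zero M).eq_of_tgt f g]

/-- The zero object of `M` is initial in `Ho(M)`. -/
instance subsingleton_toHo_zero_hom (W : HoCat M) : Subsingleton ((toHo M).obj 0 ⟶ W) := by
  refine ⟨fun φ ψ => ?_⟩
  obtain ⟨C, hC, ⟨e⟩⟩ := exists_fibrant_iso W
  have : IsCofibrant (0 : M) := by
    have : IsIso (initial.to (0 : M)) :=
      isIso_of_isInitial initialIsInitial (isZero_zero M).isInitial _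
    infer_instance
  rw [← cancel_mono e.hom]
  obtain ⟨f, hf⟩ := map_surjective_of_isLocalization (toHo M) 0 C (φ ≫ e.hom)
  obtain ⟨g, hg⟩ := map_surjective_of_isLocalization (toHo M) 0 C (ψ ≫ e.hom)
  rw [← hf, ← hg, (isZero_zero M).eq_of_src f g]

lemma toHo_map_zero (A B : M) : (toHo M).map (0 : A ⟶ B) =
    hoZero ((toHo M).obj A) ((toHo M).obj B) := rfl

/-- Morphisms through the zero object are zero. In particular zero morphisms of `Ho(M)` are absorbing
for composition with arbitrary morphisms of `Ho(M)`, not only with images of morphisms of `M`. -/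
lemma comp_toHo_zero_comp {W Z : HoCat M} (φ : W ⟶ (toHo M).obj 0) (ψ : (toHo M).obj 0 ⟶ Z) :
    φ ≫ ψ = hoZero W Z := by
  have h : hoZero W Z = hoZero W ((toHo M).obj 0) ≫ hoZero ((toHo M).obj 0) Z := by
    exact (congrArg (toHo M).map comp_zero.symm).trans ((toHo M).map_comp _ _)
  rw [h, Subsingleton.elim φ (hoZero W _), Subsingleton.elim ψ (hoZero _ Z)]

lemma comp_hoZero {W W' Z : HoCat M} (φ : W ⟶ W') : φ ≫ hoZero W' Z = hoZero W Z := by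
  rw [← comp_toHo_zero_comp (hoZero W' ((toHo M).obj 0)) (hoZero _ Z), ← Category.assoc,
    comp_toHo_zero_comp]

lemma hoZero_comp {W Z Z' : HoCat M} (φ : Z ⟶ Z') : hoZero W Z ≫ φ = hoZero W Z' := by
  rw [← comp_toHo_zero_comp (hoZero W ((toHo M).obj 0)) (hoZero _ Z), Category.assoc,
    comp_toHo_zero_comp]

/-- Morphisms through an acyclic object are zero in `Ho(M)`. -/
lemma comp_comp_eq_hoZero {E : M} (hE : WeakEquivalence (0 : (0 : M) ⟶ E)) {W Z : HoCat M}
    (φ : W ⟶ (toHo M).obj E) (ψ : (toHo M).obj E ⟶ Z) : φ ≫ ψ = hoZero W Z := by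
  have h : φ ≫ ψ = (φ ≫ inv ((toHo M).map (0 : (0 : M) ⟶ E))) ≫
      ((toHo M).map (0 : (0 : M) ⟶ E) ≫ ψ) := by simp
  rw [h, comp_toHo_zero_comp]

end HoZero

/-! ### The action of the based loops on homotopy kernels -/

namespace BasedPathSpaceFunctor

variable {M : Type u} [Category.{v} M] [ModelCategory M] [HasZeroObject M] [HasZeroMorphisms M]
  (B : BasedPathSpaceFunctor M)

instance (V : M) [IsFibrant V] : Fibration (B.π V) := B.fibration_π V

instance (V : M) [IsFibrant V] : IsFibrant (B.Path₀.obj V) := isFibrant_of_fibration (B.π V)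

section HoKernel

variable {V X Y : M} (g : X ⟶ V) (g' : Y ⟶ V)

/-- The path component `K_g ⟶ Path₀ V`. -/
noncomputable def kPath : B.hoKernel g ⟶ B.Path₀.obj V := pullback.fst _ _

/-- The projection `K_g ⟶ X`. -/
noncomputable def kPt : B.hoKernel g ⟶ X := pullback.snd _ _

lemma isPullback_hoKernel : IsPullback (B.kPath g) (B.kPt g) (B.π V) g :=
  IsPullback.of_hasPullback _ _

variable {g} in
/-- The morphism to `K_g` given by a based path and a point over its end point. -/
noncomputable def kLift {A : M} (a : A ⟶ B.Path₀.obj V) (x : A ⟶ X) (w : a ≫ B.π V = x ≫ g) :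
    A ⟶ B.hoKernel g := (B.isPullback_hoKernel g).lift a x w

@[simp]
lemma kLift_kPath {A : M} (a : A ⟶ B.Path₀.obj V) (x : A ⟶ X) (w : a ≫ B.π V = x ≫ g) :
    B.kLift a x w ≫ B.kPath g = a := IsPullback.lift_fst _ _ _ _

@[simp]
lemma kLift_kPath_assoc {A : M} (a : A ⟶ B.Path₀.obj V) (x : A ⟶ X) (w : a ≫ B.π V = x ≫ g)
    {Z : M} (z : B.Path₀.obj V ⟶ Z) :
    B.kLift a x w ≫ B.kPath g ≫ z = a ≫ z := by
  rw [← Category.assoc, kLift_kPath]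

@[simp]
lemma kLift_kPt {A : M} (a : A ⟶ B.Path₀.obj V) (x : A ⟶ X) (w : a ≫ B.π V = x ≫ g) :
    B.kLift a x w ≫ B.kPt g = x := IsPullback.lift_snd _ _ _ _

@[simp]
lemma kLift_kPt_assoc {A : M} (a : A ⟶ B.Path₀.obj V) (x : A ⟶ X) (w : a ≫ B.π V = x ≫ g)
    {Z : M} (z : X ⟶ Z) :
    B.kLift a x w ≫ B.kPt g ≫ z = x ≫ z := by
  rw [← Category.assoc, kLift_kPt]

variable {B g} in
lemma hoKernel_ext {A : M} {k k' : A ⟶ B.hoKernel g} (h₁ : k ≫ B.kPath g = k' ≫ B.kPath g)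
    (h₂ : k ≫ B.kPt g = k' ≫ B.kPt g) : k = k' :=
  (B.isPullback_hoKernel g).hom_ext h₁ h₂

/-- The structural morphism `K_g ⟶ V`, so that `K` is an endofunctor of the category of objects
over `V`. -/
noncomputable def kStr : B.hoKernel g ⟶ V := B.kPt g ≫ g

lemma kPath_π : B.kPath g ≫ B.π V = B.kStr g := (B.isPullback_hoKernel g).w

lemma kPt_comp : B.kPt g ≫ g = B.kStr g := rfl

variable {g g'} in
/-- The functoriality of `K_g` with respect to morphisms over `V`. -/
noncomputable def kMap (h : X ⟶ Y) (w : h ≫ g' = g) : B.hoKernel g ⟶ B.hoKernel g' :=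
  B.kLift (B.kPath g) (B.kPt g ≫ h) (by rw [kPath_π, Category.assoc, w, kPt_comp])

variable {g g'} in
@[simp]
lemma kMap_kPath (h : X ⟶ Y) (w : h ≫ g' = g) : B.kMap h w ≫ B.kPath g' = B.kPath g :=
  B.kLift_kPath _ _ _ _

variable {g g'} in
@[simp]
lemma kMap_kPath_assoc (h : X ⟶ Y) (w : h ≫ g' = g) {Z : M} (z : B.Path₀.obj V ⟶ Z) :
    B.kMap h w ≫ B.kPath g' ≫ z = B.kPath g ≫ z := by
  rw [← Category.assoc, kMap_kPath]

variable {g g'} in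
@[simp]
lemma kMap_kPt (h : X ⟶ Y) (w : h ≫ g' = g) : B.kMap h w ≫ B.kPt g' = B.kPt g ≫ h :=
  B.kLift_kPt _ _ _ _

variable {g g'} in
@[simp]
lemma kMap_kPt_assoc (h : X ⟶ Y) (w : h ≫ g' = g) {Z : M} (z : Y ⟶ Z) :
    B.kMap h w ≫ B.kPt g' ≫ z = B.kPt g ≫ h ≫ z := by
  rw [← Category.assoc, kMap_kPt, Category.assoc]

variable {g g'} in
lemma kMap_kStr (h : X ⟶ Y) (w : h ≫ g' = g) : B.kMap h w ≫ B.kStr g' = B.kStr g := by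
  rw [← kPath_π, kMap_kPath_assoc, kPath_π]

/-- The projection of `Path₀ V ×_V Path₀ V ×_V X` to the first two factors. -/
noncomputable def proj₀₁ : B.hoKernel (B.kStr g) ⟶ B.hoKernel (B.π V) :=
  B.kMap (B.kPath g) (B.kPath_π g)

/-- The projection of `Path₀ V ×_V Path₀ V ×_V X` to the first and the last factor. -/
noncomputable def proj₀₂ : B.hoKernel (B.kStr g) ⟶ B.hoKernel g :=
  B.kMap (B.kPt g) (B.kPt_comp g)

lemma proj₀₁_kStr : B.proj₀₁ g ≫ B.kStr (B.π V) = B.kStr (B.kStr g) := B.kMap_kStr _ _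

lemma proj₀₂_kStr : B.proj₀₂ g ≫ B.kStr g = B.kStr (B.kStr g) := B.kMap_kStr _ _

/-- The projection of `Path₀ V ×_V Path₀ V ×_V X` to the last two factors. -/
noncomputable def proj₁₂ : B.hoKernel (B.kStr g) ⟶ B.hoKernel g := B.kPt (B.kStr g)

@[simp]
lemma proj₀₁_kPath : B.proj₀₁ g ≫ B.kPath _ = B.kPath _ := B.kMap_kPath _ _

@[simp]
lemma proj₀₁_kPt : B.proj₀₁ g ≫ B.kPt _ = B.proj₁₂ g ≫ B.kPath g := B.kMap_kPt _ _

@[simp]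
lemma proj₀₂_kPath : B.proj₀₂ g ≫ B.kPath _ = B.kPath _ := B.kMap_kPath _ _

@[simp]
lemma proj₀₂_kPt : B.proj₀₂ g ≫ B.kPt _ = B.proj₁₂ g ≫ B.kPt g := B.kMap_kPt _ _

@[simp]
lemma proj₀₂_kPt_assoc {Z : M} (z : X ⟶ Z) :
    B.proj₀₂ g ≫ B.kPt g ≫ z = B.proj₁₂ g ≫ B.kPt g ≫ z := by
  rw [← Category.assoc, proj₀₂_kPt, Category.assoc]

@[simp]
lemma kLift_proj₁₂ {A : M} (a : A ⟶ B.Path₀.obj V) (x : A ⟶ B.hoKernel g)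
    (w : a ≫ B.π V = x ≫ B.kStr g) : B.kLift a x w ≫ B.proj₁₂ g = x := B.kLift_kPt _ _ _ _

@[simp]
lemma kLift_proj₁₂_assoc {A : M} (a : A ⟶ B.Path₀.obj V) (x : A ⟶ B.hoKernel g)
    (w : a ≫ B.π V = x ≫ B.kStr g) {Z : M} (z : B.hoKernel g ⟶ Z) :
    B.kLift a x w ≫ B.proj₁₂ g ≫ z = x ≫ z := by
  rw [← Category.assoc, kLift_proj₁₂]

variable {g g'} in
@[simp]
lemma kMap_proj₁₂ {h : X ⟶ B.hoKernel g'} (w : h ≫ B.kStr g' = g) :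
    B.kMap h w ≫ B.proj₁₂ g' = B.kPt g ≫ h := B.kMap_kPt _ _

variable {g g'} in
@[simp]
lemma kMap_proj₁₂_assoc {h : X ⟶ B.hoKernel g'} (w : h ≫ B.kStr g' = g) {Z : M} (z : B.hoKernel g' ⟶ Z) :
    B.kMap h w ≫ B.proj₁₂ g' ≫ z = B.kPt g ≫ h ≫ z := by
  rw [← Category.assoc, kMap_proj₁₂, Category.assoc]

/-- The diagonal of `Path₀ V` over `V`. -/
noncomputable def diag (V : M) : B.Path₀.obj V ⟶ B.hoKernel (B.π V) := B.kLift (𝟙 _) (𝟙 _) rfl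

/-- The exchange of the two factors of `Path₀ V ×_V Path₀ V`. -/
noncomputable def swap (V : M) : B.hoKernel (B.π V) ⟶ B.hoKernel (B.π V) :=
  B.kLift (B.kPt _) (B.kPath _) (by rw [kPath_π, kPt_comp])

instance [IsFibrant V] : Fibration (B.kPt g) := fibration_of_isPullback (B.isPullback_hoKernel g)

instance [IsFibrant V] [IsFibrant X] : IsFibrant (B.hoKernel g) :=
  isFibrant_of_fibration (B.kPt g)

/-- The Segal morphism `Path₀ V ×_V Path₀ V ×_V X ⟶ (Path₀ V ×_V Path₀ V) × (Path₀ V ×_V X)`. -/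
noncomputable def segal : B.hoKernel (B.kStr g) ⟶ B.hoKernel (B.π V) ⨯ B.hoKernel g :=
  prod.lift (B.proj₀₁ g) (B.proj₁₂ g)

/-- The object `Path₀ V ×_V Path₀ V ×_V X` is the fiber product of `Path₀ V ×_V Path₀ V` and `K_g`
over the middle copy of `Path₀ V`. -/
lemma isPullback_segal :
    IsPullback (B.proj₀₁ g) (B.proj₁₂ g) (B.kPt (B.π V)) (B.kPath g) := by
  refine IsPullback.of_right ?_ (B.proj₀₁_kPt g) (B.isPullback_hoKernel (B.π V))
  rw [proj₀₁_kPath, kPath_π]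
  exact B.isPullback_hoKernel (B.kStr g)

/-- As `Path₀ V` is acyclic, the fiber product over it is weakly equivalent to the product. -/
lemma weakEquivalence_segal [IsFibrant V] [IsFibrant X] : WeakEquivalence (B.segal g) := by
  have hE := B.acyclic V
  have hT : WeakEquivalence (terminal.from (B.Path₀.obj V)) := by
    have h : IsIso (terminal.from (0 : M)) :=
      isIso_of_isTerminal (isZero_zero M).isTerminal terminalIsTerminal _
    exact weakEquivalence_of_precomp_of_fac (f := (0 : (0 : M) ⟶ B.Path₀.obj V))
      (fg := terminal.from (0 : M)) (Subsingleton.elim _ _)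
  have hF : IsFibrant (⊤_ M) := by
    have h : terminal.from (⊤_ M) = 𝟙 _ := Subsingleton.elim _ _
    rw [isFibrant_iff, h]
    infer_instance
  have hK : Fibration (terminal.from (B.hoKernel (B.π V))) := by
    rw [← isFibrant_iff]
    infer_instance
  exact weakEquivalence_cogluing_left (B.isPullback_segal g)
    (IsPullback.of_hasBinaryProduct' (B.hoKernel (B.π V)) (B.hoKernel g)) (𝟙 _) (𝟙 _)
    (terminal.from _) (Subsingleton.elim _ _) (Subsingleton.elim _ _) _
    ((prod.lift_fst _ _).trans (Category.comp_id _).symm)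
    ((prod.lift_snd _ _).trans (Category.comp_id _).symm)

end HoKernel

section Action

variable {V X Y : M} [IsFibrant V] [IsFibrant X] [IsFibrant Y] (g : X ⟶ V) {g' : Y ⟶ V}
  {W : HoCat M}

/-- The action of `Path₀ V ×_V Path₀ V` on `K_g` in `Ho(M)`: `(e₀, e₁)` sends `(e₁, x)` to
`(e₀, x)`. -/
noncomputable def act : (toHo M).obj (B.hoKernel (B.π V) ⨯ B.hoKernel g) ⟶
    (toHo M).obj (B.hoKernel g) :=
  have := B.weakEquivalence_segal g
  inv ((toHo M).map (B.segal g)) ≫ (toHo M).map (B.proj₀₂ g)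

/-- The action of `Path₀ V ×_V Path₀ V` on `K_g` in `Ho(M)`, on generalized elements. -/
noncomputable def smul (a : W ⟶ (toHo M).obj (B.hoKernel (B.π V)))
    (k : W ⟶ (toHo M).obj (B.hoKernel g)) : W ⟶ (toHo M).obj (B.hoKernel g) :=
  hoPair a k ≫ B.act g

lemma comp_smul {W' : HoCat M} (φ : W' ⟶ W) (a : W ⟶ (toHo M).obj (B.hoKernel (B.π V)))
    (k : W ⟶ (toHo M).obj (B.hoKernel g)) :
    φ ≫ B.smul g a k = B.smul g (φ ≫ a) (φ ≫ k) := by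
  rw [smul, smul, ← Category.assoc, comp_hoPair]

/-- A generalized element of `Path₀ V ×_V Path₀ V ×_V X` computes the action. -/
lemma smul_eq (t : W ⟶ (toHo M).obj (B.hoKernel (B.kStr g))) :
    B.smul g (t ≫ (toHo M).map (B.proj₀₁ g)) (t ≫ (toHo M).map (B.proj₁₂ g)) =
      t ≫ (toHo M).map (B.proj₀₂ g) := by
  have := B.weakEquivalence_segal g
  have h : hoPair (t ≫ (toHo M).map (B.proj₀₁ g)) (t ≫ (toHo M).map (B.proj₁₂ g)) =
      t ≫ (toHo M).map (B.segal g) := by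
    apply hoPair_eq
    · rw [Category.assoc, ← Functor.map_comp, segal, prod.lift_fst]
    · rw [Category.assoc, ← Functor.map_comp, segal, prod.lift_snd]
  rw [smul, h, act, Category.assoc, IsIso.hom_inv_id_assoc]

/-- Every pair of generalized elements lifts along the Segal morphism, so that an identity between
iterated actions may be checked on the object of composable tuples, where it holds strictly. -/
lemma exists_proj (a : W ⟶ (toHo M).obj (B.hoKernel (B.π V)))
    (k : W ⟶ (toHo M).obj (B.hoKernel g)) :
    ∃ t : W ⟶ (toHo M).obj (B.hoKernel (B.kStr g)),
      t ≫ (toHo M).map (B.proj₀₁ g) = a ∧ t ≫ (toHo M).map (B.proj₁₂ g) = k := by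
  have := B.weakEquivalence_segal g
  have h₁ : B.segal g ≫ prod.fst = B.proj₀₁ g := prod.lift_fst _ _
  have h₂ : B.segal g ≫ prod.snd = B.proj₁₂ g := prod.lift_snd _ _
  obtain ⟨t, rfl, rfl⟩ := exists_toHo_prod_lift a k
  refine ⟨t ≫ inv ((toHo M).map (B.segal g)), ?_, ?_⟩
  · rw [← h₁, Functor.map_comp, Category.assoc, IsIso.inv_hom_id_assoc]
  · rw [← h₂, Functor.map_comp, Category.assoc, IsIso.inv_hom_id_assoc]

lemma smul_toHo_map {A : M} (t : A ⟶ B.hoKernel (B.kStr g)) :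
    B.smul g ((toHo M).map (t ≫ B.proj₀₁ g)) ((toHo M).map (t ≫ B.proj₁₂ g)) =
      (toHo M).map (t ≫ B.proj₀₂ g) := by
  simp only [Functor.map_comp]
  exact B.smul_eq g _

variable {g} in
lemma smul_kMap (h : X ⟶ Y) (w : h ≫ g' = g) (a : W ⟶ (toHo M).obj (B.hoKernel (B.π V)))
    (k : W ⟶ (toHo M).obj (B.hoKernel g)) :
    B.smul g' a (k ≫ (toHo M).map (B.kMap h w)) = B.smul g a k ≫ (toHo M).map (B.kMap h w) := by
  obtain ⟨t, rfl, rfl⟩ := B.exists_proj g a k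
  let l : B.hoKernel (B.kStr g) ⟶ B.hoKernel (B.kStr g') := B.kMap (B.kMap h w) (B.kMap_kStr h w)
  have h₁ : l ≫ B.proj₀₁ g' = B.proj₀₁ g := hoKernel_ext (by simp [l]) (by simp [l, proj₁₂])
  have h₂ : l ≫ B.proj₁₂ g' = B.proj₁₂ g ≫ B.kMap h w := by simp [l, proj₁₂]
  have h₃ : l ≫ B.proj₀₂ g' = B.proj₀₂ g ≫ B.kMap h w :=
    hoKernel_ext (by simp [l]) (by simp [l, proj₁₂])
  have := B.smul_eq g' (t ≫ (toHo M).map l)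
  simp only [Category.assoc, ← Functor.map_comp, h₁, h₂, h₃] at this
  rw [Category.assoc, ← Functor.map_comp, this, B.smul_eq, Category.assoc, ← Functor.map_comp]

/-- The strict associativity of composition in the groupoid `Path₀ V ×_V Path₀ V` over `Path₀ V`
yields the associativity of the action. -/
lemma smul_smul (a b : W ⟶ (toHo M).obj (B.hoKernel (B.π V)))
    (k : W ⟶ (toHo M).obj (B.hoKernel g)) :
    B.smul g (B.smul (B.π V) a b) k = B.smul g a (B.smul g b k) := by
  obtain ⟨t₁, rfl, rfl⟩ := B.exists_proj g b k
  obtain ⟨t, rfl, rfl⟩ := B.exists_proj (B.kStr g) a t₁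
  -- for `(e₀, e₁, e₂, x)`, the two sides are computed by way of `(e₀, e₁, e₂)` and of `(e₀, e₁, x)`,
  -- `(e₀, e₂, x)`, `(e₁, e₂, x)`; both give `(e₀, x)`
  let p₀₁₂ : B.hoKernel (B.kStr (B.kStr g)) ⟶ B.hoKernel (B.kStr (B.π V)) :=
    B.kMap (B.proj₀₁ g) (B.proj₀₁_kStr g)
  let p₀₁₃ : B.hoKernel (B.kStr (B.kStr g)) ⟶ B.hoKernel (B.kStr g) :=
    B.kMap (B.proj₀₂ g) (B.proj₀₂_kStr g)
  have h₁ : p₀₁₂ ≫ B.proj₀₁ _ = B.proj₀₁ (B.kStr g) :=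
    hoKernel_ext (by simp [p₀₁₂]) (by simp [p₀₁₂, proj₁₂])
  have h₂ : p₀₁₂ ≫ B.proj₁₂ _ = B.proj₁₂ (B.kStr g) ≫ B.proj₀₁ g := by simp [p₀₁₂, proj₁₂]
  have h₃ : p₀₁₂ ≫ B.proj₀₂ _ = B.proj₀₂ (B.kStr g) ≫ B.proj₀₁ g :=
    hoKernel_ext (by simp [p₀₁₂]) (by
      simp only [p₀₁₂, proj₀₂_kPt, Category.assoc, proj₀₁_kPt, kMap_proj₁₂_assoc]
      simp [proj₁₂, proj₀₂])
  have h₄ : p₀₁₃ ≫ B.proj₀₁ _ = B.proj₀₁ (B.kStr g) :=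
    hoKernel_ext (by simp [p₀₁₃]) (by simp [p₀₁₃, proj₁₂])
  have h₅ : p₀₁₃ ≫ B.proj₁₂ _ = B.proj₁₂ (B.kStr g) ≫ B.proj₀₂ g := by simp [p₀₁₃, proj₁₂]
  have h₆ : p₀₁₃ ≫ B.proj₀₂ _ = B.proj₀₂ (B.kStr g) ≫ B.proj₀₂ g :=
    hoKernel_ext (by simp [p₀₁₃]) (by
      simp only [p₀₁₃, proj₀₂_kPt, Category.assoc, kMap_proj₁₂_assoc]
      simp [proj₁₂, proj₀₂])
  have h₇ : B.proj₀₂ (B.kStr g) ≫ B.proj₁₂ g = B.proj₁₂ (B.kStr g) ≫ B.proj₁₂ g := by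
    simp [proj₁₂, proj₀₂]
  have e₁ := B.smul_eq _ (t ≫ (toHo M).map p₀₁₂)
  have e₂ := B.smul_eq _ (t ≫ (toHo M).map p₀₁₃)
  have e₃ := B.smul_eq g (t ≫ (toHo M).map (B.proj₀₂ (B.kStr g)))
  have e₄ := B.smul_eq g (t ≫ (toHo M).map (B.proj₁₂ (B.kStr g)))
  simp only [Category.assoc, ← Functor.map_comp, h₁, h₂, h₃, h₄, h₅, h₆, h₇] at e₁ e₂ e₃ e₄
  simp only [Category.assoc, ← Functor.map_comp]
  rw [e₁, e₃, e₄, e₂]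

/-- The identities of the groupoid `Path₀ V ×_V Path₀ V` are zero, since they are parametrized by the
acyclic object `Path₀ V`. -/
lemma comp_diag (φ : W ⟶ (toHo M).obj (B.Path₀.obj V)) :
    φ ≫ (toHo M).map (B.diag V) = hoZero _ _ :=
  comp_comp_eq_hoZero (B.acyclic V) _ _

lemma zero_smul (k : W ⟶ (toHo M).obj (B.hoKernel g)) : B.smul g (hoZero _ _) k = k := by
  let d : B.hoKernel g ⟶ B.hoKernel (B.kStr g) :=
    B.kLift (B.kPath g) (𝟙 _) (by rw [kPath_π, Category.id_comp])
  have h₁ : d ≫ B.proj₀₁ g = B.kPath g ≫ B.diag V :=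
    hoKernel_ext (by simp [d, diag]) (by simp [d, diag])
  have h₂ : d ≫ B.proj₁₂ g = 𝟙 _ := by simp [d]
  have h₃ : d ≫ B.proj₀₂ g = 𝟙 _ := hoKernel_ext (by simp [d]) (by simp [d])
  have := B.smul_eq _ (k ≫ (toHo M).map d)
  simp only [Category.assoc, ← Functor.map_comp, h₁, h₂, h₃] at this
  rw [Functor.map_comp, ← Category.assoc, comp_diag, (toHo M).map_id, Category.comp_id] at this
  exact this

lemma smul_zero (a : W ⟶ (toHo M).obj (B.hoKernel (B.π V))) :
    B.smul (B.π V) a (hoZero _ _) = a := by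
  let d : B.hoKernel (B.π V) ⟶ B.hoKernel (B.kStr (B.π V)) :=
    B.kMap (B.diag V) (by rw [← kPath_π, diag, kLift_kPath_assoc, Category.id_comp])
  have h₁ : d ≫ B.proj₀₁ _ = 𝟙 _ := hoKernel_ext (by simp [d]) (by simp [d, diag])
  have h₂ : d ≫ B.proj₁₂ _ = B.kPt _ ≫ B.diag V := by simp [d]
  have h₃ : d ≫ B.proj₀₂ _ = 𝟙 _ := hoKernel_ext (by simp [d]) (by simp [d, diag])
  have := B.smul_eq _ (a ≫ (toHo M).map d)
  simp only [Category.assoc, ← Functor.map_comp, h₁, h₂, h₃] at this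
  rw [Functor.map_comp, ← Category.assoc _ _ ((toHo M).map (B.diag V)), comp_diag,
    (toHo M).map_id, Category.comp_id] at this
  exact this

lemma smul_swap (a : W ⟶ (toHo M).obj (B.hoKernel (B.π V))) :
    B.smul (B.π V) a (a ≫ (toHo M).map (B.swap V)) = hoZero _ _ := by
  let d : B.hoKernel (B.π V) ⟶ B.hoKernel (B.kStr (B.π V)) :=
    B.kLift (B.kPath _) (B.swap V) (by
      rw [kPath_π, ← kPath_π (g := B.π V), swap, kLift_kPath_assoc, kPt_comp, kPath_π])
  have h₁ : d ≫ B.proj₀₁ _ = 𝟙 _ := hoKernel_ext (by simp [d]) (by simp [d, swap])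
  have h₂ : d ≫ B.proj₁₂ _ = B.swap V := by simp [d]
  have h₃ : d ≫ B.proj₀₂ _ = B.kPath _ ≫ B.diag V :=
    hoKernel_ext (by simp [d, diag]) (by simp [d, diag, swap])
  have := B.smul_eq _ (a ≫ (toHo M).map d)
  simp only [Category.assoc, ← Functor.map_comp, h₁, h₂, h₃] at this
  rw [(toHo M).map_id, Category.comp_id, Functor.map_comp, ← Category.assoc, comp_diag] at this
  exact this

lemma swap_smul (a : W ⟶ (toHo M).obj (B.hoKernel (B.π V))) :
    B.smul (B.π V) (a ≫ (toHo M).map (B.swap V)) a = hoZero _ _ := by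
  have h : B.swap V ≫ B.swap V = 𝟙 _ := hoKernel_ext (by simp [swap]) (by simp [swap])
  have := B.smul_swap (a ≫ (toHo M).map (B.swap V))
  rwa [Category.assoc, ← Functor.map_comp, h, (toHo M).map_id, Category.comp_id] at this

end Action

section Bracket

variable {V X : M} {g : X ⟶ V} {A : M}

/-- The morphism to `K_g` given by a loop and a point of the strict fiber of `g`. -/
noncomputable def bracket (l : A ⟶ B.loopObj V) (x : A ⟶ X) (hx : x ≫ g = 0) :
    A ⟶ B.hoKernel g :=
  B.kLift (l ≫ kernel.ι _) x (by rw [Category.assoc, kernel.condition, comp_zero, hx])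

lemma δ_eq_bracket (g : X ⟶ V) : B.δ g = B.bracket (𝟙 _) 0 zero_comp :=
  (B.isPullback_hoKernel g).hom_ext
    ((pullback.lift_fst _ _ _).trans (by simp [bracket]))
    ((pullback.lift_snd _ _ _).trans (by simp [bracket]))

lemma comp_bracket {A' : M} (f : A' ⟶ A) (l : A ⟶ B.loopObj V) (x : A ⟶ X) (hx : x ≫ g = 0) :
    f ≫ B.bracket l x hx = B.bracket (f ≫ l) (f ≫ x) (by rw [Category.assoc, hx, comp_zero]) :=
  hoKernel_ext (by simp [bracket]) (by simp [bracket])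

lemma bracket_zero_zero : B.bracket (0 : A ⟶ B.loopObj V) (0 : A ⟶ X) (g := g) zero_comp = 0 :=
  hoKernel_ext (by simp [bracket]) (by simp [bracket])

variable [IsFibrant V] [IsFibrant X]

/-- The loops embed into `Path₀ V ×_V Path₀ V` as the fiber of the second projection to the acyclic
object `Path₀ V`. -/
instance weakEquivalence_δ_π : WeakEquivalence (B.δ (B.π V)) := by
  have := isFibrant_zero M
  have sq : IsPullback (B.δ (B.π V)) (0 : B.loopObj V ⟶ 0) (B.kPt (B.π V)) 0 := by
    rw [δ_eq_bracket]
    refine IsPullback.of_right ?_ (by simp [bracket]) (B.isPullback_hoKernel (B.π V))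
    simpa [bracket] using isPullback_kernel (B.π V)
  have := B.acyclic V
  exact weakEquivalence_of_isPullback_fibration sq

/-- The loops act on the points of the strict fiber by `l • (0, x) = (l, x)`. -/
lemma smul_bracket (l : A ⟶ B.loopObj V) (x : A ⟶ X) (hx : x ≫ g = 0) :
    B.smul g ((toHo M).map l ≫ (toHo M).map (B.δ (B.π V)))
      ((toHo M).map (B.bracket 0 x hx)) = (toHo M).map (B.bracket l x hx) := by
  let t : A ⟶ B.hoKernel (B.kStr g) := B.kLift (l ≫ kernel.ι _) (B.bracket 0 x hx) (by
    rw [Category.assoc, kernel.condition, comp_zero, kStr, bracket, kLift_kPt_assoc, hx])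
  have h₁ : t ≫ B.proj₀₁ g = l ≫ B.δ (B.π V) := by
    rw [δ_eq_bracket]
    exact hoKernel_ext (by simp [t, bracket]) (by simp [t, bracket])
  have h₂ : t ≫ B.proj₁₂ g = B.bracket 0 x hx := by simp [t]
  have h₃ : t ≫ B.proj₀₂ g = B.bracket l x hx :=
    hoKernel_ext (by simp [t, bracket]) (by simp [t, bracket])
  have := B.smul_toHo_map g t
  rwa [h₁, h₂, h₃, Functor.map_comp] at this

/-- The action on the zero element. -/
lemma smul_hoZero {W : HoCat M} (φ : W ⟶ (toHo M).obj (B.loopObj V)) :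
    B.smul g (φ ≫ (toHo M).map (B.δ (B.π V))) (hoZero _ _) = φ ≫ (toHo M).map (B.δ g) := by
  have h := B.smul_bracket (g := g) (𝟙 (B.loopObj V)) 0 zero_comp
  rw [bracket_zero_zero, toHo_map_zero, (toHo M).map_id, Category.id_comp, ← δ_eq_bracket] at h
  rw [← h, comp_smul, comp_hoZero]

end Bracket

end BasedPathSpaceFunctor

/-! ### Loops acting on homotopy kernels -/

namespace PathSpaceFunctor

variable {M : Type u} [Category.{v} M] [ModelCategory M] [HasZeroObject M] [HasZeroMorphisms M]
  (P : PathSpaceFunctor M)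

instance (V : M) : WeakEquivalence (P.s V) := P.weakEquivalence_s V

instance (V : M) : Fibration (P.d V) := P.fibration_d V

instance (V : M) [IsFibrant V] : Fibration (P.d₁ V) :=
  inferInstanceAs (Fibration (P.pathObject V).p₁)

lemma isFibrant_kernel {U V : M} (p : U ⟶ V) [Fibration p] : IsFibrant (kernel p) := by
  have := isFibrant_zero M
  have := fibration_of_isPullback (isPullback_kernel p)
  exact isFibrant_of_fibration (0 : kernel p ⟶ 0)

instance (V : M) : IsFibrant (P.loop.obj V) := isFibrant_kernel (P.d V)

/-- The inclusion of the based paths into the paths. -/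
noncomputable def basedι (V : M) : P.based.Path₀.obj V ⟶ P.Path.obj V := kernel.ι (P.d₀ V)

instance (V : M) : Mono (P.basedι V) := inferInstanceAs (Mono (kernel.ι (P.d₀ V)))

lemma basedι_d₀ (V : M) : P.basedι V ≫ P.d₀ V = 0 := kernel.condition _

lemma basedι_d₁ (V : M) : P.basedι V ≫ P.d₁ V = P.based.π V := rfl

/-- A path that starts at the base point, seen as a based path. -/
noncomputable def basedLift {V A : M} (a : A ⟶ P.Path.obj V) (h : a ≫ P.d₀ V = 0) :
    A ⟶ P.based.Path₀.obj V := kernel.lift _ a h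

@[simp]
lemma basedLift_ι {V A : M} (a : A ⟶ P.Path.obj V) (h : a ≫ P.d₀ V = 0) :
    P.basedLift a h ≫ P.basedι V = a := kernel.lift_ι _ _ _

lemma basedLift_π {V A : M} (a : A ⟶ P.Path.obj V) (h : a ≫ P.d₀ V = 0) :
    P.basedLift a h ≫ P.based.π V = a ≫ P.d₁ V := by
  rw [← basedι_d₁, ← Category.assoc, basedLift_ι]

@[simp]
lemma loopIso_hom_ι (V : M) :
    (P.loopIso V).hom ≫ kernel.ι (P.based.π V) ≫ P.basedι V = P.loopι V :=
  (Category.assoc _ _ _).symm.trans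
    ((congrArg (· ≫ P.basedι V) (kernel.lift_ι _ _ _)).trans (kernel.lift_ι _ _ _))

@[simp]
lemma loopLift_ι {A X : M} (a : A ⟶ P.Path.obj X) (h₀ : a ≫ P.d₀ X = 0) (h₁ : a ≫ P.d₁ X = 0) :
    P.loopLift a h₀ h₁ ≫ P.loopι X = a := kernel.lift_ι _ _ _

section Bracket

variable {V X A : M} {g : X ⟶ V}

/-- The morphism to `K_g` given by a loop and a point of the strict fiber of `g`. -/
noncomputable def bracket (l : A ⟶ P.loop.obj V) (x : A ⟶ X) (hx : x ≫ g = 0) :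
    A ⟶ P.based.hoKernel g := P.based.bracket (l ≫ (P.loopIso V).hom) x hx

lemma comp_bracket {A' : M} (f : A' ⟶ A) (l : A ⟶ P.loop.obj V) (x : A ⟶ X) (hx : x ≫ g = 0) :
    f ≫ P.bracket l x hx = P.bracket (f ≫ l) (f ≫ x) (by rw [Category.assoc, hx, comp_zero]) := by
  simp only [bracket, BasedPathSpaceFunctor.comp_bracket, Category.assoc]

/-- A path in `V` that starts at the base point and a point of `X` over its end point. -/
noncomputable def pathPt (a : A ⟶ P.Path.obj V) (x : A ⟶ X) (h : a ≫ P.d₀ V = 0)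
    (w : a ≫ P.d₁ V = x ≫ g) : A ⟶ P.based.hoKernel g :=
  P.based.kLift (P.basedLift a h) x (by rw [basedLift_π, w])

lemma bracket_eq_pathPt (l : A ⟶ P.loop.obj V) (x : A ⟶ X) (hx : x ≫ g = 0) :
    P.bracket l x hx = P.pathPt (l ≫ P.loopι V) x
      (by rw [Category.assoc, loopι_d₀, comp_zero])
      (by rw [Category.assoc, loopι_d₁, comp_zero, hx]) := by
  refine BasedPathSpaceFunctor.hoKernel_ext ?_ (by simp [bracket, pathPt,
    BasedPathSpaceFunctor.bracket])
  rw [← cancel_mono (P.basedι V)]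
  simp [bracket, pathPt, BasedPathSpaceFunctor.bracket]

lemma pathPt_congr {a a' : A ⟶ P.Path.obj V} {x x' : A ⟶ X} (h : a ≫ P.d₀ V = 0)
    (w : a ≫ P.d₁ V = x ≫ g) (ha : a = a') (hx : x = x') :
    P.pathPt a x h w = P.pathPt a' x' (ha ▸ h) (ha ▸ hx ▸ w) := by
  subst ha hx
  rfl

/-- The paths in `V` that end in the image of `g : X ⟶ V` are fibered over `V ⨯ X`. -/
lemma fibration_pathSpace (g : X ⟶ V) :
    Fibration (prod.lift (pullback.fst (P.d₁ V) g ≫ P.d₀ V) (pullback.snd (P.d₁ V) g)) := by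
  have sq : IsPullback (pullback.fst (P.d₁ V) g)
      (prod.lift (pullback.fst (P.d₁ V) g ≫ P.d₀ V) (pullback.snd (P.d₁ V) g))
      (P.d V) (prod.map (𝟙 V) g) := by
    refine ⟨⟨?_⟩, ⟨PullbackCone.IsLimit.mk _
      (fun s => pullback.lift s.fst (s.snd ≫ prod.snd) ?_) ?_ ?_ ?_⟩⟩
    · apply Limits.prod.hom_ext
      · rw [Category.assoc, Category.assoc, P.d_fst, prod.map_fst, prod.lift_fst_assoc,
          Category.comp_id]
      · rw [Category.assoc, Category.assoc, P.d_snd, prod.map_snd, prod.lift_snd_assoc,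
          pullback.condition]
    · have := s.condition =≫ prod.snd
      rwa [Category.assoc, Category.assoc, P.d_snd, prod.map_snd, ← Category.assoc] at this
    · exact fun s => pullback.lift_fst _ _ _
    · intro s
      apply Limits.prod.hom_ext
      · have := s.condition =≫ prod.fst
        rw [Category.assoc, Category.assoc, P.d_fst, prod.map_fst, Category.comp_id] at this
        rw [Category.assoc, prod.lift_fst, pullback.lift_fst_assoc, this]
      · exact (Category.assoc _ _ _).trans ((congrArg _ (prod.lift_snd _ _)).trans
          (pullback.lift_snd _ _ _))
    · intro s m h₁ h₂
      apply pullback.hom_ext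
      · rw [pullback.lift_fst, h₁]
      · rw [pullback.lift_snd, ← h₂, Category.assoc, prod.lift_snd]
  exact fibration_of_isPullback sq

/-- Two families of paths in `V` with points of `X` over their end points, which are parametrized
by `I`, have the same start points, and agree on `A ⟶ I`, for a weak equivalence `s : A ⟶ I`,
coincide in `Ho(M)` where they start at the base point. -/
lemma toHo_map_pathPt_eq [IsFibrant X] {I Z : M} (s : A ⟶ I) [WeakEquivalence s]
    (a a' : I ⟶ P.Path.obj V) (x x' : I ⟶ X) (w : a ≫ P.d₁ V = x ≫ g)
    (w' : a' ≫ P.d₁ V = x' ≫ g) (hs : s ≫ a = s ≫ a') (hs' : s ≫ x = s ≫ x')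
    (h : a ≫ P.d₀ V = a' ≫ P.d₀ V) (k : Z ⟶ I) (hk : (k ≫ a) ≫ P.d₀ V = 0)
    (hk' : (k ≫ a') ≫ P.d₀ V = 0) :
    (toHo M).map (P.pathPt (g := g) (k ≫ a) (k ≫ x) hk (by simp only [Category.assoc, w])) =
      (toHo M).map (P.pathPt (k ≫ a') (k ≫ x') hk' (by simp only [Category.assoc, w'])) := by
  let t : pullback (P.d₁ V) g ⟶ V := pullback.fst (P.d₁ V) g ≫ P.d₀ V
  have ht : Fibration t := by
    have h₁ := P.fibration_pathSpace g
    have h₂ : prod.lift (pullback.fst (P.d₁ V) g ≫ P.d₀ V) (pullback.snd (P.d₁ V) g) ≫ prod.fst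
      = t := prod.lift_fst _ _
    rw [← h₂]
    infer_instance
  let r : kernel t ⟶ P.based.hoKernel g :=
    P.pathPt (kernel.ι t ≫ pullback.fst _ _) (kernel.ι t ≫ pullback.snd _ _)
      ((Category.assoc _ _ _).trans (kernel.condition t))
      (by simp only [Category.assoc, pullback.condition])
  have key (b : I ⟶ P.Path.obj V) (y : I ⟶ X) (hb : b ≫ P.d₁ V = y ≫ g)
      (hkb : (k ≫ b) ≫ P.d₀ V = 0) (hkt : (k ≫ pullback.lift b y hb) ≫ t = 0) :
      kernel.lift t (k ≫ pullback.lift b y hb) hkt ≫ r =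
        P.pathPt (k ≫ b) (k ≫ y) hkb (by simp only [Category.assoc, hb]) := by
    refine BasedPathSpaceFunctor.hoKernel_ext ?_ ?_
    · rw [← cancel_mono (P.basedι V)]
      simp only [r, pathPt, Category.assoc, BasedPathSpaceFunctor.kLift_kPath, basedLift_ι,
        kernel.lift_ι_assoc, pullback.lift_fst]
    · simp only [r, pathPt, Category.assoc, BasedPathSpaceFunctor.kLift_kPt,
        kernel.lift_ι_assoc, pullback.lift_snd]
  have hT (b : I ⟶ P.Path.obj V) (y : I ⟶ X) (hb : b ≫ P.d₁ V = y ≫ g) :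
      pullback.lift b y hb ≫ t = b ≫ P.d₀ V := pullback.lift_fst_assoc _ _ _ _
  have H := toHo_map_kernel_lift_eq s (pullback.lift a x w) (pullback.lift a' x' w')
    (by apply pullback.hom_ext <;> simp only [Category.assoc, pullback.lift_fst,
      pullback.lift_snd, hs, hs']) t
    (by rw [hT, hT, h]) k (by rw [Category.assoc, hT, ← Category.assoc, hk])
    (by rw [Category.assoc, hT, ← Category.assoc, hk'])
  have H' := congrArg (· ≫ (toHo M).map r) H
  simp only [← Functor.map_comp] at H'
  rwa [key _ _ _ hk, key _ _ _ hk'] at H'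

end Bracket

section Action

variable {V X Y : M} [IsFibrant V] [IsFibrant X] [IsFibrant Y] (g : X ⟶ V) {g' : Y ⟶ V}
  {W : HoCat M}

/-- A loop `l`, seen as the pair of based paths `(l, 0)` with the same end point. -/
noncomputable def loopPair (V : M) : (toHo M).obj (P.loop.obj V) ⟶
    (toHo M).obj (P.based.hoKernel (P.based.π V)) :=
  (toHo M).map (P.loopIso V).hom ≫ (toHo M).map (P.based.δ (P.based.π V))

instance : IsIso (P.loopPair V) := by
  unfold loopPair
  infer_instance

/-- The action of the loops of `V` on `K_g` in `Ho(M)`, on generalized elements. -/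
noncomputable def smul (l : W ⟶ (toHo M).obj (P.loop.obj V))
    (k : W ⟶ (toHo M).obj (P.based.hoKernel g)) : W ⟶ (toHo M).obj (P.based.hoKernel g) :=
  P.based.smul g (l ≫ P.loopPair V) k

lemma comp_smul {W' : HoCat M} (φ : W' ⟶ W) (l : W ⟶ (toHo M).obj (P.loop.obj V))
    (k : W ⟶ (toHo M).obj (P.based.hoKernel g)) :
    φ ≫ P.smul g l k = P.smul g (φ ≫ l) (φ ≫ k) := by
  rw [smul, smul, BasedPathSpaceFunctor.comp_smul, Category.assoc]

variable {g} in
lemma smul_kMap (h : X ⟶ Y) (w : h ≫ g' = g) (l : W ⟶ (toHo M).obj (P.loop.obj V))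
    (k : W ⟶ (toHo M).obj (P.based.hoKernel g)) :
    P.smul g' l (k ≫ (toHo M).map (P.based.kMap h w)) =
      P.smul g l k ≫ (toHo M).map (P.based.kMap h w) :=
  P.based.smul_kMap h w _ k

lemma zero_smul (k : W ⟶ (toHo M).obj (P.based.hoKernel g)) : P.smul g (hoZero _ _) k = k := by
  rw [smul, hoZero_comp, BasedPathSpaceFunctor.zero_smul]

lemma smul_hoZero (l : W ⟶ (toHo M).obj (P.loop.obj V)) :
    P.smul g l (hoZero _ _) =
      l ≫ (toHo M).map (P.loopIso V).hom ≫ (toHo M).map (P.based.δ g) := by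
  rw [smul, loopPair, ← Category.assoc l, BasedPathSpaceFunctor.smul_hoZero, Category.assoc]

lemma smul_bracket {A : M} (l : A ⟶ P.loop.obj V) (x : A ⟶ X) (hx : x ≫ g = 0) :
    P.smul g ((toHo M).map l) ((toHo M).map (P.bracket 0 x hx)) =
      (toHo M).map (P.bracket l x hx) := by
  have := P.based.smul_bracket (l ≫ (P.loopIso V).hom) x hx
  rw [Functor.map_comp, Category.assoc] at this
  simpa only [smul, loopPair, bracket, zero_comp] using this

variable (V) in
/-- The multiplication of `Ω V` in `Ho(M)`, which corresponds to the composition of the groupoid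
`Path₀ V ×_V Path₀ V` over `Path₀ V`. -/
noncomputable def loopMul : (toHo M).obj (P.loop.obj V ⨯ P.loop.obj V) ⟶
    (toHo M).obj (P.loop.obj V) :=
  P.smul (P.based.π V) ((toHo M).map prod.fst) ((toHo M).map prod.snd ≫ P.loopPair V) ≫
    inv (P.loopPair V)

variable (V) in
/-- The object `Ω V ⨯ Ω V` is a product in `Ho(M)`. -/
noncomputable abbrev isLimitLoopFan : IsLimit (hoFan (P.loop.obj V) (P.loop.obj V)) :=
  isLimitHoFan _ _

/-- The product of two generalized elements of `Ω V`. -/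
noncomputable def mul (a b : W ⟶ (toHo M).obj (P.loop.obj V)) : W ⟶ (toHo M).obj (P.loop.obj V) :=
  hoPair a b ≫ P.loopMul V

lemma mul_loopPair (a b : W ⟶ (toHo M).obj (P.loop.obj V)) :
    P.mul a b ≫ P.loopPair V = P.smul (P.based.π V) a (b ≫ P.loopPair V) := by
  rw [mul, loopMul, Category.assoc, Category.assoc, IsIso.inv_hom_id, Category.comp_id, comp_smul,
    hoPair_fst, ← Category.assoc, hoPair_snd]

lemma mul_smul (a b : W ⟶ (toHo M).obj (P.loop.obj V))
    (k : W ⟶ (toHo M).obj (P.based.hoKernel g)) :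
    P.smul g (P.mul a b) k = P.smul g a (P.smul g b k) := by
  rw [smul, mul_loopPair]
  exact P.based.smul_smul g _ _ _

lemma mul_assoc (a b c : W ⟶ (toHo M).obj (P.loop.obj V)) :
    P.mul (P.mul a b) c = P.mul a (P.mul b c) := by
  rw [← cancel_mono (P.loopPair V), mul_loopPair, mul_loopPair, mul_loopPair, mul_smul]

lemma zero_mul (a : W ⟶ (toHo M).obj (P.loop.obj V)) : P.mul (hoZero _ _) a = a := by
  rw [← cancel_mono (P.loopPair V), mul_loopPair, zero_smul]

lemma mul_zero (a : W ⟶ (toHo M).obj (P.loop.obj V)) : P.mul a (hoZero _ _) = a := by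
  rw [← cancel_mono (P.loopPair V), mul_loopPair, hoZero_comp, smul,
    BasedPathSpaceFunctor.smul_zero]

lemma exists_mul_inv (a : W ⟶ (toHo M).obj (P.loop.obj V)) :
    ∃ b, P.mul a b = hoZero _ _ ∧ P.mul b a = hoZero _ _ := by
  refine ⟨a ≫ P.loopPair V ≫ (toHo M).map (P.based.swap V) ≫ inv (P.loopPair V), ?_, ?_⟩
  · rw [← cancel_mono (P.loopPair V), mul_loopPair, hoZero_comp, smul]
    simpa only [Category.assoc, IsIso.inv_hom_id, Category.comp_id] using
      P.based.smul_swap (a ≫ P.loopPair V)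
  · rw [← cancel_mono (P.loopPair V), mul_loopPair, hoZero_comp, smul]
    simpa only [Category.assoc, IsIso.inv_hom_id, Category.comp_id] using
      P.based.swap_smul (a ≫ P.loopPair V)

lemma isGroupLaw_loopMul : IsGroupLaw (P.isLimitLoopFan V) (P.loopMul V) :=
  ⟨fun _ a b c => P.mul_assoc a b c, fun _ a => ⟨P.zero_mul a, P.mul_zero a⟩,
    fun _ a => P.exists_mul_inv a⟩

end Action

/-! ### The multiplication of loops is concatenation -/

section Concat

variable (V : M)

/-- The evaluation at the start point of the paths that end at the base point. -/
noncomputable def coPi : kernel (P.d₁ V) ⟶ V := kernel.ι (P.d₁ V) ≫ P.d₀ V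

/-- A loop, seen as a path that ends at the base point. -/
noncomputable def loopToCo : P.loop.obj V ⟶ kernel (P.d₁ V) :=
  kernel.lift _ (P.loopι V) (P.loopι_d₁ V)

lemma loopToCo_coPi : P.loopToCo V ≫ P.coPi V = 0 := by
  rw [loopToCo, coPi, kernel.lift_ι_assoc, loopι_d₀]

lemma comp_loopToCo_coPi {A : M} (b : A ⟶ P.loop.obj V) : (b ≫ P.loopToCo V) ≫ P.coPi V = 0 := by
  rw [Category.assoc, loopToCo_coPi, comp_zero]

/-- The identification of the pairs of composable paths with trivial outer end points with the
homotopy kernel of `coPi`. -/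
noncomputable def brokenToKernel : P.brokenLoop V ⟶ P.based.hoKernel (P.coPi V) :=
  P.pathPt (kernel.ι _ ≫ pullback.fst _ _)
    (kernel.lift _ (kernel.ι _ ≫ pullback.snd _ _) (by
      have := kernel.condition (prod.lift (pullback.fst (P.d₁ V) (P.d₀ V) ≫ P.d₀ V)
        (pullback.snd (P.d₁ V) (P.d₀ V) ≫ P.d₁ V)) =≫ prod.snd
      rwa [Category.assoc, prod.lift_snd, zero_comp, ← Category.assoc] at this))
    (by
      have := kernel.condition (prod.lift (pullback.fst (P.d₁ V) (P.d₀ V) ≫ P.d₀ V)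
        (pullback.snd (P.d₁ V) (P.d₀ V) ≫ P.d₁ V)) =≫ prod.fst
      rwa [Category.assoc, prod.lift_fst, zero_comp, ← Category.assoc] at this)
    (by
      rw [coPi, kernel.lift_ι_assoc, Category.assoc, Category.assoc, pullback.condition])

/-- The inverse of `brokenToKernel`. -/
noncomputable def kernelToBroken : P.based.hoKernel (P.coPi V) ⟶ P.brokenLoop V :=
  kernel.lift _ (pullback.lift (P.based.kPath _ ≫ P.basedι V)
      (P.based.kPt _ ≫ kernel.ι (P.d₁ V)) (by
        rw [Category.assoc, basedι_d₁, BasedPathSpaceFunctor.kPath_π, Category.assoc]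
        rfl)) (by
    apply Limits.prod.hom_ext
    · rw [Category.assoc, prod.lift_fst, pullback.lift_fst_assoc, Category.assoc, basedι_d₀,
        comp_zero, zero_comp]
    · rw [Category.assoc, prod.lift_snd, pullback.lift_snd_assoc, Category.assoc,
        kernel.condition, comp_zero, zero_comp])

variable {V} {A : M} (a b : A ⟶ P.loop.obj V)

lemma toBroken_brokenToKernel : P.toBroken V a b ≫ P.brokenToKernel V =
    P.bracket a (b ≫ P.loopToCo V) (P.comp_loopToCo_coPi V b) := by
  rw [bracket_eq_pathPt]
  refine BasedPathSpaceFunctor.hoKernel_ext ?_ ?_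
  · rw [← cancel_mono (P.basedι V)]
    simp only [brokenToKernel, toBroken, pathPt, Category.assoc,
      BasedPathSpaceFunctor.kLift_kPath, basedLift_ι, kernel.lift_ι_assoc, pullback.lift_fst]
  · rw [← cancel_mono (kernel.ι _)]
    simp only [brokenToKernel, toBroken, pathPt, Category.assoc, loopToCo,
      BasedPathSpaceFunctor.kLift_kPt, kernel.lift_ι, kernel.lift_ι_assoc, pullback.lift_snd]

lemma bracket_kernelToBroken :
    P.bracket a (b ≫ P.loopToCo V) (P.comp_loopToCo_coPi V b) ≫ P.kernelToBroken V =
      P.toBroken V a b := by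
  rw [bracket_eq_pathPt, ← cancel_mono (kernel.ι _)]
  apply pullback.hom_ext
  · simp only [kernelToBroken, toBroken, pathPt, Category.assoc,
      BasedPathSpaceFunctor.kLift_kPath_assoc, basedLift_ι, kernel.lift_ι, pullback.lift_fst]
  · simp only [kernelToBroken, toBroken, pathPt, Category.assoc, loopToCo,
      BasedPathSpaceFunctor.kLift_kPt_assoc, kernel.lift_ι, pullback.lift_snd]

variable (V) in
/-- The pairs of loops `(l, 0)` and `(0, l)` coincide in `Ho(M)`: for a path `l`, the composable pairs
of `l` with the constant path at `l(1)`, and of the constant path at `l(0)` with `l`, have the same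
outer end points, and they agree if `l` is constant. -/
lemma toHo_map_toBroken_comm [IsFibrant V] :
    (toHo M).map (P.toBroken V (𝟙 _) 0) = (toHo M).map (P.toBroken V 0 (𝟙 _)) := by
  let t := prod.lift (pullback.fst (P.d₁ V) (P.d₀ V) ≫ P.d₀ V)
    (pullback.snd (P.d₁ V) (P.d₀ V) ≫ P.d₁ V)
  have ht : Fibration t := by
    have h₁ := P.fibration_pathSpace (P.d₀ V)
    have h₂ : Fibration (prod.map (𝟙 V) (P.d₁ V)) := by
      rw [fibration_iff]
      apply MorphismProperty.limMap
      rintro (_ | _)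
      · exact mem_fibrations (𝟙 V)
      · exact mem_fibrations (P.d₁ V)
    have h₃ : t = prod.lift (pullback.fst (P.d₁ V) (P.d₀ V) ≫ P.d₀ V)
        (pullback.snd (P.d₁ V) (P.d₀ V)) ≫ prod.map (𝟙 V) (P.d₁ V) := by
      rw [prod.lift_map, Category.comp_id]
    rw [h₃]
    infer_instance
  let f : P.Path.obj V ⟶ pullback (P.d₁ V) (P.d₀ V) :=
    pullback.lift (𝟙 _) (P.d₁ V ≫ P.s V) (by
      rw [Category.id_comp, Category.assoc, s_d₀, Category.comp_id])
  let f' : P.Path.obj V ⟶ pullback (P.d₁ V) (P.d₀ V) :=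
    pullback.lift (P.d₀ V ≫ P.s V) (𝟙 _) (by
      rw [Category.id_comp, Category.assoc, s_d₁, Category.comp_id])
  have hf₁ : f ≫ pullback.fst _ _ = 𝟙 _ := pullback.lift_fst _ _ _
  have hf₂ : f ≫ pullback.snd _ _ = P.d₁ V ≫ P.s V := pullback.lift_snd _ _ _
  have hf'₁ : f' ≫ pullback.fst _ _ = P.d₀ V ≫ P.s V := pullback.lift_fst _ _ _
  have hf'₂ : f' ≫ pullback.snd _ _ = 𝟙 _ := pullback.lift_snd _ _ _
  have hft : f ≫ t = f' ≫ t := by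
    apply Limits.prod.hom_ext
    · rw [Category.assoc, Category.assoc, prod.lift_fst, reassoc_of% hf₁, reassoc_of% hf'₁,
        s_d₀, Category.comp_id]
    · rw [Category.assoc, Category.assoc, prod.lift_snd, reassoc_of% hf₂, reassoc_of% hf'₂,
        s_d₁, Category.comp_id]
  have hs : P.s V ≫ f = P.s V ≫ f' := by
    apply pullback.hom_ext
    · rw [Category.assoc, Category.assoc, hf₁, hf'₁, ← Category.assoc, s_d₀, Category.comp_id,
        Category.id_comp]
    · rw [Category.assoc, Category.assoc, hf₂, hf'₂, ← Category.assoc, s_d₁, Category.comp_id,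
        Category.id_comp]
  have e : P.toBroken V (𝟙 _) 0 ≫ kernel.ι t = P.loopι V ≫ f := by
    rw [toBroken, kernel.lift_ι]
    apply pullback.hom_ext
    · rw [Category.assoc, pullback.lift_fst, hf₁, Category.id_comp, Category.comp_id]
    · rw [Category.assoc, pullback.lift_snd, hf₂, ← Category.assoc, loopι_d₁, zero_comp, zero_comp]
  have e' : P.toBroken V 0 (𝟙 _) ≫ kernel.ι t = P.loopι V ≫ f' := by
    rw [toBroken, kernel.lift_ι]
    apply pullback.hom_ext
    · rw [Category.assoc, pullback.lift_fst, hf'₁, ← Category.assoc, loopι_d₀, zero_comp,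
        zero_comp]
    · rw [Category.assoc, pullback.lift_snd, hf'₂, Category.id_comp, Category.comp_id]
  have w : (P.loopι V ≫ f) ≫ t = 0 := by rw [← e, Category.assoc, kernel.condition, comp_zero]
  have w' : (P.loopι V ≫ f') ≫ t = 0 := by rw [← e', Category.assoc, kernel.condition, comp_zero]
  have key := toHo_map_kernel_lift_eq (P.s V) f f' hs t hft (P.loopι V) w w'
  have k : kernel.lift t _ w = P.toBroken V (𝟙 _) 0 := by
    rw [← cancel_mono (kernel.ι t), kernel.lift_ι, e]
  have k' : kernel.lift t _ w' = P.toBroken V 0 (𝟙 _) := by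
    rw [← cancel_mono (kernel.ι t), kernel.lift_ι, e']
  rwa [k, k'] at key

variable (V) in
/-- The multiplication is concatenation. Write `[l, l']` for the pair of composable loops `l`, `l'`,
seen as an element of a homotopy kernel on which the loops act. Then `[l, l'] = l • [0, l']`, and
`[l, 0] = [0, l]`, whence `[l l', 0] = l • l' • 0 = l • [l', 0] = l • [0, l'] = [l, l']`. -/
lemma isConcat_loopMul [IsFibrant V] : P.IsConcat V (P.loopMul V) := by
  have := isFibrant_kernel (P.d₁ V)
  let β {A : M} (a b : A ⟶ P.loop.obj V) := P.bracket a (b ≫ P.loopToCo V)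
    (P.comp_loopToCo_coPi V b)
  have hβ {A A' : M} (f : A' ⟶ A) (a b : A ⟶ P.loop.obj V) : f ≫ β a b = β (f ≫ a) (f ≫ b) := by
    simp only [β, comp_bracket, Category.assoc]
  -- `[l, 0] = l • 0`
  have h₁ : (toHo M).map (β (𝟙 (P.loop.obj V)) 0) =
      P.smul (P.coPi V) (𝟙 _) (hoZero _ _) := by
    have h := P.smul_bracket (P.coPi V) (𝟙 (P.loop.obj V)) (0 ≫ P.loopToCo V)
      (P.comp_loopToCo_coPi V 0)
    have h0 : P.bracket 0 (0 ≫ P.loopToCo V) (P.comp_loopToCo_coPi V 0) =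
        (0 : P.loop.obj V ⟶ _) := by
      simp only [bracket, zero_comp, BasedPathSpaceFunctor.bracket_zero_zero]
    rw [h0, toHo_map_zero, (toHo M).map_id] at h
    exact h.symm
  have h₂ : (toHo M).map (β (𝟙 (P.loop.obj V)) 0) = (toHo M).map (β 0 (𝟙 _)) := by
    simp only [β, ← toBroken_brokenToKernel, Functor.map_comp, toHo_map_toBroken_comm]
  have hm : P.loopMul V = P.mul ((toHo M).map prod.fst) ((toHo M).map prod.snd) := by
    have h : hoPair ((toHo M).map prod.fst) ((toHo M).map prod.snd) =
        𝟙 ((toHo M).obj (P.loop.obj V ⨯ P.loop.obj V)) :=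
      hoPair_eq (Category.id_comp _) (Category.id_comp _)
    rw [mul, h, Category.id_comp]
  have h₃ : P.loopMul V ≫ (toHo M).map (β (𝟙 (P.loop.obj V)) 0) =
      (toHo M).map (β prod.fst prod.snd) := by
    rw [h₁, comp_smul, Category.comp_id, comp_hoZero, hm, mul_smul]
    have h₄ : P.smul (P.coPi V) ((toHo M).map (prod.snd : P.loop.obj V ⨯ P.loop.obj V ⟶ _))
        (hoZero _ _) = (toHo M).map (β 0 prod.snd) := by
      rw [← Category.comp_id prod.snd, ← comp_zero (f := prod.snd) (Z := P.loop.obj V), ← hβ,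
        Functor.map_comp _ _ (β _ _), ← h₂, h₁, comp_smul, Category.comp_id, comp_hoZero,
        Category.comp_id]
    rw [h₄]
    exact P.smul_bracket _ _ _ _
  have h₅ := congrArg (· ≫ (toHo M).map (P.kernelToBroken V)) h₃
  simp only [Category.assoc, ← Functor.map_comp, β, bracket_kernelToBroken] at h₅
  exact h₅

end Concat

/-! ### Quillen's action as an action on a homotopy kernel -/

section Quillen

variable {U V : M} (p : U ⟶ V)

/-- The inclusion of the strict kernel into the homotopy kernel. -/
noncomputable def kernelToHoKernel : kernel p ⟶ P.based.hoKernel p :=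
  P.bracket 0 (kernel.ι p) (kernel.condition p)

lemma kernelToHoKernel_kPt : P.kernelToHoKernel p ≫ P.based.kPt p = kernel.ι p := by
  simp [kernelToHoKernel, bracket, BasedPathSpaceFunctor.bracket]

lemma kernelToHoKernel_kPath : P.kernelToHoKernel p ≫ P.based.kPath p = 0 := by
  simp [kernelToHoKernel, bracket, BasedPathSpaceFunctor.bracket]

/-- The inclusion is the base change of `0 ⟶ Path₀ V` along a fibration. -/
instance weakEquivalence_kernelToHoKernel [Fibration p] [IsFibrant V] :
    WeakEquivalence (P.kernelToHoKernel p) := by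
  have := isFibrant_zero M
  have := P.based.acyclic V
  have : Fibration (P.based.kPath p) :=
    fibration_of_isPullback (P.based.isPullback_hoKernel p).flip
  have sq : IsPullback (P.kernelToHoKernel p) (0 : kernel p ⟶ 0) (P.based.kPath p) 0 := by
    refine (IsPullback.of_right (h₁₂ := P.based.kPt p) (h₂₂ := P.based.π V) ?_ ?_
      (P.based.isPullback_hoKernel p).flip)
    · rw [kernelToHoKernel_kPt, zero_comp]
      exact isPullback_kernel p
    · rw [kernelToHoKernel_kPath, zero_comp]
  exact weakEquivalence_of_isPullback_fibration sq

variable {P p} in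
/-- For a path `u` in `U` between points of the fiber, the pair of the loop `p u` and the end point
`u(1)` coincides with the pair of the constant loop and the start point `u(0)` in the homotopy kernel
of `p`, since both agree for constant `u`. -/
lemma LiftedPathObject.toHo_map_bracket_eq [IsFibrant U] (L : P.LiftedPathObject p) :
    (toHo M).map (P.bracket (g := p) L.imageLoop (L.endPt ≫ kernel.ι p)
        (by rw [Category.assoc, kernel.condition, comp_zero])) =
      (toHo M).map (P.bracket (g := p) 0 (L.startPt ≫ kernel.ι p)
        (by rw [Category.assoc, kernel.condition, comp_zero])) := by
  have e₁ : pullback.fst _ _ ≫ L.q = L.imageLoop ≫ P.loopι V := (P.loopLift_ι _ _ _).symm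
  have e₂ : pullback.fst (prod.lift L.I.p₀ L.I.p₁) (prod.map (kernel.ι p) (kernel.ι p)) ≫
      L.I.p₀ ≫ p ≫ P.s V = 0 ≫ P.loopι V := by
    rw [← Category.assoc, ← L.startPt_ι, Category.assoc, kernel.condition_assoc, zero_comp,
      zero_comp, comp_zero]
  have H := P.toHo_map_pathPt_eq L.I.ι L.q (L.I.p₀ ≫ p ≫ P.s V) L.I.p₁ L.I.p₀ L.q_d₁
    (by rw [Category.assoc, Category.assoc, s_d₁, Category.comp_id])
    (by rw [L.ι_q, ← Category.assoc, L.I.ι_p₀, Category.id_comp])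
    (by rw [L.I.ι_p₁, L.I.ι_p₀])
    (by rw [Category.assoc, Category.assoc, s_d₀, Category.comp_id, L.q_d₀])
    (pullback.fst (prod.lift L.I.p₀ L.I.p₁) (prod.map (kernel.ι p) (kernel.ι p)))
    (by rw [e₁, Category.assoc, loopι_d₀, comp_zero])
    (by rw [e₂, Category.assoc, loopι_d₀, comp_zero])
  rw [P.pathPt_congr _ _ e₁ L.endPt_ι.symm, P.pathPt_congr _ _ e₂ L.startPt_ι.symm] at H
  rw [bracket_eq_pathPt, bracket_eq_pathPt]
  exact H

/-- A lifted path object is a factorization of `U ⟶ Path V ×_(V × V) (U × U)`. -/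
lemma nonempty_liftedPathObject : Nonempty (P.LiftedPathObject p) := by
  have hd : (p ≫ P.s V) ≫ P.d V = prod.lift (𝟙 U) (𝟙 U) ≫ prod.map p p := by
    apply Limits.prod.hom_ext
    · rw [Category.assoc, P.d_fst, Category.assoc, s_d₀, Category.assoc, prod.map_fst,
        prod.lift_fst_assoc, Category.id_comp, Category.comp_id]
    · rw [Category.assoc, P.d_snd, Category.assoc, s_d₁, Category.assoc, prod.map_snd,
        prod.lift_snd_assoc, Category.id_comp, Category.comp_id]
  let F := MorphismProperty.factorizationData (trivialCofibrations M) (fibrations M)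
    (pullback.lift (f := P.d V) (g := prod.map p p) _ _ hd)
  have hi : WeakEquivalence F.i := by rw [weakEquivalence_iff]; exact F.hi.2
  have hp : Fibration F.p := by rw [fibration_iff]; exact F.hp
  have h₁ : F.i ≫ F.p ≫ pullback.fst _ _ = p ≫ P.s V := by
    rw [F.fac_assoc, pullback.lift_fst]
  have h₂ : F.i ≫ F.p ≫ pullback.snd _ _ = prod.lift (𝟙 U) (𝟙 U) := by
    rw [F.fac_assoc, pullback.lift_snd]
  have h₃ : (F.p ≫ pullback.fst _ _) ≫ P.d₀ V =
      (F.p ≫ pullback.snd (P.d V) (prod.map p p) ≫ prod.fst) ≫ p := by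
    have := pullback.condition (f := P.d V) (g := prod.map p p) =≫ prod.fst
    rw [Category.assoc, Category.assoc, P.d_fst, prod.map_fst] at this
    simp only [Category.assoc, this]
  have h₄ : (F.p ≫ pullback.fst _ _) ≫ P.d₁ V =
      (F.p ≫ pullback.snd (P.d V) (prod.map p p) ≫ prod.snd) ≫ p := by
    have := pullback.condition (f := P.d V) (g := prod.map p p) =≫ prod.snd
    rw [Category.assoc, Category.assoc, P.d_snd, prod.map_snd] at this
    simp only [Category.assoc, this]
  have h₅ : prod.lift (F.p ≫ pullback.snd (P.d V) (prod.map p p) ≫ prod.fst)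
      (F.p ≫ pullback.snd (P.d V) (prod.map p p) ≫ prod.snd) = F.p ≫ pullback.snd _ _ := by
    apply Limits.prod.hom_ext
    · rw [prod.lift_fst, Category.assoc]
    · rw [prod.lift_snd, Category.assoc]
  let I : PathObject U :=
    { P := F.Z
      p₀ := F.p ≫ pullback.snd _ _ ≫ prod.fst
      p₁ := F.p ≫ pullback.snd _ _ ≫ prod.snd
      ι := F.i
      ι_p₀ := by rw [← Category.assoc F.p, ← Category.assoc, h₂, prod.lift_fst]
      ι_p₁ := by rw [← Category.assoc F.p, ← Category.assoc, h₂, prod.lift_snd]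
      weakEquivalence_ι := hi }
  refine ⟨⟨I, F.p ≫ pullback.fst _ _, h₁, h₃, h₄, ?_⟩⟩
  convert hp using 1
  apply pullback.hom_ext
  · exact pullback.lift_fst _ _ _
  · exact (pullback.lift_snd _ _ _).trans h₅

variable {p} in
/-- Quillen's action on the kernel of a fibration is the restriction of the action of the loops
on the homotopy kernel. -/
lemma isQuillenAction_of_comp [Fibration p] [IsFibrant U] [IsFibrant V]
    {ρ : (toHo M).obj (P.loop.obj V ⨯ kernel p) ⟶ (toHo M).obj (kernel p)}
    (h : ρ ≫ (toHo M).map (P.kernelToHoKernel p) = P.smul p ((toHo M).map prod.fst)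
      ((toHo M).map prod.snd ≫ (toHo M).map (P.kernelToHoKernel p))) :
    P.IsQuillenAction p ρ := by
  obtain ⟨L⟩ := P.nonempty_liftedPathObject p
  refine ⟨L, ?_⟩
  have h₁ : L.loopEnd ≫ prod.fst = L.imageLoop := prod.lift_fst _ _
  have h₂ : L.loopEnd ≫ prod.snd = L.endPt := prod.lift_snd _ _
  rw [← cancel_mono ((toHo M).map (P.kernelToHoKernel p)), Category.assoc, h, comp_smul,
    ← Category.assoc, ← Functor.map_comp, ← Functor.map_comp, h₁, h₂, ← Functor.map_comp,
    ← Functor.map_comp]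
  simp only [kernelToHoKernel, comp_bracket, comp_zero]
  rw [smul_bracket]
  exact L.toHo_map_bracket_eq

end Quillen

/-! ### Derived loops -/

lemma isIso_RLoopUnit (V : M) [hV : IsFibrant V] : IsIso (P.RLoopUnit V) := by
  have h : (FibrantObject.localizerMorphism M).Derives (P.loop ⋙ toHo M) := by
    intro X Y f hf
    have : WeakEquivalence f.hom := (weakEquivalence_iff _).2 hf
    exact (weakEquivalences M).Q_inverts _
      ((weakEquivalence_iff _).1 (P.weakEquivalence_loop_map f.hom))
  exact h.isIso_of_isRightDerivedFunctor
    ((P.loop ⋙ toHo M).totalRightDerivedUnit (toHo M) (weakEquivalences M)) ⟨V, hV⟩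

end PathSpaceFunctor

variable {M : Type u} [Category.{v} M] [ModelCategory M] [HasZeroObject M] [HasZeroMorphisms M]

/-! ### Morphisms of homotopy fiber sequences that extend a given morphism -/

section Extension

variable [MorphismProperty.HasFunctorialFactorization (trivialCofibrations M) (fibrations M)]
  {x y : HoFibSeq M}

/-- The restriction functor is fully faithful on homotopy categories. -/
lemma existsUnique_extends (ξ : (weakEquivalences M).arrow.Q.obj (Arrow.mk x.obj.f₂₄) ⟶
    (weakEquivalences M).arrow.Q.obj (Arrow.mk y.obj.f₂₄)) :
    ∃! Ξ : (seqWeq M).Q.obj x ⟶ (seqWeq M).Q.obj y, Extends Ξ ξ := by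
  have := isEquivalence_hoRestr M
  obtain ⟨Ξ, hΞ⟩ := (hoRestr M).map_surjective
    (X := (seqWeq M).Q.obj x) (Y := (seqWeq M).Q.obj y) ξ
  exact ⟨Ξ, hΞ, fun Ξ' hΞ' => (hoRestr M).map_injective (hΞ'.trans hΞ.symm)⟩

lemma existsUnique_iso_extends (ξ : (weakEquivalences M).arrow.Q.obj (Arrow.mk x.obj.f₂₄) ⟶
    (weakEquivalences M).arrow.Q.obj (Arrow.mk y.obj.f₂₄)) (hξ : IsIso ξ) :
    ∃! Ξ : (seqWeq M).Q.obj x ≅ (seqWeq M).Q.obj y, Extends Ξ.hom ξ := by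
  obtain ⟨Ξ, hΞ, h⟩ := existsUnique_extends ξ
  obtain ⟨Ξ', hΞ', -⟩ := existsUnique_extends (inv ξ)
  have h₁ : Ξ ≫ Ξ' = 𝟙 _ := (existsUnique_extends (𝟙 _)).unique
    (((hoRestr M).map_comp _ _).trans ((congrArg₂ (· ≫ ·) hΞ hΞ').trans (IsIso.hom_inv_id ξ)))
    ((hoRestr M).map_id _)
  have h₂ : Ξ' ≫ Ξ = 𝟙 _ := (existsUnique_extends (𝟙 _)).unique
    (((hoRestr M).map_comp _ _).trans ((congrArg₂ (· ≫ ·) hΞ' hΞ).trans (IsIso.inv_hom_id ξ)))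
    ((hoRestr M).map_id _)
  exact ⟨⟨Ξ, Ξ', h₁, h₂⟩, hΞ, fun Ψ hΨ => Iso.ext (h _ hΨ)⟩

end Extension

namespace PathSpaceFunctor

variable (P : PathSpaceFunctor M)

/-! ### The action on an object isomorphic to a homotopy kernel -/

section Transport

variable (V Z : M) [IsFibrant V] [IsFibrant Z]

instance isIso_RLoopUnit_of_isFibrant : IsIso (P.RLoopUnit V) := P.isIso_RLoopUnit V

/-- The object `Ω V ⨯ Z` as a product of `ℝΩ V` and `Z` in `Ho(M)`. -/
noncomputable def derivedFan : BinaryFan (P.RLoop.obj ((toHo M).obj V)) ((toHo M).obj Z) :=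
  BinaryFan.mk (P := (toHo M).obj (P.loop.obj V ⨯ Z))
    ((toHo M).map prod.fst ≫ P.RLoopUnit V) ((toHo M).map prod.snd)

variable {V} in
lemma comp_inv_RLoopUnit_comp {W : HoCat M} (a : W ⟶ P.RLoop.obj ((toHo M).obj V)) :
    (a ≫ inv (P.RLoopUnit V)) ≫ P.RLoopUnit V = a := by
  rw [Category.assoc, IsIso.inv_hom_id, Category.comp_id]

/-- `derivedFan` is a product. -/
noncomputable def isLimitDerivedFan : IsLimit (P.derivedFan V Z) :=
  BinaryFan.IsLimit.mk _ (fun a b => hoPair (a ≫ inv (P.RLoopUnit V)) b)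
    (fun a _ => (Category.assoc _ _ _).symm.trans ((congrArg (· ≫ P.RLoopUnit V)
      (hoPair_fst _ _)).trans (P.comp_inv_RLoopUnit_comp a)))
    (fun _ _ => hoPair_snd _ _)
    (fun _ _ _ h₁ h₂ => (hoPair_eq
      ((IsIso.eq_comp_inv (P.RLoopUnit V)).2 ((Category.assoc _ _ _).trans h₁)) h₂).symm)

variable {V Z} {X : M} [IsFibrant X] (g : X ⟶ V)
  (e : (toHo M).obj (P.based.hoKernel g) ≅ (toHo M).obj Z)

/-- The action of the loops on an object of `Ho(M)` isomorphic to a homotopy kernel. -/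
noncomputable def derivedAct : (toHo M).obj (P.loop.obj V ⨯ Z) ⟶ (toHo M).obj Z :=
  P.smul g ((toHo M).map prod.fst) ((toHo M).map prod.snd ≫ e.inv) ≫ e.hom

lemma pair_comp_derivedAct {W : HoCat M} (a : W ⟶ P.RLoop.obj ((toHo M).obj V))
    (z : W ⟶ (toHo M).obj Z) :
    pair (P.isLimitDerivedFan V Z) a z ≫ P.derivedAct g e =
      P.smul g (a ≫ inv (P.RLoopUnit V)) (z ≫ e.inv) ≫ e.hom := by
  have h : hoPair (a ≫ inv (P.RLoopUnit V)) z ≫ P.derivedAct g e =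
      P.smul g (a ≫ inv (P.RLoopUnit V)) (z ≫ e.inv) ≫ e.hom := by
    rw [derivedAct, ← Category.assoc, comp_smul, hoPair_fst, ← Category.assoc, hoPair_snd]
  exact h

lemma isLeftAction_derivedAct : IsLeftAction (P.isLimitLoopFan V) (P.loopMul V) (P.RLoopUnit V)
    (P.isLimitDerivedFan V Z) (P.derivedAct g e) := by
  have hm {A : HoCat M} (a b : A ⟶ (toHo M).obj (P.loop.obj V)) :
      pair (P.isLimitLoopFan V) a b ≫ P.loopMul V = P.mul a b := rfl
  refine ⟨fun A z => ?_, fun A a b z => ?_⟩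
  · rw [pair_comp_derivedAct, Category.assoc, IsIso.hom_inv_id, Category.comp_id, zero_smul,
      Category.assoc, e.inv_hom_id, Category.comp_id]
  · simp only [hm, pair_comp_derivedAct, Category.assoc, IsIso.hom_inv_id, Category.comp_id,
      e.hom_inv_id, mul_smul]

/-- Both connecting morphisms are `l ↦ l • 0`. -/
lemma connectingQ_derivedAct :
    P.RLoopUnit V ≫ P.connectingQ (P.isLimitDerivedFan V Z) (P.derivedAct g e) =
      (toHo M).map (P.loopIso V).hom ≫ (toHo M).map (P.based.δ g) ≫ e.hom := by
  have h := P.pair_comp_derivedAct g e (𝟙 _) (hoZero (P.RLoop.obj ((toHo M).obj V)) _)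
  refine (congrArg (P.RLoopUnit V ≫ ·) h).trans ?_
  rw [Category.id_comp, hoZero_comp, smul_hoZero]
  simp only [Category.assoc, IsIso.hom_inv_id_assoc]

/-- If `g` is factored as a weak equivalence `w` followed by a fibration `p`, and if `i` is
compatible with the comparison of the kernel of `p` with the homotopy kernels of `p` and `g`, then
`i` identifies the action with Quillen's action. -/
lemma isQuillenAction_derivedAct {U : M} [IsFibrant U] (w : X ⟶ U) (p : U ⟶ V) [Fibration p]
    (hwp : w ≫ p = g) (i : (toHo M).obj Z ≅ (toHo M).obj (kernel p))
    (hi : e.hom ≫ i.hom ≫ (toHo M).map (P.kernelToHoKernel p) =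
      (toHo M).map (P.based.kMap w hwp)) :
    P.IsQuillenAction p
      (pair (P.isLimitDerivedFan V Z) ((toHo M).map prod.fst ≫ P.RLoopUnit V)
        ((toHo M).map prod.snd ≫ i.inv) ≫ P.derivedAct g e ≫ i.hom) := by
  apply isQuillenAction_of_comp
  have h₁ := P.pair_comp_derivedAct g e
    ((toHo M).map (prod.fst : P.loop.obj V ⨯ kernel p ⟶ _) ≫ P.RLoopUnit V)
    ((toHo M).map prod.snd ≫ i.inv)
  rw [Category.assoc _ _ (inv _), IsIso.hom_inv_id, Category.comp_id] at h₁
  refine (congrArg (· ≫ _) ((Category.assoc _ _ _).symm.trans (congrArg (· ≫ i.hom) h₁))).trans ?_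
  have h₂ : (toHo M).map (P.kernelToHoKernel p) =
      i.inv ≫ e.inv ≫ (toHo M).map (P.based.kMap w hwp) := by
    rw [← hi, e.inv_hom_id_assoc, i.inv_hom_id_assoc]
  rw [Category.assoc, Category.assoc, hi, ← smul_kMap _ w hwp, h₂]
  simp only [Category.assoc]

end Transport

/-! ### Comparison of strict and homotopy kernels in `h(M)` -/

section Comparison

variable {U V X : M} [IsFibrant U] [IsFibrant V] [IsFibrant X]

/-- The morphism from the kernel sequence to the homotopy kernel sequence of a fibration. -/
noncomputable def kernelSeqToHoKernelSeq (p : U ⟶ V) [Fibration p] :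
    kernelSeq p ⟶ P.based.hoKernelSeq p :=
  ObjectProperty.homMk
    { τ₁ := P.kernelToHoKernel p
      τ₂ := 𝟙 U
      τ₃ := (0 : 0 ⟶ P.based.Path₀.obj V)
      τ₄ := 𝟙 V
      comm₁₂ := (Category.comp_id _).trans (P.kernelToHoKernel_kPt p).symm
      comm₁₃ := comp_zero.trans (P.kernelToHoKernel_kPath p).symm
      comm₂₄ := (Category.comp_id _).trans (Category.id_comp _).symm
      comm₃₄ := (Category.comp_id _).trans zero_comp.symm }

/-- The functoriality of the homotopy kernel sequence. -/
noncomputable def hoKernelSeqMap {g : X ⟶ V} {p : U ⟶ V} (w : X ⟶ U) (hwp : w ≫ p = g) :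
    P.based.hoKernelSeq g ⟶ P.based.hoKernelSeq p :=
  ObjectProperty.homMk
    { τ₁ := P.based.kMap w hwp
      τ₂ := w
      τ₃ := 𝟙 _
      τ₄ := 𝟙 V
      comm₁₂ := (P.based.kMap_kPt w hwp).symm
      comm₁₃ := (Category.comp_id _).trans (P.based.kMap_kPath w hwp).symm
      comm₂₄ := (Category.comp_id _).trans hwp.symm
      comm₃₄ := (Category.comp_id _).trans (Category.id_comp _).symm }

variable [MorphismProperty.HasFunctorialFactorization (trivialCofibrations M) (fibrations M)]

/-- The composite `K_g ⟶ X ⟶ ker p ⟶ K_p` of the canonical isomorphisms is induced by `w`, since both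
morphisms of homotopy fiber sequences have the same restriction. -/
lemma onFiber_comparison {x : HoFibSeq M} [IsFibrant x.obj.X₂] [IsFibrant x.obj.X₄]
    (w : x.obj.X₂ ⟶ U) (p : U ⟶ x.obj.X₄) [Fibration p] (hwp : w ≫ p = x.obj.f₂₄)
    (Ξ₀ : (seqWeq M).Q.obj (P.based.hoKernelSeq x.obj.f₂₄) ⟶ (seqWeq M).Q.obj x)
    (h₀ : Extends Ξ₀ (𝟙 _))
    (Ξ : (seqWeq M).Q.obj x ⟶ (seqWeq M).Q.obj (kernelSeq p))
    (h : Extends Ξ ((weakEquivalences M).arrow.Q.map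
      (Arrow.homMk w (𝟙 x.obj.X₄) (hwp.trans (Category.comp_id _).symm)))) :
    onFiber Ξ₀ ≫ onFiber Ξ ≫ (toHo M).map (P.kernelToHoKernel p) =
      (toHo M).map (P.based.kMap w hwp) := by
  have := isEquivalence_hoRestr M
  have key : Ξ₀ ≫ Ξ ≫ (seqWeq M).Q.map (P.kernelSeqToHoKernelSeq p) =
      (seqWeq M).Q.map (P.hoKernelSeqMap w hwp) := by
    apply (hoRestr M).map_injective
    rw [Functor.map_comp, Functor.map_comp, hoRestr_map_Q, hoRestr_map_Q]
    refine (congrArg₂ (· ≫ ·) h₀ (congrArg (· ≫ _) h)).trans ?_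
    refine (Category.id_comp _).trans ?_
    refine ((weakEquivalences M).arrow.Q.map_comp _ _).symm.trans (congrArg _ ?_)
    exact Arrow.hom_ext _ _ (Category.comp_id w) (Category.comp_id _)
  have := congrArg onFiber key
  rwa [onFiber_comp, onFiber_comp, onFiber_Q_map, onFiber_Q_map] at this

end Comparison

/-- The canonical isomorphisms implement `x` as the kernel of `p`, with Quillen's action. -/
lemma isFibSeqVia_derivedAct
    [MorphismProperty.HasFunctorialFactorization (trivialCofibrations M) (fibrations M)]
    {x : HoFibSeq M} [IsFibrant x.obj.X₁] [IsFibrant x.obj.X₂] [IsFibrant x.obj.X₄]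
    (Ξ₀ : (seqWeq M).Q.obj (P.based.hoKernelSeq x.obj.f₂₄) ≅ (seqWeq M).Q.obj x)
    (h₀ : Extends Ξ₀.hom (𝟙 _)) {U : M} [IsFibrant U] (w : x.obj.X₂ ⟶ U) [WeakEquivalence w]
    (p : U ⟶ x.obj.X₄) [Fibration p] (hwp : w ≫ p = x.obj.f₂₄)
    (Ξ : (seqWeq M).Q.obj x ≅ (seqWeq M).Q.obj (kernelSeq p))
    (h : Extends Ξ.hom ((weakEquivalences M).arrow.Q.map
      (Arrow.homMk w (𝟙 x.obj.X₄) (hwp.trans (Category.comp_id _).symm)))) :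
    P.IsFibSeqVia ((toHo M).map x.obj.f₁₂) ((toHo M).map x.obj.f₂₄)
      (P.isLimitDerivedFan x.obj.X₄ x.obj.X₁)
      (P.derivedAct (Z := x.obj.X₁) x.obj.f₂₄ ((hoFiberObj M).mapIso Ξ₀)) p
      ((hoFiberObj M).mapIso Ξ) (hoIso w) (Iso.refl _) := by
  refine ⟨?_, ?_, ?_⟩
  · refine Eq.symm ((onFiber_comp_map_f₁₂ Ξ.hom).trans (congrArg _ ?_))
    exact (congrArg _ h).trans (lift_map_Q _ _ _)
  · refine (Category.comp_id _).trans ?_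
    exact (congrArg (toHo M).map hwp.symm).trans ((toHo M).map_comp _ _)
  · have := P.isQuillenAction_derivedAct (Z := x.obj.X₁) x.obj.f₂₄ ((hoFiberObj M).mapIso Ξ₀) w p hwp
      ((hoFiberObj M).mapIso Ξ) (P.onFiber_comparison w p hwp Ξ₀.hom h₀ Ξ.hom h)
    have hk : P.RLoopUnit x.obj.X₄ ≫ P.RLoop.map (Iso.refl ((toHo M).obj x.obj.X₄)).inv =
        P.RLoopUnit x.obj.X₄ :=
      (congrArg _ (P.RLoop.map_id _)).trans (Category.comp_id _)
    rw [hk]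
    exact this

end PathSpaceFunctor

end HoFib

theorem mainTheorem11 {M : Type u} [Category.{v} M] [ModelCategory M]
    [HasZeroObject M] [HasZeroMorphisms M]
    [MorphismProperty.HasFunctorialFactorization (trivialCofibrations M) (fibrations M)]
    [MorphismProperty.HasFunctorialFactorization (cofibrations M) (trivialFibrations M)]
    (P : HoFib.PathSpaceFunctor M) (x : HoFib.HoFibSeq M)
    [IsFibrant x.obj.X₁] [IsFibrant x.obj.X₂] [IsFibrant x.obj.X₃] [IsFibrant x.obj.X₄] :
    -- the canonical morphism of `Ho(h(M))` that defines the connecting morphism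
    (∃! Ξ : (HoFib.seqWeq M).Q.obj (P.based.hoKernelSeq x.obj.f₂₄) ⟶ (HoFib.seqWeq M).Q.obj x,
      HoFib.Extends Ξ (𝟙 _)) ∧
    -- the identification of the loop space of `𝔛` with its derived loop space
    IsIso (P.RLoopUnit x.obj.X₄) ∧
    -- the group object `Ω^Q 𝔛`
    ∃ (hG : IsLimit (HoFib.hoFan (P.loop.obj x.obj.X₄) (P.loop.obj x.obj.X₄)))
      (m : (HoFib.toHo M).obj (P.loop.obj x.obj.X₄ ⨯ P.loop.obj x.obj.X₄) ⟶
        (HoFib.toHo M).obj (P.loop.obj x.obj.X₄)),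
      P.IsConcat x.obj.X₄ m ∧ HoFib.IsGroupLaw hG m ∧
    ∃ (c : BinaryFan (P.RLoop.obj ((HoFib.toHo M).obj x.obj.X₄)) ((HoFib.toHo M).obj x.obj.X₁))
      (hc : IsLimit c) (R : c.pt ⟶ (HoFib.toHo M).obj x.obj.X₁),
      -- the fibration sequence, with its action
      P.IsFibrationSequence ((HoFib.toHo M).map x.obj.f₁₂) ((HoFib.toHo M).map x.obj.f₂₄) hc R ∧
      HoFib.IsLeftAction hG m (P.RLoopUnit x.obj.X₄) hc R ∧
      -- `R` is the morphism induced by any factorization `g = p ∘ w`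
      (∀ (U : M) (w : x.obj.X₂ ⟶ U) (p : U ⟶ x.obj.X₄) (_ : WeakEquivalence w)
        (_ : Fibration p) (_ : IsFibrant U) (hwp : w ≫ p = x.obj.f₂₄),
        (∃! Ξ : (HoFib.seqWeq M).Q.obj x ≅ (HoFib.seqWeq M).Q.obj (HoFib.kernelSeq p),
          HoFib.Extends Ξ.hom ((weakEquivalences M).arrow.Q.map
            (Arrow.homMk w (𝟙 x.obj.X₄) (hwp.trans (Category.comp_id _).symm)))) ∧
        ∀ Ξ : (HoFib.seqWeq M).Q.obj x ≅ (HoFib.seqWeq M).Q.obj (HoFib.kernelSeq p),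
          HoFib.Extends Ξ.hom ((weakEquivalences M).arrow.Q.map
            (Arrow.homMk w (𝟙 x.obj.X₄) (hwp.trans (Category.comp_id _).symm))) →
          P.IsFibSeqVia ((HoFib.toHo M).map x.obj.f₁₂) ((HoFib.toHo M).map x.obj.f₂₄) hc R p
            ((HoFib.hoFiberObj M).mapIso Ξ) (HoFib.hoIso w) (Iso.refl _)) ∧
      -- the two connecting morphisms coincide
      ∀ Ξ : (HoFib.seqWeq M).Q.obj (P.based.hoKernelSeq x.obj.f₂₄) ⟶ (HoFib.seqWeq M).Q.obj x,
        HoFib.Extends Ξ (𝟙 _) →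
          P.connecting x Ξ = P.RLoopUnit x.obj.X₄ ≫ P.connectingQ hc R := by
  have hQ (U : M) (w : x.obj.X₂ ⟶ U) (p : U ⟶ x.obj.X₄) (hw : WeakEquivalence w)
      (hwp : w ≫ p = x.obj.f₂₄) : IsIso ((weakEquivalences M).arrow.Q.map
        (Arrow.homMk (f := Arrow.mk x.obj.f₂₄) (g := Arrow.mk p) w (𝟙 x.obj.X₄)
          (hwp.trans (Category.comp_id _).symm))) :=
    (weakEquivalences M).arrow.Q_inverts _
      ⟨(weakEquivalence_iff _).1 hw, (weakEquivalence_iff _).1 (inferInstance :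
        WeakEquivalence (𝟙 x.obj.X₄))⟩
  obtain ⟨Ξ₀, h₀, -⟩ := HoFib.existsUnique_iso_extends
    (x := P.based.hoKernelSeq x.obj.f₂₄) (y := x) (𝟙 _) (IsIso.id _)
  refine ⟨HoFib.existsUnique_extends _, P.isIso_RLoopUnit _, P.isLimitLoopFan _, P.loopMul _,
    P.isConcat_loopMul _, P.isGroupLaw_loopMul, P.derivedFan x.obj.X₄ x.obj.X₁,
    P.isLimitDerivedFan _ _, P.derivedAct (Z := x.obj.X₁) x.obj.f₂₄ ((HoFib.hoFiberObj M).mapIso Ξ₀),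
    ?_, P.isLeftAction_derivedAct _ _, ?_, ?_⟩
  · -- any factorization of `x.obj.f₂₄` implements the fibration sequence
    let F := MorphismProperty.factorizationData (trivialCofibrations M) (fibrations M) x.obj.f₂₄
    have hi : WeakEquivalence F.i := by rw [weakEquivalence_iff]; exact F.hi.2
    have hp : Fibration F.p := by rw [fibration_iff]; exact F.hp
    have hZ : IsFibrant F.Z := isFibrant_of_fibration F.p
    obtain ⟨Ξ, hΞ, -⟩ := HoFib.existsUnique_iso_extends (x := x) (y := HoFib.kernelSeq F.p)
      ((weakEquivalences M).arrow.Q.map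
        (Arrow.homMk F.i (𝟙 x.obj.X₄) (F.fac.trans (Category.comp_id _).symm)))
      (hQ F.Z F.i F.p hi F.fac)
    exact ⟨_, _, F.p, _, _, _, hp, hZ, inferInstance,
      P.isFibSeqVia_derivedAct Ξ₀ h₀ F.i F.p F.fac Ξ hΞ⟩
  · intro U w p hw hp hU hwp
    exact ⟨HoFib.existsUnique_iso_extends _ (hQ U w p hw hwp),
      fun Ξ hΞ => P.isFibSeqVia_derivedAct Ξ₀ h₀ w p hwp Ξ hΞ⟩
  · intro Ξ hΞ
    obtain rfl : Ξ = Ξ₀.hom := (HoFib.existsUnique_extends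
      (x := P.based.hoKernelSeq x.obj.f₂₄) (y := x) (𝟙 _)).unique hΞ h₀
    exact (P.connectingQ_derivedAct (Z := x.obj.X₁) x.obj.f₂₄
      ((HoFib.hoFiberObj M).mapIso Ξ₀)).symm
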